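/- For every real number $r$ there is a constant $C>0$, depending only on $r$, with the following property. Let $\Sigma$ be a closed smooth surface, let $g$ be a smooth Riemannian metric on $\Sigma$, and let $G=e^{2u}g$, with $u\in\mathcal C^\infty(\Sigma)$ and $\|u\|_{\mathcal C^0}\le r$, be a hyperbolic metric (Gauss curvature $K^G\equiv-1$) conformal to $g$. For a smooth symmetric $2$-tensor $h$ let $(\delta^g h)_j=-g^{ik}\nabla_i h_{kj}$ be its divergence, where $\nabla$ is the Levi-Civita connection of $g$, and let $$\mathcal S_{\mathrm{tt}}(g)=\{h\in \mathcal C^\infty(\Sigma;\operatorname{Sym}^2T^*\Sigma)\mid \operatorname{tr}^g h=0,\ \delta^g h=0\}$$ be the space of transverse-traceless tensors. Then every smooth symmetric $2$-tensor $\kappa$ with $\operatorname{tr}^g\kappa=0$ has a unique $L^2(\Sigma,dA_g)$-orthogonal projection $T^g\kappa$ onto $\mathcal S_{\mathrm{tt}}(g)$, that is, there is exactly one $T^g\kappa\in\mathcal S_{\mathrm{tt}}(g)$ such that $\kappa-T^g\kappa$ is $L^2(\Sigma,dA_g)$-orthogonal to $\mathcal S_{\mathrm{tt}}(g)$, and $$\|T^g\kappa-\kappa\|_{L^2(\Sigma,dA_g)}\le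 C\,\|\delta^g\kappa\|_{L^2(\Sigma,dA_g)}.$$ -/

import Mathlib

open scoped Manifold ContDiff Bundle

noncomputable section

namespace TTSurface

/-- The model space `ℝ²` of surfaces. -/
abbrev E2 : Type := EuclideanSpace ℝ (Fin 2)

/-- Smooth (Riemannian) metrics on a surface `M`. -/
abbrev Metric (M : Type*) [TopologicalSpace M] [ChartedSpace E2 M] [IsManifold 𝓘(ℝ, E2) ∞ M] :=
  Bundle.ContMDiffRiemannianMetric 𝓘(ℝ, E2) ∞ E2 (fun x : M ↦ TangentSpace 𝓘(ℝ, E2) x)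

/-- Smooth sections of `T*M ⊗ T*M`. -/
abbrev Tensor2 (M : Type*) [TopologicalSpace M] [ChartedSpace E2 M] [IsManifold 𝓘(ℝ, E2) ∞ M] :=
  ContMDiffSection 𝓘(ℝ, E2) (E2 →L[ℝ] E2 →L[ℝ] ℝ) ∞
    (fun x : M ↦ TangentSpace 𝓘(ℝ, E2) x →L[ℝ] TangentSpace 𝓘(ℝ, E2) x →L[ℝ] ℝ)

variable {M : Type*} [TopologicalSpace M] [ChartedSpace E2 M] [IsManifold 𝓘(ℝ, E2) ∞ M]

/-- Shortcut instance, needed for the vector space structure on `Tensor2 M`. -/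
instance instContinuousAddCotangent (x : M) :
    ContinuousAdd (TangentSpace 𝓘(ℝ, E2) x →L[ℝ] ℝ) :=
  inferInstanceAs (ContinuousAdd (E2 →L[ℝ] ℝ))

/-! ### Local coordinates

`c : M` names the preferred chart `chartAt E2 c`; the point `x` lies in the domain of this chart.
Scalar quantities at `x` are eventually computed in the chart named by `c = x`. -/

/-- The coordinate vector `∂ᵢ` at `x` of the chart named by `c` (the trivialization of the tangent
bundle at `c` is the one induced by that chart). -/
def coordVec (c x : M) (i : Fin 2) : TangentSpace 𝓘(ℝ, E2) x :=
  (trivializationAt E2 (TangentSpace 𝓘(ℝ, E2) : M → Type _) c).symmL ℝ x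
    (EuclideanSpace.single i 1)

/-- The coordinate covector `dxⁱ` at `x` of the chart named by `c`. -/
def coordCovec (c x : M) (i : Fin 2) : TangentSpace 𝓘(ℝ, E2) x →L[ℝ] ℝ :=
  (EuclideanSpace.proj i : E2 →L[ℝ] ℝ) ∘L
    (trivializationAt E2 (TangentSpace 𝓘(ℝ, E2) : M → Type _) c).continuousLinearMapAt ℝ x

/-- The partial derivative `∂ₖ f` at `x` in the chart named by `c`. -/
def partialDeriv (c : M) (k : Fin 2) (f : M → ℝ) (x : M) : ℝ :=
  fderiv ℝ (fun y : E2 ↦ f ((chartAt E2 c).symm y)) (chartAt E2 c x) (EuclideanSpace.single k 1)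

/-- The components `hᵢⱼ = h(∂ᵢ, ∂ⱼ)` at `x` in the chart named by `c`. -/
def components (h : ∀ x : M, TangentSpace 𝓘(ℝ, E2) x →L[ℝ] TangentSpace 𝓘(ℝ, E2) x →L[ℝ] ℝ)
    (c x : M) : Matrix (Fin 2) (Fin 2) ℝ :=
  Matrix.of fun i j ↦ h x (coordVec c x i) (coordVec c x j)

/-- The components `gⁱʲ` of the inverse metric. -/
def invMetric (g : Metric M) (c x : M) : Matrix (Fin 2) (Fin 2) ℝ :=
  (components g.inner c x)⁻¹

/-- The Christoffel symbols `Γᵏᵢⱼ = ½ gᵏˡ (∂ᵢ gⱼₗ + ∂ⱼ gᵢₗ - ∂ₗ gᵢⱼ)`. -/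
def christoffel (g : Metric M) (c : M) (k i j : Fin 2) (x : M) : ℝ :=
  (1 / 2) * ∑ l, invMetric g c x k l *
    (partialDeriv c i (fun z ↦ components g.inner c z j l) x
      + partialDeriv c j (fun z ↦ components g.inner c z i l) x
      - partialDeriv c l (fun z ↦ components g.inner c z i j) x)

/-- The curvature components `Rˡₖᵢⱼ`, with `R(∂ᵢ, ∂ⱼ)∂ₖ = Rˡₖᵢⱼ ∂ₗ` and
`R(X, Y) = ∇_X ∇_Y - ∇_Y ∇_X - ∇_[X,Y]`. -/
def riemannCurv (g : Metric M) (c : M) (l k i j : Fin 2) (x : M) : ℝ :=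
  partialDeriv c i (christoffel g c l j k) x - partialDeriv c j (christoffel g c l i k) x
    + ∑ m, (christoffel g c l i m x * christoffel g c m j k x
      - christoffel g c l j m x * christoffel g c m i k x)

/-- The Gauss curvature `K = g(R(∂₁, ∂₂)∂₂, ∂₁) / det(gᵢⱼ)`. -/
def gaussCurvature (g : Metric M) (x : M) : ℝ :=
  (∑ l, components g.inner x x 0 l * riemannCurv g x l 1 0 1 x) / (components g.inner x x).det

/-- A metric is hyperbolic if its Gauss curvature is identically `-1`. -/
def IsHyperbolic (g : Metric M) : Prop := ∀ x, gaussCurvature g x = -1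

/-! ### Trace, divergence, transverse-traceless tensors -/

/-- The trace `tr^g h = gⁱʲ hᵢⱼ`. -/
def trace (g : Metric M) (h : Tensor2 M) (x : M) : ℝ :=
  ∑ i, ∑ j, invMetric g x x i j * components h x x i j

/-- The components `(∇ᵢ h)ₖⱼ = ∂ᵢ hₖⱼ - Γᵐᵢₖ hₘⱼ - Γᵐᵢⱼ hₖₘ` of the covariant derivative. -/
def covDeriv (g : Metric M) (h : Tensor2 M) (c : M) (i k j : Fin 2) (x : M) : ℝ :=
  partialDeriv c i (fun z ↦ components h c z k j) x
    - ∑ m, (christoffel g c m i k x * components h c x m j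
      + christoffel g c m i j x * components h c x k m)

/-- The divergence `δ^g h`, the one-form `(δ^g h)ⱼ = - gⁱᵏ (∇ᵢ h)ₖⱼ`. -/
def divergence (g : Metric M) (h : Tensor2 M) (x : M) : TangentSpace 𝓘(ℝ, E2) x →L[ℝ] ℝ :=
  ∑ j, (-∑ i, ∑ k, invMetric g x x i k * covDeriv g h x i k j x) • coordCovec x x j

/-- `h` is a (smooth) symmetric trace-free tensor, i.e. a section of `S₀²(T*M)`. -/
structure IsSymmTraceFree (g : Metric M) (h : Tensor2 M) : Prop where
  symm : ∀ (x : M) (v w : TangentSpace 𝓘(ℝ, E2) x), h x v w = h x w v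
  trace_eq_zero : ∀ x, trace g h x = 0

/-- `h` belongs to the space `S_tt(g)` of (smooth) transverse-traceless symmetric tensors. -/
structure IsTT (g : Metric M) (h : Tensor2 M) : Prop extends IsSymmTraceFree g h where
  divergence_eq_zero : ∀ x, divergence g h x = 0

/-! ### The area measure and the `L²` structures -/

/-- A smooth partition of unity on `M` subordinate to the chart domains. -/
def chartPartition (M : Type*) [TopologicalSpace M] [ChartedSpace E2 M]
    [IsManifold 𝓘(ℝ, E2) ∞ M] [T2Space M] [CompactSpace M] :
    SmoothPartitionOfUnity M 𝓘(ℝ, E2) M :=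
  (SmoothPartitionOfUnity.exists_isSubordinate_chartAt_source 𝓘(ℝ, E2) M).choose

/-- The Riemannian area measure `dA_g`: in the chart named by `c` it is
`√(det gᵢⱼ) dy¹ dy²`, and these local expressions are glued by a partition of unity. -/
def areaMeasure [T2Space M] [CompactSpace M] [MeasurableSpace M] (g : Metric M) :
    MeasureTheory.Measure M :=
  MeasureTheory.Measure.sum fun c : M ↦
    (((MeasureTheory.volume : MeasureTheory.Measure E2).restrict
        (chartAt E2 c).target).withDensity fun y ↦
      ENNReal.ofReal (chartPartition M c ((chartAt E2 c).symm y) *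
        Real.sqrt (components g.inner c ((chartAt E2 c).symm y)).det)).map (chartAt E2 c).symm

/-- The pointwise inner product `⟨h, k⟩_g = gⁱᵏ gʲˡ hᵢⱼ kₖₗ` of two-tensors. -/
def tensorInner (g : Metric M) (h k : Tensor2 M) (x : M) : ℝ :=
  ∑ i, ∑ j, ∑ p, ∑ q, invMetric g x x i p * invMetric g x x j q *
    components h x x i j * components k x x p q

/-- The pointwise squared norm `|α|²_g = gⁱʲ αᵢ αⱼ` of a covector at `x`. -/
def covectorNormSq (g : Metric M) (x : M) (α : TangentSpace 𝓘(ℝ, E2) x →L[ℝ] ℝ) : ℝ :=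
  ∑ i, ∑ j, invMetric g x x i j * α (coordVec x x i) * α (coordVec x x j)

variable [T2Space M] [CompactSpace M] [MeasurableSpace M]

/-- The `L²(M, dA_g)` inner product of two-tensors. -/
def l2Inner (g : Metric M) (h k : Tensor2 M) : ℝ :=
  ∫ x, tensorInner g h k x ∂(areaMeasure g)

/-- The `L²(M, dA_g)` norm of a two-tensor. -/
def l2Norm (g : Metric M) (h : Tensor2 M) : ℝ :=
  Real.sqrt (l2Inner g h h)

/-- The `L²(M, dA_g)` norm of a one-form. -/
def l2NormForm (g : Metric M) (α : ∀ x : M, TangentSpace 𝓘(ℝ, E2) x →L[ℝ] ℝ) : ℝ :=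
  Real.sqrt (∫ x, covectorNormSq g x (α x) ∂(areaMeasure g))

/-- `τ` is the `L²(M, dA_g)`-orthogonal projection of `κ` onto `S_tt(g)`. -/
def IsTTProjection (g : Metric M) (κ τ : Tensor2 M) : Prop :=
  IsTT g τ ∧ ∀ η : Tensor2 M, IsTT g η → l2Inner g (κ - τ) η = 0

/-- `T^g κ`, the `L²(M, dA_g)`-orthogonal projection of `κ` onto `S_tt(g)`. -/
def ttProjection (g : Metric M) (κ : Tensor2 M) : Tensor2 M :=
  Classical.epsilon (IsTTProjection g κ)

end TTSurface

end

noncomputable section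

set_option linter.unusedSectionVars false

namespace TTSurface

/-! ### Tensor calculus on open subsets of the plane -/

/-! Let S X denote the trace-free part of the Lie derivative of g along X (`lieT`). For symmetric
trace-free h one has pointwise ⟨h, S X⟩ = 2 (δh)(X) + 2 div(h(X, ·)^♯) (`tinner_lieT`), so by the
divergence theorem (`integral_dvM`) S is twice the L²-adjoint of δ. Hence the transverse-traceless
tensors are exactly the smooth trace-free tensors orthogonal to the range of S, and κ - Tκ must be
looked for in the L²-closure of that range.

The estimate rests on coercivity of S. Bochner's formula reads div(∇_X X - (div X) X) = -2 det ∇X +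
K |X|² (`dv_bvec`), while |S X|² + 4 det ∇X = 2 |∇X|² ≥ 0 (`four_mul_det_cov_le`). If K = -1,
integration gives 2 ‖X‖² ≤ ‖S X‖² (`two_mul_integral_inner_le`). The pointwise norm |S X| is
conformally invariant, so passing from G to g costs only powers of e^{2r} and gives ‖X‖² ≤ c ‖S X‖²
with c = e^{6r}/2 (`integral_inner_le_of_conformal`). For s = S X it follows that ⟨κ - Tκ, s⟩ = ⟨κ,
s⟩ = 2 ∫ (δκ)(X) ≤ 2 √c ‖δκ‖ ‖s‖. Both sides are continuous in s, so s = κ - Tκ is allowed, and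
dividing by ‖κ - Tκ‖ proves the bound.

Existence needs regularity. The projection is first taken in the Hilbert completion of the smooth
trace-free tensors; it is a limit of smooth tensors that become orthogonal to the range of S
(`exists_orthogonal_of_weak_limits`). In isothermal coordinates S is the Cauchy–Riemann operator up
to the conformal factor, so the two components of the limit solve the adjoint system weakly, and a
Weyl lemma based on a mean value property makes them smooth (`weyl_lemma`,
`exists_weak_limit_chart`). A partition of unity glues the local limits (`exists_weak_limit`).

Isothermal coordinates come from hyperbolicity. On a metric of curvature -1 the equation Hess f = f
γ is a flat linear system, hence locally solvable with arbitrary 1-jet (`exists_hessian_solution`);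
two suitable solutions f, h yield the upper half-plane coordinates (h/f, 1/f)
(`IsMetricOn.exists_conformal_map`). -/

/-- Two-by-two real matrices. -/
abbrev Mat : Type := Matrix (Fin 2) (Fin 2) ℝ

/-- The standard basis vectors of the plane. -/
abbrev stdVec (k : Fin 2) : E2 := EuclideanSpace.single k 1

/-- The `k`-th partial derivative. -/
def pd (k : Fin 2) (f : E2 → ℝ) (y : E2) : ℝ := fderiv ℝ f y (stdVec k)

/-! ### Rules for partial derivatives. -/

section pd

variable {f g : E2 → ℝ} {y : E2} {k : Fin 2}

lemma pd_congr (h : f =ᶠ[nhds y] g) : pd k f y = pd k g y := by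
  simp only [pd, h.fderiv_eq]

lemma pd_congr_of_isOpen {U : Set E2} (hU : IsOpen U) (hy : y ∈ U) (h : ∀ z ∈ U, f z = g z) :
    pd k f y = pd k g y :=
  pd_congr (Filter.eventually_of_mem (hU.mem_nhds hy) h)

@[simp] lemma pd_const (c : ℝ) : pd k (fun _ ↦ c) y = 0 := by simp [pd]

lemma pd_add (hf : DifferentiableAt ℝ f y) (hg : DifferentiableAt ℝ g y) :
    pd k (fun z ↦ f z + g z) y = pd k f y + pd k g y := by
  simp only [pd]; rw [fderiv_fun_add hf hg]; rfl

lemma pd_sub (hf : DifferentiableAt ℝ f y) (hg : DifferentiableAt ℝ g y) :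
    pd k (fun z ↦ f z - g z) y = pd k f y - pd k g y := by
  simp only [pd]; rw [fderiv_fun_sub hf hg]; rfl

lemma pd_neg : pd k (fun z ↦ - f z) y = - pd k f y := by
  simp only [pd]; rw [fderiv_fun_neg]; rfl

lemma pd_mul (hf : DifferentiableAt ℝ f y) (hg : DifferentiableAt ℝ g y) :
    pd k (fun z ↦ f z * g z) y = pd k f y * g y + f y * pd k g y := by
  simp only [pd]; rw [fderiv_fun_mul hf hg]
  simp only [add_apply, smul_apply, smul_eq_mul]; ring

lemma pd_const_mul (c : ℝ) (hf : DifferentiableAt ℝ f y) :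
    pd k (fun z ↦ c * f z) y = c * pd k f y := by
  rw [pd_mul (differentiableAt_const c) hf]; simp

lemma pd_inv (hf : DifferentiableAt ℝ f y) (h0 : f y ≠ 0) :
    pd k (fun z ↦ (f z)⁻¹) y = - pd k f y / (f y) ^ 2 := by
  have h := (hasDerivAt_inv h0).comp_hasFDerivAt y hf.hasFDerivAt
  simp only [pd]
  have h' : HasFDerivAt (fun z ↦ (f z)⁻¹) (-(f y ^ 2)⁻¹ • fderiv ℝ f y) y := h
  rw [h'.fderiv]
  simp only [smul_apply, smul_eq_mul]; ring

lemma contDiffOn_pd {U : Set E2} (hU : IsOpen U) (hf : ContDiffOn ℝ ∞ f U) (k : Fin 2) :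
    ContDiffOn ℝ ∞ (pd k f) U := by
  have h := hf.fderiv_of_isOpen hU (m := ∞) (by simp)
  exact h.clm_apply contDiffOn_const

lemma ContDiffOn.differentiableAt_of_isOpen {U : Set E2} (hU : IsOpen U)
    (hf : ContDiffOn ℝ ∞ f U) (hy : y ∈ U) : DifferentiableAt ℝ f y :=
  (hf.contDiffAt (hU.mem_nhds hy)).differentiableAt (by simp)

lemma pd_comm (i j : Fin 2) (hf : ContDiffAt ℝ ∞ f y) :
    pd i (pd j f) y = pd j (pd i f) y := by
  have h2 : ContDiffAt ℝ 1 (fderiv ℝ f) y := hf.fderiv_right (m := 1) (by norm_cast)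
  have hd : DifferentiableAt ℝ (fderiv ℝ f) y := h2.differentiableAt (by simp)
  have hs : IsSymmSndFDerivAt ℝ f y := hf.isSymmSndFDerivAt (by simp; exact ENat.LEInfty.out)
  have key : ∀ a b : Fin 2, pd a (pd b f) y = fderiv ℝ (fderiv ℝ f) y (stdVec a) (stdVec b) := by
    intro a b
    have := hd.hasFDerivAt.clm_apply (hasFDerivAt_const (stdVec b) y)
    have h' : HasFDerivAt (pd b f) _ y := this
    rw [pd, h'.fderiv]; simp
  rw [key, key]
  exact hs _ _

lemma fderiv_apply_eq_sum_pd (f : E2 → ℝ) (y v : E2) :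
    fderiv ℝ f y v = v 0 * pd 0 f y + v 1 * pd 1 f y := by
  have : v = v 0 • stdVec 0 + v 1 • stdVec 1 := by
    ext i; fin_cases i <;> simp [stdVec]
  conv_lhs => rw [this]
  simp [pd]

end pd

/-! ### Metric, connection and curvature in coordinates. -/

/-- The components of a smooth Riemannian metric on an open subset of the plane. -/
structure IsMetricOn (γ : E2 → Mat) (U : Set E2) : Prop where
  isOpen : IsOpen U
  smooth : ∀ i j, ContDiffOn ℝ ∞ (fun y ↦ γ y i j) U
  symm : ∀ y ∈ U, γ y 1 0 = γ y 0 1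
  pos : ∀ y ∈ U, 0 < γ y 0 0
  det_pos : ∀ y ∈ U, 0 < γ y 0 0 * γ y 1 1 - γ y 0 1 * γ y 0 1

/-- Christoffel symbols of the metric `γ`. -/
def chr (γ : E2 → Mat) (k i j : Fin 2) (y : E2) : ℝ :=
  (1 / 2) * ∑ l, (γ y)⁻¹ k l *
    (pd i (fun z ↦ γ z j l) y + pd j (fun z ↦ γ z i l) y - pd l (fun z ↦ γ z i j) y)

/-- The Lie derivative of `γ` in the direction of the vector field `ξ`. -/
def lie (γ : E2 → Mat) (ξ : E2 → E2) (y : E2) : Mat :=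
  Matrix.of fun i j ↦ ∑ k, (ξ y k * pd k (fun z ↦ γ z i j) y
    + γ y k j * pd i (fun z ↦ ξ z k) y + γ y i k * pd j (fun z ↦ ξ z k) y)

/-- The trace of `h` with respect to `γ`. -/
def mtr (γ h : Mat) : ℝ := ∑ i, ∑ j, γ⁻¹ i j * h i j

/-- The inner product of two-tensors with respect to `γ`. -/
def minner (γ h k : Mat) : ℝ :=
  ∑ i, ∑ j, ∑ p, ∑ q, γ⁻¹ i p * γ⁻¹ j q * h i j * k p q

/-- The quadratic form of `γ`. -/
def mquad (γ : Mat) (v : E2) : ℝ := ∑ i, ∑ j, γ i j * v i * v j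

/-- The divergence of a vector field with respect to `γ`. -/
def dv (γ : E2 → Mat) (ξ : E2 → E2) (y : E2) : ℝ := (1 / 2) * mtr (γ y) (lie γ ξ y)

/-- The trace-free part of the Lie derivative. -/
def lieTF (γ : E2 → Mat) (ξ : E2 → E2) (y : E2) : Mat :=
  lie γ ξ y - dv γ ξ y • γ y

/-- The components of the covariant derivative `∇ξ`, with `cov γ ξ k i = (∇ᵢ ξ)ᵏ`. -/
def cov (γ : E2 → Mat) (ξ : E2 → E2) (k i : Fin 2) (y : E2) : ℝ :=
  pd i (fun z ↦ ξ z k) y + ∑ m, chr γ k i m y * ξ y m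

/-- The curvature components `Rˡₖ₀₁` of the metric `γ`. -/
def rc (γ : E2 → Mat) (l k : Fin 2) (y : E2) : ℝ :=
  pd 0 (chr γ l 1 k) y - pd 1 (chr γ l 0 k) y
    + ∑ m, (chr γ l 0 m y * chr γ m 1 k y - chr γ l 1 m y * chr γ m 0 k y)

/-- The Gauss curvature of the metric `γ`. -/
def gc (γ : E2 → Mat) (y : E2) : ℝ := (∑ l, γ y 0 l * rc γ l 1 y) / (γ y).det

lemma inv_apply_fin_two (γ : Mat) :
    γ⁻¹ 0 0 = γ 1 1 / γ.det ∧ γ⁻¹ 0 1 = - γ 0 1 / γ.det ∧ γ⁻¹ 1 0 = - γ 1 0 / γ.det ∧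
      γ⁻¹ 1 1 = γ 0 0 / γ.det := by
  simp only [Matrix.inv_def, Matrix.adjugate_fin_two, Ring.inverse_eq_inv', Matrix.smul_apply,
    Matrix.of_apply, Matrix.cons_val', Matrix.cons_val_zero, Matrix.cons_val_one, smul_eq_mul]
  refine ⟨?_, ?_, ?_, ?_⟩ <;> simp [div_eq_inv_mul]

namespace IsMetricOn

variable {γ : E2 → Mat} {U : Set E2} (hγ : IsMetricOn γ U) {y : E2}
include hγ

lemma det_eq (hy : y ∈ U) : (γ y).det = γ y 0 0 * γ y 1 1 - γ y 0 1 * γ y 0 1 := by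
  rw [Matrix.det_fin_two, hγ.symm y hy]

lemma det_pos' (hy : y ∈ U) : 0 < (γ y).det := by
  rw [hγ.det_eq hy]; exact hγ.det_pos y hy

lemma inv_symm (hy : y ∈ U) : (γ y)⁻¹ 1 0 = (γ y)⁻¹ 0 1 := by
  obtain ⟨-, h1, h2, -⟩ := inv_apply_fin_two (γ y)
  rw [h1, h2, hγ.symm y hy]

lemma contDiffOn_det : ContDiffOn ℝ ∞ (fun y ↦ (γ y).det) U := by
  simp only [Matrix.det_fin_two]
  exact ((hγ.smooth 0 0).mul (hγ.smooth 1 1)).sub ((hγ.smooth 0 1).mul (hγ.smooth 1 0))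

lemma contDiffOn_inv (i j : Fin 2) : ContDiffOn ℝ ∞ (fun y ↦ (γ y)⁻¹ i j) U := by
  have h0 : ∀ y ∈ U, (γ y).det ≠ 0 := fun y hy ↦ (hγ.det_pos' hy).ne'
  have hd := hγ.contDiffOn_det
  fin_cases i <;> fin_cases j
  · exact ((hγ.smooth 1 1).div hd h0).congr fun y _ ↦ (inv_apply_fin_two (γ y)).1
  · exact ((hγ.smooth 0 1).neg.div hd h0).congr fun y _ ↦ (inv_apply_fin_two (γ y)).2.1
  · exact ((hγ.smooth 1 0).neg.div hd h0).congr fun y _ ↦ (inv_apply_fin_two (γ y)).2.2.1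
  · exact ((hγ.smooth 0 0).div hd h0).congr fun y _ ↦ (inv_apply_fin_two (γ y)).2.2.2

lemma contDiffOn_chr (k i j : Fin 2) : ContDiffOn ℝ ∞ (chr γ k i j) U := by
  unfold chr
  refine contDiffOn_const.mul (ContDiffOn.sum fun l _ ↦ (hγ.contDiffOn_inv k l).mul ?_)
  exact ((contDiffOn_pd hγ.isOpen (hγ.smooth _ _) _).add
    (contDiffOn_pd hγ.isOpen (hγ.smooth _ _) _)).sub (contDiffOn_pd hγ.isOpen (hγ.smooth _ _) _)

lemma differentiableAt (hy : y ∈ U) (i j : Fin 2) : DifferentiableAt ℝ (fun y ↦ γ y i j) y :=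
  ContDiffOn.differentiableAt_of_isOpen hγ.isOpen (hγ.smooth i j) hy

lemma differentiableAt_inv (hy : y ∈ U) (i j : Fin 2) :
    DifferentiableAt ℝ (fun y ↦ (γ y)⁻¹ i j) y :=
  ContDiffOn.differentiableAt_of_isOpen hγ.isOpen (hγ.contDiffOn_inv i j) hy

lemma differentiableAt_chr (hy : y ∈ U) (k i j : Fin 2) : DifferentiableAt ℝ (chr γ k i j) y :=
  ContDiffOn.differentiableAt_of_isOpen hγ.isOpen (hγ.contDiffOn_chr k i j) hy

lemma pd_symm (hy : y ∈ U) (k : Fin 2) :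
    pd k (fun z ↦ γ z 1 0) y = pd k (fun z ↦ γ z 0 1) y :=
  pd_congr_of_isOpen hγ.isOpen hy hγ.symm

lemma chr_symm (hy : y ∈ U) (k : Fin 2) : chr γ k 1 0 y = chr γ k 0 1 y := by
  simp only [chr, Fin.sum_univ_two, hγ.pd_symm hy]
  ring

/-- The relations `∑ γₐₘ γᵐᵇ = δₐᵇ`, spelled out. -/
lemma inv_rel (hy : y ∈ U) :
    γ y 0 0 * (γ y)⁻¹ 0 0 + γ y 0 1 * (γ y)⁻¹ 0 1 = 1 ∧
    γ y 0 0 * (γ y)⁻¹ 0 1 + γ y 0 1 * (γ y)⁻¹ 1 1 = 0 ∧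
    γ y 0 1 * (γ y)⁻¹ 0 0 + γ y 1 1 * (γ y)⁻¹ 0 1 = 0 ∧
    γ y 0 1 * (γ y)⁻¹ 0 1 + γ y 1 1 * (γ y)⁻¹ 1 1 = 1 := by
  obtain ⟨h0, h1, -, h3⟩ := inv_apply_fin_two (γ y)
  have hd := (hγ.det_pos' hy).ne'
  have he := hγ.det_eq hy
  rw [h0, h1, h3]
  refine ⟨?_, ?_, ?_, ?_⟩ <;> field_simp <;> rw [he] <;> ring

/-- Compatibility of the Levi-Civita connection with the metric. -/
lemma pd_metric (hy : y ∈ U) (i : Fin 2) :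
    pd i (fun z ↦ γ z 0 0) y = 2 * (γ y 0 0 * chr γ 0 i 0 y + γ y 0 1 * chr γ 1 i 0 y) ∧
    pd i (fun z ↦ γ z 0 1) y = γ y 0 0 * chr γ 0 i 1 y + γ y 0 1 * chr γ 1 i 1 y
      + γ y 0 1 * chr γ 0 i 0 y + γ y 1 1 * chr γ 1 i 0 y ∧
    pd i (fun z ↦ γ z 1 1) y = 2 * (γ y 0 1 * chr γ 0 i 1 y + γ y 1 1 * chr γ 1 i 1 y) := by
  obtain ⟨h0, h1, h2, h3⟩ := hγ.inv_rel hy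
  have hs := hγ.pd_symm hy
  simp only [chr, Fin.sum_univ_two, hγ.inv_symm hy]
  generalize (γ y)⁻¹ 0 0 = a at *
  generalize (γ y)⁻¹ 0 1 = b at *
  generalize (γ y)⁻¹ 1 1 = c at *
  fin_cases i <;> simp only [Fin.zero_eta, Fin.mk_one, hs] <;>
  refine ⟨?_, ?_, ?_⟩
  · linear_combination -(pd 0 (fun z ↦ γ z 0 0) y) * h0 -
      (2 * pd 0 (fun z ↦ γ z 0 1) y - pd 1 (fun z ↦ γ z 0 0) y) * h1
  · linear_combination -(pd 1 (fun z ↦ γ z 0 0) y)/2 * h0 - pd 0 (fun z ↦ γ z 1 1) y / 2 * h1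
      - pd 0 (fun z ↦ γ z 0 0) y / 2 * h2 -
        (pd 0 (fun z ↦ γ z 0 1) y - pd 1 (fun z ↦ γ z 0 0) y/2) * h3
  · linear_combination -(pd 1 (fun z ↦ γ z 0 0) y) * h2 - pd 0 (fun z ↦ γ z 1 1) y * h3
  · linear_combination -(pd 1 (fun z ↦ γ z 0 0) y) * h0 - pd 0 (fun z ↦ γ z 1 1) y * h1
  · linear_combination -(pd 1 (fun z ↦ γ z 0 1) y - pd 0 (fun z ↦ γ z 1 1) y/2) * h0
      - pd 1 (fun z ↦ γ z 1 1) y / 2 * h1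
      - pd 1 (fun z ↦ γ z 0 0) y / 2 * h2 - pd 0 (fun z ↦ γ z 1 1) y/2 * h3
  · linear_combination -(2 * pd 1 (fun z ↦ γ z 0 1) y - pd 0 (fun z ↦ γ z 1 1) y) * h2
      - pd 1 (fun z ↦ γ z 1 1) y * h3

end IsMetricOn

end TTSurface

/-! ### Lie derivative and divergence in covariant form. -/

namespace TTSurface

namespace IsMetricOn

variable {γ : E2 → Mat} {U : Set E2} (hγ : IsMetricOn γ U) {y : E2}
include hγ

/-- This is ∇γ⁻¹ = 0. The relations γγ⁻¹ = 1 are differentiated, the derivatives of γ are eliminated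
by `pd_metric`, and the resulting linear system is solved by multiplying with γ⁻¹ again. -/
lemma pd_inv_metric (hy : y ∈ U) (i : Fin 2) :
    pd i (fun z ↦ (γ z)⁻¹ 0 0) y
      = -2 * ((γ y)⁻¹ 0 0 * chr γ 0 i 0 y + (γ y)⁻¹ 0 1 * chr γ 0 i 1 y) ∧
    pd i (fun z ↦ (γ z)⁻¹ 0 1) y
      = -((γ y)⁻¹ 0 0 * chr γ 1 i 0 y + (γ y)⁻¹ 0 1 * chr γ 1 i 1 y
        + (γ y)⁻¹ 0 1 * chr γ 0 i 0 y + (γ y)⁻¹ 1 1 * chr γ 0 i 1 y) ∧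
    pd i (fun z ↦ (γ z)⁻¹ 1 1) y
      = -2 * ((γ y)⁻¹ 0 1 * chr γ 1 i 0 y + (γ y)⁻¹ 1 1 * chr γ 1 i 1 y) := by
  have D := fun i j ↦ hγ.differentiableAt hy i j
  have D' := fun i j ↦ hγ.differentiableAt_inv hy i j
  have der : ∀ (f₁ f₂ f₃ f₄ : E2 → ℝ) (t : ℝ), DifferentiableAt ℝ f₁ y → DifferentiableAt ℝ f₂ y →
      DifferentiableAt ℝ f₃ y → DifferentiableAt ℝ f₄ y →
      (∀ z ∈ U, f₁ z * f₂ z + f₃ z * f₄ z = t) →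
      pd i f₁ y * f₂ y + f₁ y * pd i f₂ y + (pd i f₃ y * f₄ y + f₃ y * pd i f₄ y) = 0 := by
    intro f₁ f₂ f₃ f₄ t h1 h2 h3 h4 h
    have := pd_congr_of_isOpen (k := i) hγ.isOpen hy h
    rwa [pd_const, pd_add (h1.fun_mul h2) (h3.fun_mul h4), pd_mul h1 h2, pd_mul h3 h4] at this
  have r1 := der _ _ _ _ _ (D 0 0) (D' 0 0) (D 0 1) (D' 0 1) fun z hz ↦ (hγ.inv_rel hz).1
  have r2 := der _ _ _ _ _ (D 0 0) (D' 0 1) (D 0 1) (D' 1 1) fun z hz ↦ (hγ.inv_rel hz).2.1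
  have r3 := der _ _ _ _ _ (D 0 1) (D' 0 0) (D 1 1) (D' 0 1) fun z hz ↦ (hγ.inv_rel hz).2.2.1
  have r4 := der _ _ _ _ _ (D 0 1) (D' 0 1) (D 1 1) (D' 1 1) fun z hz ↦ (hγ.inv_rel hz).2.2.2
  obtain ⟨h0, h1, h2, h3⟩ := hγ.inv_rel hy
  obtain ⟨hE, hF, hG⟩ := hγ.pd_metric hy i
  generalize pd i (fun z ↦ (γ z)⁻¹ 0 0) y = a' at *
  generalize pd i (fun z ↦ (γ z)⁻¹ 0 1) y = b' at *
  generalize pd i (fun z ↦ (γ z)⁻¹ 1 1) y = c' at *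
  generalize (γ y)⁻¹ 0 0 = a at *
  generalize (γ y)⁻¹ 0 1 = b at *
  generalize (γ y)⁻¹ 1 1 = c at *
  rw [hE, hF] at r1 r2
  rw [hF, hG] at r3 r4
  generalize chr γ 0 i 0 y = G00 at *
  generalize chr γ 0 i 1 y = G01 at *
  generalize chr γ 1 i 0 y = G10 at *
  generalize chr γ 1 i 1 y = G11 at *
  refine ⟨?_, ?_, ?_⟩
  · linear_combination a * r1 + b * r3 - (a' + 2 * a * G00 + 2 * b * G01) * h0
      - (b' + 2 * a * G10 + 2 * b * G11) * h2
  · linear_combination b * r1 + c * r3 - (a' + a * G00 + b * G01) * h1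
      - (b' + a * G10 + b * G11) * h3 - (b * G00 + c * G01) * h0 - (b * G10 + c * G11) * h2
  · linear_combination b * r2 + c * r4 - (b' + 2 * b * G00 + 2 * c * G01) * h1
      - (c' + 2 * b * G10 + 2 * c * G11) * h3

/-- Metric compatibility and symmetry of the Christoffel symbols turn the partial derivatives into
covariant ones: (L_ξ γ)ᵢⱼ = ∇ᵢξⱼ + ∇ⱼξᵢ. -/
lemma lie_apply (hy : y ∈ U) (ξ : E2 → E2) :
    lie γ ξ y 0 0 = 2 * (γ y 0 0 * cov γ ξ 0 0 y + γ y 0 1 * cov γ ξ 1 0 y) ∧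
    lie γ ξ y 0 1 = γ y 0 1 * cov γ ξ 0 0 y + γ y 1 1 * cov γ ξ 1 0 y
      + γ y 0 0 * cov γ ξ 0 1 y + γ y 0 1 * cov γ ξ 1 1 y ∧
    lie γ ξ y 1 0 = lie γ ξ y 0 1 ∧
    lie γ ξ y 1 1 = 2 * (γ y 0 1 * cov γ ξ 0 1 y + γ y 1 1 * cov γ ξ 1 1 y) := by
  obtain ⟨hE0, hF0, hG0⟩ := hγ.pd_metric hy 0
  obtain ⟨hE1, hF1, hG1⟩ := hγ.pd_metric hy 1
  simp only [lie, cov, Matrix.of_apply, Fin.sum_univ_two, hγ.pd_symm hy, hγ.symm y hy, hE0, hF0,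
    hG0, hE1, hF1, hG1, hγ.chr_symm hy]
  refine ⟨?_, ?_, ?_, ?_⟩ <;> ring

lemma dv_eq_cov (hy : y ∈ U) (ξ : E2 → E2) : dv γ ξ y = cov γ ξ 0 0 y + cov γ ξ 1 1 y := by
  obtain ⟨l0, l1, l2, l3⟩ := hγ.lie_apply hy ξ
  obtain ⟨h0, h1, h2, h3⟩ := hγ.inv_rel hy
  simp only [dv, mtr, Fin.sum_univ_two, l2, l0, l1, l3, hγ.inv_symm hy]
  linear_combination cov γ ξ 0 0 y * h0 + cov γ ξ 1 0 y * h2 + cov γ ξ 0 1 y * h1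
    + cov γ ξ 1 1 y * h3

/-- The divergence in terms of the area density. -/
lemma sqrt_det_mul_dv (hy : y ∈ U) {ξ : E2 → E2}
    (hξ : ∀ i, DifferentiableAt ℝ (fun z ↦ ξ z i) y) :
    √(γ y).det * dv γ ξ y = pd 0 (fun z ↦ √(γ z).det * ξ z 0) y
      + pd 1 (fun z ↦ √(γ z).det * ξ z 1) y := by
  have hD := hγ.det_pos' hy
  have hdd : DifferentiableAt ℝ (fun z ↦ (γ z).det) y :=
    ContDiffOn.differentiableAt_of_isOpen hγ.isOpen hγ.contDiffOn_det hy
  have hds : DifferentiableAt ℝ (fun z ↦ √(γ z).det) y := hdd.sqrt hD.ne'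
  -- Jacobi's formula: the logarithmic derivative of the area density is the contracted Christoffel
  -- symbol.
  have hpd : ∀ k, pd k (fun z ↦ √(γ z).det) y
      = √(γ y).det * (chr γ 0 k 0 y + chr γ 1 k 1 y) := by
    intro k
    have e1 : pd k (fun z ↦ √(γ z).det) y = pd k (fun z ↦ (γ z).det) y / (2 * √(γ y).det) := by
      simp only [pd]
      rw [fderiv_sqrt hdd hD.ne']
      simp only [smul_apply, smul_eq_mul]; ring
    have e2 : pd k (fun z ↦ (γ z).det) y
        = 2 * (γ y).det * (chr γ 0 k 0 y + chr γ 1 k 1 y) := by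
      have := pd_congr_of_isOpen (k := k) hγ.isOpen hy fun z hz ↦ hγ.det_eq hz
      obtain ⟨hE, hF, hG⟩ := hγ.pd_metric hy k
      have D := fun i j ↦ hγ.differentiableAt hy i j
      rw [this, pd_sub ((D 0 0).fun_mul (D 1 1)) ((D 0 1).fun_mul (D 0 1)), pd_mul (D 0 0) (D 1 1),
        pd_mul (D 0 1) (D 0 1), hE, hF, hG, hγ.det_eq hy]
      ring
    rw [e1, e2]
    have hs := Real.sqrt_pos.2 hD
    have hsq := Real.mul_self_sqrt hD.le
    field_simp
    linear_combination -(chr γ 0 k 0 y + chr γ 1 k 1 y) * hsq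
  rw [hγ.dv_eq_cov hy, pd_mul hds (hξ 0), pd_mul hds (hξ 1), hpd, hpd]
  simp only [cov, Fin.sum_univ_two, hγ.chr_symm hy]
  ring

/-- The polarised form of `minner γ h (lieTF γ ξ)` for trace-free `h`. -/
lemma minner_lieTF (hy : y ∈ U) (ξ : E2 → E2) {h : Mat} (hs : h 1 0 = h 0 1)
    (ht : mtr (γ y) h = 0) :
    minner (γ y) h (lieTF γ ξ y) = 2 * ∑ i, ∑ j, ∑ p, (γ y)⁻¹ i p * h i j * cov γ ξ j p y := by
  obtain ⟨l0, l1, l2, l3⟩ := hγ.lie_apply hy ξ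
  have hd := hγ.dv_eq_cov hy ξ
  have hD := (hγ.det_pos' hy).ne'
  obtain ⟨i0, i1, i2, i3⟩ := inv_apply_fin_two (γ y)
  simp only [mtr, Fin.sum_univ_two, hs, i0, i1, i2, i3, hγ.symm y hy] at ht
  simp only [minner, lieTF, Matrix.sub_apply, Matrix.smul_apply, smul_eq_mul, Fin.sum_univ_two, l2,
    l0, l1, l3, hd, hs, i0, i1, i2, i3, hγ.symm y hy]
  have he := hγ.det_eq hy
  generalize (γ y).det = D at *
  generalize γ y 0 0 = E at *
  generalize γ y 0 1 = F at *
  generalize γ y 1 1 = G at *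
  generalize h 0 0 = h0 at *
  generalize h 0 1 = h1 at *
  generalize h 1 1 = h3 at *
  generalize cov γ ξ 0 0 y = A at *
  generalize cov γ ξ 0 1 y = B at *
  generalize cov γ ξ 1 0 y = C at *
  generalize cov γ ξ 1 1 y = D' at *
  field_simp at ht ⊢
  subst he
  -- The summand `dv γ ξ y • γ y` pairs with `h` to div ξ = A + D' times the trace of `h`; this is
  -- the only place where trace-freeness enters.
  linear_combination (-(A + D') * (E * G - F * F)) * ht

end IsMetricOn

end TTSurface

/-! ### Pointwise integration by parts and Bochner's formula. -/

namespace TTSurface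

/-- The components of the divergence of a two-tensor. -/
def ldiv (γ h : E2 → Mat) (j : Fin 2) (y : E2) : ℝ :=
  -∑ i, ∑ k, (γ y)⁻¹ i k * (pd i (fun z ↦ h z k j) y
    - ∑ m, (chr γ m i k y * h y m j + chr γ m i j y * h y k m))

/-- The vector field dual to the one-form `h(ξ, ·)`. -/
def sharp (γ h : E2 → Mat) (ξ : E2 → E2) (y : E2) : E2 :=
  WithLp.toLp 2 fun i ↦ ∑ j, (γ y)⁻¹ i j * ∑ k, h y j k * ξ y k

/-- The vector field `∇_ξ ξ - (div ξ) ξ`, expressed by the Lie derivative of the metric. -/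
def bvec (γ : E2 → Mat) (ξ : E2 → E2) (y : E2) : E2 :=
  WithLp.toLp 2 fun i ↦ ∑ j, (γ y)⁻¹ i j *
    ((∑ k, lieTF γ ξ y j k * ξ y k) - (1 / 2) * pd j (fun z ↦ mquad (γ z) (ξ z)) y)

namespace IsMetricOn

variable {γ : E2 → Mat} {U : Set E2} (hγ : IsMetricOn γ U) {y : E2}
include hγ

/-- Leibniz rule: half the left side is hⁱʲ∇ᵢξⱼ = ∇ᵢ(hⁱʲξⱼ) - (∇ᵢhⁱʲ)ξⱼ, and `ldiv` contains the
minus sign. Once the total divergence integrates to zero, ξ ↦ `lieTF γ ξ` is twice the formal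
adjoint of the divergence. -/
lemma minner_lieTF_eq_ldiv_add_dv (hy : y ∈ U) {ξ : E2 → E2} {h : E2 → Mat}
    (hξ : ∀ i, DifferentiableAt ℝ (fun z ↦ ξ z i) y)
    (hh : ∀ i j, DifferentiableAt ℝ (fun z ↦ h z i j) y)
    (hs : ∀ z ∈ U, h z 1 0 = h z 0 1) (ht : mtr (γ y) (h y) = 0) :
    minner (γ y) (h y) (lieTF γ ξ y)
      = 2 * ∑ j, ldiv γ h j y * ξ y j + 2 * dv γ (sharp γ h ξ) y := by
  rw [hγ.minner_lieTF hy ξ (hs y hy) ht, hγ.dv_eq_cov hy]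
  have D' := fun i j ↦ hγ.differentiableAt_inv hy i j
  have hps : ∀ i, pd i (fun z ↦ h z 1 0) y = pd i (fun z ↦ h z 0 1) y := fun i ↦
    pd_congr_of_isOpen hγ.isOpen hy hs
  have hpi : ∀ i, pd i (fun z ↦ (γ z)⁻¹ 1 0) y = pd i (fun z ↦ (γ z)⁻¹ 0 1) y := fun i ↦
    pd_congr_of_isOpen hγ.isOpen hy fun z hz ↦ hγ.inv_symm hz
  obtain ⟨ha0, hb0, -⟩ := hγ.pd_inv_metric hy 0
  obtain ⟨-, hb1, hc1⟩ := hγ.pd_inv_metric hy 1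
  have H : ∀ j k, DifferentiableAt ℝ (fun z ↦ h z j k * ξ z k) y := fun j k ↦
    (hh j k).fun_mul (hξ k)
  have hpd : ∀ a i, pd a (fun z ↦ sharp γ h ξ z i) y
      = pd a (fun z ↦ (γ z)⁻¹ i 0) y * (h y 0 0 * ξ y 0 + h y 0 1 * ξ y 1)
        + (γ y)⁻¹ i 0 * (pd a (fun z ↦ h z 0 0) y * ξ y 0 + h y 0 0 * pd a (fun z ↦ ξ z 0) y
          + (pd a (fun z ↦ h z 0 1) y * ξ y 1 + h y 0 1 * pd a (fun z ↦ ξ z 1) y))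
        + (pd a (fun z ↦ (γ z)⁻¹ i 1) y * (h y 0 1 * ξ y 0 + h y 1 1 * ξ y 1)
        + (γ y)⁻¹ i 1 * (pd a (fun z ↦ h z 0 1) y * ξ y 0 + h y 0 1 * pd a (fun z ↦ ξ z 0) y
          + (pd a (fun z ↦ h z 1 1) y * ξ y 1 + h y 1 1 * pd a (fun z ↦ ξ z 1) y))) := by
    intro a i
    simp only [sharp, Fin.sum_univ_two]
    rw [pd_add ((D' i 0).fun_mul ((H 0 0).fun_add (H 0 1)))
        ((D' i 1).fun_mul ((H 1 0).fun_add (H 1 1))),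
      pd_mul (D' i 0) ((H 0 0).fun_add (H 0 1)), pd_mul (D' i 1) ((H 1 0).fun_add (H 1 1)),
      pd_add (H 0 0) (H 0 1), pd_add (H 1 0) (H 1 1), pd_mul (hh 0 0) (hξ 0),
      pd_mul (hh 0 1) (hξ 1), pd_mul (hh 1 0) (hξ 0), pd_mul (hh 1 1) (hξ 1), hps, hs y hy]
  have hv : ∀ i, sharp γ h ξ y i = (γ y)⁻¹ i 0 * (h y 0 0 * ξ y 0 + h y 0 1 * ξ y 1)
      + (γ y)⁻¹ i 1 * (h y 0 1 * ξ y 0 + h y 1 1 * ξ y 1) := by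
    intro i
    simp only [sharp, Fin.sum_univ_two, hs y hy]
  simp only [cov, Fin.sum_univ_two, hpd, hv, ldiv, hpi, ha0, hb0, hb1, hc1,
    hγ.inv_symm hy, hγ.chr_symm hy, hps, hs y hy]
  ring

lemma lieTF_apply (hy : y ∈ U) (ξ : E2 → E2) (i j : Fin 2) :
    lieTF γ ξ y i j = lie γ ξ y i j - (cov γ ξ 0 0 y + cov γ ξ 1 1 y) * γ y i j := by
  simp [lieTF, hγ.dv_eq_cov hy]

lemma contDiffOn_cov {ξ : E2 → E2} (hξ : ∀ i, ContDiffOn ℝ ∞ (fun z ↦ ξ z i) U) (k i : Fin 2) :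
    ContDiffOn ℝ ∞ (cov γ ξ k i) U :=
  (contDiffOn_pd hγ.isOpen (hξ k) i).add
    (ContDiffOn.sum fun m _ ↦ (hγ.contDiffOn_chr k i m).mul (hξ m))

/-- Metric compatibility: d|ξ|² = 2⟨∇ξ, ξ⟩. -/
lemma pd_mquad (hy : y ∈ U) {ξ : E2 → E2} (hξ : ∀ i, DifferentiableAt ℝ (fun z ↦ ξ z i) y)
    (j : Fin 2) :
    pd j (fun z ↦ mquad (γ z) (ξ z)) y
      = 2 * (cov γ ξ 0 j y * (γ y 0 0 * ξ y 0 + γ y 0 1 * ξ y 1)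
        + cov γ ξ 1 j y * (γ y 0 1 * ξ y 0 + γ y 1 1 * ξ y 1)) := by
  have D := fun i j ↦ hγ.differentiableAt hy i j
  have e : ∀ z ∈ U, mquad (γ z) (ξ z) = γ z 0 0 * (ξ z 0 * ξ z 0)
      + (2 * γ z 0 1) * (ξ z 0 * ξ z 1) + γ z 1 1 * (ξ z 1 * ξ z 1) := by
    intro z hz
    simp only [mquad, Fin.sum_univ_two, hγ.symm z hz]; ring
  obtain ⟨hE, hF, hG⟩ := hγ.pd_metric hy j
  have Dξ := fun i j ↦ (hξ i).fun_mul (hξ j)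
  rw [pd_congr_of_isOpen hγ.isOpen hy e,
    pd_add (((D 0 0).fun_mul (Dξ 0 0)).fun_add (((D 0 1).const_mul 2).fun_mul (Dξ 0 1)))
      ((D 1 1).fun_mul (Dξ 1 1)),
    pd_add ((D 0 0).fun_mul (Dξ 0 0)) (((D 0 1).const_mul 2).fun_mul (Dξ 0 1)),
    pd_mul (D 0 0) (Dξ 0 0), pd_mul ((D 0 1).const_mul 2) (Dξ 0 1), pd_mul (D 1 1) (Dξ 1 1),
    pd_const_mul 2 (D 0 1), pd_mul (hξ 0) (hξ 0), pd_mul (hξ 0) (hξ 1), pd_mul (hξ 1) (hξ 1),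
    hE, hF, hG]
  simp only [cov, Fin.sum_univ_two]
  ring

/-- In (L_ξ γ)(ξ, ·) - ½ d|ξ|² the terms ⟨∇ⱼξ, ξ⟩ cancel and ∇_ξ ξ remains. `bvec` is defined
without Christoffel symbols so that its independence of coordinates is immediate; this formula is
the one used for computing. -/
lemma bvec_apply (hy : y ∈ U) {ξ : E2 → E2} (hξ : ∀ i, DifferentiableAt ℝ (fun z ↦ ξ z i) y)
    (i : Fin 2) :
    bvec γ ξ y i = ξ y 0 * cov γ ξ i 0 y + ξ y 1 * cov γ ξ i 1 y
      - ξ y i * (cov γ ξ 0 0 y + cov γ ξ 1 1 y) := by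
  obtain ⟨l0, l1, l2, l3⟩ := hγ.lie_apply hy ξ
  obtain ⟨h0, h1, h2, h3⟩ := hγ.inv_rel hy
  simp only [bvec, Fin.sum_univ_two, hγ.pd_mquad hy hξ, hγ.lieTF_apply hy, l0, l1, l2, l3,
    hγ.symm y hy]
  fin_cases i <;> simp only [Fin.zero_eta, Fin.mk_one, hγ.inv_symm hy]
  all_goals
    generalize cov γ ξ 0 0 y = A at *
    generalize cov γ ξ 0 1 y = B at *
    generalize cov γ ξ 1 0 y = C at *
    generalize cov γ ξ 1 1 y = D' at *
  · linear_combination (ξ y 1 * B - ξ y 0 * D') * h0 + (ξ y 0 * C - ξ y 1 * A) * h2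
  · linear_combination (ξ y 1 * B - ξ y 0 * D') * h1 + (ξ y 0 * C - ξ y 1 * A) * h3

/-- The curvature components are determined by the Gauss curvature. -/
lemma rc_eq (hy : y ∈ U) :
    rc γ 0 0 y = gc γ y * γ y 0 1 ∧ rc γ 0 1 y = gc γ y * γ y 1 1 ∧
      rc γ 1 0 y = - (gc γ y * γ y 0 0) ∧ rc γ 1 1 y = - (gc γ y * γ y 0 1) := by
  have D := fun i j ↦ hγ.differentiableAt hy i j
  have Dc := fun k i j ↦ hγ.differentiableAt_chr hy k i j
  have sm : ∀ i j, ContDiffAt ℝ ∞ (fun z ↦ γ z i j) y := fun i j ↦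
    (hγ.smooth i j).contDiffAt (hγ.isOpen.mem_nhds hy)
  have comm := fun i j ↦ pd_comm 0 1 (sm i j)
  -- Second derivatives of γ are obtained by differentiating the compatibility equations. Their
  -- symmetry says that the curvature with lowered index is antisymmetric in its first two slots
  -- (`R00`, `R11`, `R01` below), so that in dimension two a single number remains.
  have cE : ∀ i j, pd j (pd i (fun z ↦ γ z 0 0)) y
      = 2 * (pd j (fun z ↦ γ z 0 0) y * chr γ 0 i 0 y + γ y 0 0 * pd j (chr γ 0 i 0) y
        + (pd j (fun z ↦ γ z 0 1) y * chr γ 1 i 0 y + γ y 0 1 * pd j (chr γ 1 i 0) y)) := by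
    intro i j
    rw [pd_congr_of_isOpen hγ.isOpen hy fun z hz ↦ (hγ.pd_metric hz i).1,
      pd_const_mul 2 (((D 0 0).fun_mul (Dc 0 i 0)).fun_add ((D 0 1).fun_mul (Dc 1 i 0))),
      pd_add ((D 0 0).fun_mul (Dc 0 i 0)) ((D 0 1).fun_mul (Dc 1 i 0)),
      pd_mul (D 0 0) (Dc 0 i 0), pd_mul (D 0 1) (Dc 1 i 0)]
  have cG : ∀ i j, pd j (pd i (fun z ↦ γ z 1 1)) y
      = 2 * (pd j (fun z ↦ γ z 0 1) y * chr γ 0 i 1 y + γ y 0 1 * pd j (chr γ 0 i 1) y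
        + (pd j (fun z ↦ γ z 1 1) y * chr γ 1 i 1 y + γ y 1 1 * pd j (chr γ 1 i 1) y)) := by
    intro i j
    rw [pd_congr_of_isOpen hγ.isOpen hy fun z hz ↦ (hγ.pd_metric hz i).2.2,
      pd_const_mul 2 (((D 0 1).fun_mul (Dc 0 i 1)).fun_add ((D 1 1).fun_mul (Dc 1 i 1))),
      pd_add ((D 0 1).fun_mul (Dc 0 i 1)) ((D 1 1).fun_mul (Dc 1 i 1)),
      pd_mul (D 0 1) (Dc 0 i 1), pd_mul (D 1 1) (Dc 1 i 1)]
  have cF : ∀ i j, pd j (pd i (fun z ↦ γ z 0 1)) y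
      = pd j (fun z ↦ γ z 0 0) y * chr γ 0 i 1 y + γ y 0 0 * pd j (chr γ 0 i 1) y
        + (pd j (fun z ↦ γ z 0 1) y * chr γ 1 i 1 y + γ y 0 1 * pd j (chr γ 1 i 1) y)
        + (pd j (fun z ↦ γ z 0 1) y * chr γ 0 i 0 y + γ y 0 1 * pd j (chr γ 0 i 0) y)
        + (pd j (fun z ↦ γ z 1 1) y * chr γ 1 i 0 y + γ y 1 1 * pd j (chr γ 1 i 0) y) := by
    intro i j
    have m1 := (D 0 0).fun_mul (Dc 0 i 1)
    have m2 := (D 0 1).fun_mul (Dc 1 i 1)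
    have m3 := (D 0 1).fun_mul (Dc 0 i 0)
    have m4 := (D 1 1).fun_mul (Dc 1 i 0)
    rw [pd_congr_of_isOpen hγ.isOpen hy fun z hz ↦ (hγ.pd_metric hz i).2.1,
      pd_add ((m1.fun_add m2).fun_add m3) m4, pd_add (m1.fun_add m2) m3, pd_add m1 m2,
      pd_mul (D 0 0) (Dc 0 i 1), pd_mul (D 0 1) (Dc 1 i 1), pd_mul (D 0 1) (Dc 0 i 0),
      pd_mul (D 1 1) (Dc 1 i 0)]
  have eE := comm 0 0
  have eF := comm 0 1
  have eG := comm 1 1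
  rw [cE, cE] at eE
  rw [cF, cF] at eF
  rw [cG, cG] at eG
  obtain ⟨hE0, hF0, hG0⟩ := hγ.pd_metric hy 0
  obtain ⟨hE1, hF1, hG1⟩ := hγ.pd_metric hy 1
  rw [hE0, hF0, hE1, hF1] at eE
  rw [hE0, hF0, hG0, hE1, hF1, hG1] at eF
  rw [hF0, hG0, hF1, hG1] at eG
  simp only [hγ.chr_symm hy] at eE eF eG
  have R00 : γ y 0 0 * rc γ 0 0 y + γ y 0 1 * rc γ 1 0 y = 0 := by
    simp only [rc, Fin.sum_univ_two, hγ.chr_symm hy]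
    linear_combination eE / 2
  have R11 : γ y 0 1 * rc γ 0 1 y + γ y 1 1 * rc γ 1 1 y = 0 := by
    simp only [rc, Fin.sum_univ_two, hγ.chr_symm hy]
    linear_combination eG / 2
  have R01 : γ y 0 0 * rc γ 0 1 y + γ y 0 1 * rc γ 1 1 y
      + γ y 0 1 * rc γ 0 0 y + γ y 1 1 * rc γ 1 0 y = 0 := by
    simp only [rc, Fin.sum_univ_two, hγ.chr_symm hy]
    linear_combination eF
  have hD := (hγ.det_pos' hy).ne'
  have hK : γ y 0 0 * rc γ 0 1 y + γ y 0 1 * rc γ 1 1 y = gc γ y * (γ y).det := by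
    rw [gc, div_mul_cancel₀ _ hD, Fin.sum_univ_two]
  have he := hγ.det_eq hy
  generalize gc γ y = K at *
  rw [he] at hK hD
  refine ⟨?_, ?_, ?_, ?_⟩ <;> apply mul_left_cancel₀ hD
  · linear_combination γ y 1 1 * R00 - γ y 0 1 * (R01 - hK)
  · linear_combination γ y 1 1 * hK - γ y 0 1 * R11
  · linear_combination γ y 0 0 * (R01 - hK) - γ y 0 1 * R00
  · linear_combination γ y 0 0 * R11 - γ y 0 1 * hK

/-- Bochner's formula for a vector field. -/
lemma dv_bvec (hy : y ∈ U) {ξ : E2 → E2} (hξ : ∀ i, ContDiffOn ℝ ∞ (fun z ↦ ξ z i) U) :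
    dv γ (bvec γ ξ) y = -2 * (cov γ ξ 0 0 y * cov γ ξ 1 1 y - cov γ ξ 0 1 y * cov γ ξ 1 0 y)
      + gc γ y * mquad (γ y) (ξ y) := by
  have dξ : ∀ z ∈ U, ∀ i, DifferentiableAt ℝ (fun z ↦ ξ z i) z := fun z hz i ↦
    ContDiffOn.differentiableAt_of_isOpen hγ.isOpen (hξ i) hz
  have dc : ∀ k i, DifferentiableAt ℝ (cov γ ξ k i) y := fun k i ↦
    ContDiffOn.differentiableAt_of_isOpen hγ.isOpen (hγ.contDiffOn_cov hξ k i) hy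
  have dp : ∀ k i, DifferentiableAt ℝ (pd i (fun z ↦ ξ z k)) y := fun k i ↦
    ContDiffOn.differentiableAt_of_isOpen hγ.isOpen (contDiffOn_pd hγ.isOpen (hξ k) i) hy
  have dg := fun k i j ↦ hγ.differentiableAt_chr hy k i j
  have d0 := dξ y hy
  have hb : ∀ a i, pd a (fun z ↦ bvec γ ξ z i) y
      = pd a (fun z ↦ ξ z 0) y * cov γ ξ i 0 y + ξ y 0 * pd a (cov γ ξ i 0) y
        + (pd a (fun z ↦ ξ z 1) y * cov γ ξ i 1 y + ξ y 1 * pd a (cov γ ξ i 1) y)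
        - (pd a (fun z ↦ ξ z i) y * (cov γ ξ 0 0 y + cov γ ξ 1 1 y)
          + ξ y i * (pd a (cov γ ξ 0 0) y + pd a (cov γ ξ 1 1) y)) := by
    intro a i
    rw [pd_congr_of_isOpen hγ.isOpen hy fun z hz ↦ hγ.bvec_apply hz (dξ z hz) i,
      pd_sub (((d0 0).fun_mul (dc i 0)).fun_add ((d0 1).fun_mul (dc i 1)))
        ((d0 i).fun_mul ((dc 0 0).fun_add (dc 1 1))),
      pd_add ((d0 0).fun_mul (dc i 0)) ((d0 1).fun_mul (dc i 1)), pd_mul (d0 0) (dc i 0),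
      pd_mul (d0 1) (dc i 1), pd_mul (d0 i) ((dc 0 0).fun_add (dc 1 1)), pd_add (dc 0 0) (dc 1 1)]
  have hc : ∀ a k i, pd a (cov γ ξ k i) y = pd a (pd i (fun z ↦ ξ z k)) y
      + (pd a (chr γ k i 0) y * ξ y 0 + chr γ k i 0 y * pd a (fun z ↦ ξ z 0) y
        + (pd a (chr γ k i 1) y * ξ y 1 + chr γ k i 1 y * pd a (fun z ↦ ξ z 1) y)) := by
    intro a k i
    have : cov γ ξ k i = fun z ↦ pd i (fun z ↦ ξ z k) z
        + (chr γ k i 0 z * ξ z 0 + chr γ k i 1 z * ξ z 1) := by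
      funext z; simp [cov, Fin.sum_univ_two]
    rw [this, pd_add (dp k i) (((dg k i 0).fun_mul (d0 0)).fun_add ((dg k i 1).fun_mul (d0 1))),
      pd_add ((dg k i 0).fun_mul (d0 0)) ((dg k i 1).fun_mul (d0 1)), pd_mul (dg k i 0) (d0 0),
      pd_mul (dg k i 1) (d0 1)]
  have hcs : ∀ a k, pd a (chr γ k 1 0) y = pd a (chr γ k 0 1) y := fun a k ↦
    pd_congr_of_isOpen hγ.isOpen hy fun z hz ↦ hγ.chr_symm hz k
  have hcomm : ∀ k, pd 1 (pd 0 (fun z ↦ ξ z k)) y = pd 0 (pd 1 (fun z ↦ ξ z k)) y := fun k ↦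
    pd_comm 1 0 ((hξ k).contDiffAt (hγ.isOpen.mem_nhds hy))
  obtain ⟨r0, r1, r2, r3⟩ := hγ.rc_eq hy
  rw [hγ.dv_eq_cov hy]
  have expand : ∀ k i, cov γ ξ k i y = pd i (fun z ↦ ξ z k) y
      + (chr γ k i 0 y * ξ y 0 + chr γ k i 1 y * ξ y 1) := by
    intro k i; simp [cov, Fin.sum_univ_two]
  have expandb : ∀ k i, cov γ (bvec γ ξ) k i y = pd i (fun z ↦ bvec γ ξ z k) y
      + (chr γ k i 0 y * bvec γ ξ y 0 + chr γ k i 1 y * bvec γ ξ y 1) := by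
    intro k i; simp [cov, Fin.sum_univ_two]
  simp only [expandb, hb, hc, hγ.bvec_apply hy d0, hcs, hcomm]
  simp only [expand, hγ.chr_symm hy]
  simp only [rc, Fin.sum_univ_two, hcs, hγ.chr_symm hy] at r0 r1 r2 r3
  simp only [mquad, Fin.sum_univ_two, hγ.symm y hy]
  -- The second derivatives of ξ have cancelled by symmetry; the leftover is Ric(ξ, ξ), and the four
  -- curvature components combine to K |ξ|².
  linear_combination (ξ y 1 * ξ y 0) * r0 + (ξ y 1 * ξ y 1) * r1 - (ξ y 0 * ξ y 0) * r2
    - (ξ y 0 * ξ y 1) * r3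

end IsMetricOn

/-! ### Linear algebra of two-by-two metrics -/

/-- Symmetric positive definite two-by-two matrices. -/
structure IsPosMat (γ : Mat) : Prop where
  symm : γ 1 0 = γ 0 1
  pos : 0 < γ 0 0
  det_pos : 0 < γ 0 0 * γ 1 1 - γ 0 1 * γ 0 1

lemma IsMetricOn.isPosMat {γ : E2 → Mat} {U : Set E2} (hγ : IsMetricOn γ U) {y : E2} (hy : y ∈ U) :
    IsPosMat (γ y) := ⟨hγ.symm y hy, hγ.pos y hy, hγ.det_pos y hy⟩

namespace IsPosMat

variable {γ : Mat} (hγ : IsPosMat γ)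
include hγ

lemma det_eq : γ.det = γ 0 0 * γ 1 1 - γ 0 1 * γ 0 1 := by
  rw [Matrix.det_fin_two, hγ.symm]

lemma pos' : 0 < γ 1 1 := by
  have := hγ.det_pos
  have h0 := hγ.pos
  by_contra h
  nlinarith [mul_self_nonneg (γ 0 1), mul_nonneg h0.le (neg_nonneg.2 (not_lt.1 h))]

lemma mquad_eq (v : E2) :
    mquad γ v = γ 0 0 * v 0 ^ 2 + 2 * γ 0 1 * v 0 * v 1 + γ 1 1 * v 1 ^ 2 := by
  simp only [mquad, Fin.sum_univ_two, hγ.symm]; ring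

lemma mul_mquad (v : E2) : γ 0 0 * mquad γ v
    = (γ 0 0 * v 0 + γ 0 1 * v 1) ^ 2 + (γ 0 0 * γ 1 1 - γ 0 1 * γ 0 1) * v 1 ^ 2 := by
  rw [hγ.mquad_eq]; ring

lemma mquad_nonneg (v : E2) : 0 ≤ mquad γ v := by
  have h := hγ.mul_mquad v
  have h1 := hγ.det_pos
  refine nonneg_of_mul_nonneg_right (a := γ 0 0) ?_ hγ.pos
  rw [h]; positivity

lemma inv : IsPosMat γ⁻¹ := by
  obtain ⟨i0, i1, i2, i3⟩ := inv_apply_fin_two γ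
  have hD := hγ.det_pos
  have hd := hγ.det_eq
  rw [← hd] at hD
  refine ⟨by rw [i1, i2, hγ.symm], by rw [i0]; exact div_pos hγ.pos' hD, ?_⟩
  rw [i0, i1, i3]
  have : γ 1 1 / γ.det * (γ 0 0 / γ.det) - -γ 0 1 / γ.det * (-γ 0 1 / γ.det) = 1 / γ.det := by
    field_simp; rw [hd]; ring
  rw [this]; positivity

/-- A formula for the norm of symmetric trace-free tensors. -/
lemma minner_eq {h k : Mat} (hs : h 1 0 = h 0 1) (ks : k 1 0 = k 0 1) (ht : mtr γ h = 0)
    (kt : mtr γ k = 0) :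
    γ 0 0 ^ 2 * minner γ h k = 2 * h 0 0 * k 0 0
      + 2 * (γ 0 0 * h 0 1 - γ 0 1 * h 0 0) * (γ 0 0 * k 0 1 - γ 0 1 * k 0 0) / γ.det := by
  obtain ⟨i0, i1, i2, i3⟩ := inv_apply_fin_two γ
  have hd := hγ.det_eq
  have hD : γ.det ≠ 0 := by rw [hd]; exact hγ.det_pos.ne'
  have h0 := hγ.pos.ne'
  simp only [mtr, Fin.sum_univ_two, i0, i1, i2, i3, hγ.symm, hs, ks] at ht kt
  simp only [minner, Fin.sum_univ_two, i0, i1, i2, i3, hγ.symm, hs, ks]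
  field_simp at ht kt ⊢
  have e1 : h 1 1 = (2 * γ 0 1 * h 0 1 - γ 1 1 * h 0 0) / γ 0 0 := by
    field_simp; linear_combination ht
  have e2 : k 1 1 = (2 * γ 0 1 * k 0 1 - γ 1 1 * k 0 0) / γ 0 0 := by
    field_simp; linear_combination kt
  rw [e1, e2, hd]
  field_simp
  ring

/-- By `minner_eq` the norm is a sum of two squares with positive weights. -/
lemma minner_self_nonneg {h : Mat} (hs : h 1 0 = h 0 1) (ht : mtr γ h = 0) :
    0 ≤ minner γ h h := by
  have := hγ.minner_eq hs hs ht ht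
  have h1 := hγ.det_pos
  rw [← hγ.det_eq] at h1
  have h0 := hγ.pos
  refine nonneg_of_mul_nonneg_right (a := γ 0 0 ^ 2) ?_ (by positivity)
  rw [this]
  have e : 2 * (γ 0 0 * h 0 1 - γ 0 1 * h 0 0) * (γ 0 0 * h 0 1 - γ 0 1 * h 0 0) / γ.det
    = 2 * (γ 0 0 * h 0 1 - γ 0 1 * h 0 0) ^ 2 / γ.det := by ring
  rw [e, mul_assoc, ← sq]
  positivity

lemma eq_zero_of_minner_self {h : Mat} (hs : h 1 0 = h 0 1) (ht : mtr γ h = 0)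
    (h0 : minner γ h h = 0) : h = 0 := by
  have := hγ.minner_eq hs hs ht ht
  have h1 := hγ.det_pos
  rw [← hγ.det_eq] at h1
  have hp := hγ.pos
  have e : 2 * (γ 0 0 * h 0 1 - γ 0 1 * h 0 0) * (γ 0 0 * h 0 1 - γ 0 1 * h 0 0) / γ.det
    = 2 * ((γ 0 0 * h 0 1 - γ 0 1 * h 0 0) ^ 2 / γ.det) := by ring
  rw [e, h0, mul_zero] at this
  have q : 0 ≤ (γ 0 0 * h 0 1 - γ 0 1 * h 0 0) ^ 2 / γ.det := by positivity
  have a0 : h 0 0 = 0 := by nlinarith [mul_self_nonneg (h 0 0)]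
  have a1 : h 0 1 = 0 := by
    rw [a0] at this
    have q' : (γ 0 0 * h 0 1 - γ 0 1 * 0) ^ 2 / γ.det = 0 := by linarith
    rw [div_eq_zero_iff] at q'
    rcases q' with q' | q'
    · have := pow_eq_zero_iff (two_ne_zero) |>.1 q'
      simp only [mul_zero, sub_zero, mul_eq_zero] at this
      exact this.resolve_left hp.ne'
    · exact absurd q' h1.ne'
  have a3 : h 1 1 = 0 := by
    obtain ⟨i0, i1, i2, i3⟩ := inv_apply_fin_two γ
    simp only [mtr, Fin.sum_univ_two, i0, i1, i2, i3, hs, a0, a1, mul_zero, zero_add] at ht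
    rcases mul_eq_zero.1 ht with h | h
    · exact absurd h (div_pos hp h1).ne'
    · exact h
  ext i j
  fin_cases i <;> fin_cases j <;> simp [a0, a1, a3, hs]

end IsPosMat

namespace IsMetricOn

variable {γ : E2 → Mat} {U : Set E2} (hγ : IsMetricOn γ U) {y : E2}
include hγ

lemma lieTF_symm (hy : y ∈ U) (ξ : E2 → E2) : lieTF γ ξ y 1 0 = lieTF γ ξ y 0 1 := by
  rw [hγ.lieTF_apply hy, hγ.lieTF_apply hy, (hγ.lie_apply hy ξ).2.2.1, hγ.symm y hy]

lemma mtr_lieTF (hy : y ∈ U) (ξ : E2 → E2) : mtr (γ y) (lieTF γ ξ y) = 0 := by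
  obtain ⟨h0, h1, h2, h3⟩ := hγ.inv_rel hy
  have : mtr (γ y) (lieTF γ ξ y) = mtr (γ y) (lie γ ξ y) - dv γ ξ y * mtr (γ y) (γ y) := by
    simp only [mtr, Fin.sum_univ_two, lieTF, Matrix.sub_apply, Matrix.smul_apply, smul_eq_mul]
    ring
  have h4 : mtr (γ y) (γ y) = 2 := by
    simp only [mtr, Fin.sum_univ_two, hγ.inv_symm hy, hγ.symm y hy]
    linear_combination h0 + h3
  rw [this, h4, dv]; ring

/-- In an orthonormal frame with ∇ξ = (a b; c d) the squared norm of the trace-free Lie derivative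
is 2(a - d)² + 2(b + c)². Adding 4(ad - bc) gives 2(a² + b² + c² + d²) = 2|∇ξ|² ≥ 0. -/
lemma four_mul_det_cov_le (hy : y ∈ U) (ξ : E2 → E2) :
    -4 * (cov γ ξ 0 0 y * cov γ ξ 1 1 y - cov γ ξ 0 1 y * cov γ ξ 1 0 y)
      ≤ minner (γ y) (lieTF γ ξ y) (lieTF γ ξ y) := by
  have hP := hγ.isPosMat hy
  have hm := hP.minner_eq (hγ.lieTF_symm hy ξ) (hγ.lieTF_symm hy ξ) (hγ.mtr_lieTF hy ξ)
    (hγ.mtr_lieTF hy ξ)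
  obtain ⟨l0, l1, l2, l3⟩ := hγ.lie_apply hy ξ
  have hd := hγ.det_eq hy
  have hD := hγ.det_pos' hy
  have h0 := hγ.pos y hy
  rw [hγ.lieTF_apply hy, hγ.lieTF_apply hy, l0, l1] at hm
  generalize minner (γ y) (lieTF γ ξ y) (lieTF γ ξ y) = N at *
  generalize cov γ ξ 0 0 y = A at *
  generalize cov γ ξ 0 1 y = B at *
  generalize cov γ ξ 1 0 y = C at *
  generalize cov γ ξ 1 1 y = D' at *
  clear l0 l1 l2 l3
  generalize γ y 0 0 = E at *
  generalize γ y 0 1 = F at *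
  generalize γ y 1 1 = G at *
  generalize (γ y).det = D at *
  -- The quantity 2|∇ξ|² in coordinates, multiplied by E² and written as a sum of squares.
  have key : E ^ 2 * (N + 4 * (A * D' - B * C))
      = 2 * ((E * (E * B - F * A) + F * (E * D' - F * C)) ^ 2 / D + (E * D' - F * C) ^ 2
        + ((E * A + F * C) ^ 2 + D * C ^ 2)) := by
    rw [mul_add, hm]
    field_simp
    rw [hd]
    ring
  have : 0 ≤ N + 4 * (A * D' - B * C) := by
    refine nonneg_of_mul_nonneg_right (a := E ^ 2) ?_ (by positivity)
    rw [key]; positivity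
  linarith

end IsMetricOn

end TTSurface

namespace TTSurface

/-! ### Change of coordinates -/

/-- The Jacobian matrix of `Ψ`. -/
def jac (Ψ : E2 → E2) (y : E2) : Mat := Matrix.of fun a b ↦ pd b (fun z ↦ Ψ z a) y

section congr

variable {γ h k J : Mat} (hJ : J.det ≠ 0)

lemma inv_congr (γ J : Mat) : (J.transpose * γ * J)⁻¹ = J⁻¹ * γ⁻¹ * J⁻¹.transpose := by
  rw [Matrix.mul_inv_rev, Matrix.mul_inv_rev, Matrix.transpose_nonsing_inv, Matrix.mul_assoc]

/-- Contractions become traces of matrix products, so that their invariance under γ ↦ JᵀγJ reduces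
to cyclicity of the trace. -/
lemma mtr_eq_trace (γ h : Mat) : mtr γ h = (γ⁻¹.transpose * h).trace := by
  simp only [mtr, Matrix.trace, Matrix.diag, Matrix.mul_apply, Fin.sum_univ_two,
    Matrix.transpose_apply]
  ring

lemma minner_eq_trace (γ h k : Mat) :
    minner γ h k = (γ⁻¹.transpose * h * γ⁻¹ * k.transpose).trace := by
  simp only [minner, Matrix.trace, Matrix.diag, Matrix.mul_apply, Fin.sum_univ_two,
    Matrix.transpose_apply]
  ring

include hJ

lemma mul_inv_of_det_ne : J * J⁻¹ = 1 := Matrix.mul_nonsing_inv J (isUnit_iff_ne_zero.2 hJ)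

lemma inv_mul_of_det_ne : J⁻¹ * J = 1 := Matrix.nonsing_inv_mul J (isUnit_iff_ne_zero.2 hJ)

lemma mtr_congr (γ h : Mat) :
    mtr (J.transpose * γ * J) (J.transpose * h * J) = mtr γ h := by
  have e : J⁻¹.transpose * J.transpose = 1 := by
    rw [← Matrix.transpose_mul, mul_inv_of_det_ne hJ, Matrix.transpose_one]
  rw [mtr_eq_trace, mtr_eq_trace, inv_congr]
  simp only [Matrix.transpose_mul, Matrix.transpose_transpose]
  have : J⁻¹ * (γ⁻¹.transpose * J⁻¹.transpose) * (J.transpose * h * J)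
      = J⁻¹ * (γ⁻¹.transpose * (J⁻¹.transpose * J.transpose) * h * J) := by
    simp only [Matrix.mul_assoc]
  rw [this, e, Matrix.trace_mul_comm, Matrix.mul_one, Matrix.mul_assoc, mul_inv_of_det_ne hJ,
    Matrix.mul_one]

lemma minner_congr (γ h k : Mat) :
    minner (J.transpose * γ * J) (J.transpose * h * J) (J.transpose * k * J) = minner γ h k := by
  have e : J⁻¹.transpose * J.transpose = 1 := by
    rw [← Matrix.transpose_mul, mul_inv_of_det_ne hJ, Matrix.transpose_one]
  rw [minner_eq_trace, minner_eq_trace, inv_congr]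
  simp only [Matrix.transpose_mul, Matrix.transpose_transpose]
  have : J⁻¹ * (γ⁻¹.transpose * J⁻¹.transpose) * (J.transpose * h * J) *
      (J⁻¹ * γ⁻¹ * J⁻¹.transpose) * (J.transpose * (k.transpose * J))
      = J⁻¹ * (γ⁻¹.transpose * (J⁻¹.transpose * J.transpose) * h * (J * J⁻¹) * γ⁻¹ *
        (J⁻¹.transpose * J.transpose) * k.transpose * J) := by
    simp only [Matrix.mul_assoc]
  rw [this, e, Matrix.trace_mul_comm, mul_inv_of_det_ne hJ]
  simp only [Matrix.mul_one, Matrix.mul_assoc, mul_inv_of_det_ne hJ]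

omit hJ in
lemma mquad_congr (γ J : Mat) (v w : E2) (hw : ∀ a, w a = ∑ b, J a b * v b) :
    mquad (J.transpose * γ * J) v = mquad γ w := by
  simp only [mquad, Matrix.mul_apply, Fin.sum_univ_two, Matrix.transpose_apply] at hw ⊢
  rw [hw, hw]; ring

end congr

section naturality

variable {Ψ : E2 → E2} {y : E2}

lemma pd_comp {f : E2 → ℝ} (hΨ : DifferentiableAt ℝ Ψ y) (hf : DifferentiableAt ℝ f (Ψ y))
    (k : Fin 2) : pd k (fun z ↦ f (Ψ z)) y = ∑ a, pd a f (Ψ y) * jac Ψ y a k := by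
  have h := hf.hasFDerivAt.comp y hΨ.hasFDerivAt
  have h' : HasFDerivAt (fun z ↦ f (Ψ z)) _ y := h
  have e : ∀ a, jac Ψ y a k = (fderiv ℝ Ψ y (stdVec k)) a := by
    intro a
    have h1 := (EuclideanSpace.proj (𝕜 := ℝ) a).hasFDerivAt.comp y hΨ.hasFDerivAt
    have h2 : HasFDerivAt (fun z ↦ Ψ z a) _ y := h1
    simp only [jac, Matrix.of_apply, pd]
    rw [h2.fderiv]; rfl
  rw [pd, h'.fderiv]
  simp only [e, Fin.sum_univ_two, ContinuousLinearMap.comp_apply]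
  rw [fderiv_apply_eq_sum_pd]
  ring

lemma _root_.ContDiffAt.euclidean_apply {n : WithTop ℕ∞} (hΨ : ContDiffAt ℝ n Ψ y) (a : Fin 2) :
    ContDiffAt ℝ n (fun z ↦ Ψ z a) y :=
  (EuclideanSpace.proj (𝕜 := ℝ) a).contDiff.contDiffAt.comp y hΨ

lemma contDiffAt_pd {f : E2 → ℝ} (hf : ContDiffAt ℝ ∞ f y) (k : Fin 2) :
    ContDiffAt ℝ ∞ (pd k f) y := by
  have h := hf.fderiv_right (m := ∞) (by simp)
  exact h.clm_apply contDiffAt_const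

lemma pd_jac (hΨ : ContDiffAt ℝ ∞ Ψ y) (a i k : Fin 2) :
    pd k (fun z ↦ jac Ψ z a i) y = pd i (fun z ↦ jac Ψ z a k) y :=
  pd_comm k i (hΨ.euclidean_apply a)

/-- The Lie derivative is natural under changes of coordinates. -/
theorem lie_congr {γ γ' : E2 → Mat} {ξ ξ' : E2 → E2} (hΨ : ContDiffAt ℝ ∞ Ψ y)
    (hγ : ∀ᶠ z in nhds y, γ z = (jac Ψ z).transpose * γ' (Ψ z) * jac Ψ z)
    (hξ : ∀ᶠ z in nhds y, ∀ a, ξ' (Ψ z) a = ∑ b, jac Ψ z a b * ξ z b)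
    (dγ : ∀ i j, DifferentiableAt ℝ (fun z ↦ γ' z i j) (Ψ y))
    (dξ : ∀ i, DifferentiableAt ℝ (fun z ↦ ξ z i) y)
    (dξ' : ∀ i, DifferentiableAt ℝ (fun z ↦ ξ' z i) (Ψ y)) :
    lie γ ξ y = (jac Ψ y).transpose * lie γ' ξ' (Ψ y) * jac Ψ y := by
  have hd : DifferentiableAt ℝ Ψ y := hΨ.differentiableAt (by simp)
  have dJ : ∀ a b, DifferentiableAt ℝ (fun z ↦ jac Ψ z a b) y := fun a b ↦
    (contDiffAt_pd (hΨ.euclidean_apply a) b).differentiableAt (by simp)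
  have dγΨ : ∀ i j, DifferentiableAt ℝ (fun z ↦ γ' (Ψ z) i j) y := fun i j ↦
    DifferentiableAt.comp (g := fun z ↦ γ' z i j) y (dγ i j) hd
  have triple : ∀ k a b i j, pd k (fun z ↦ jac Ψ z a i * γ' (Ψ z) a b * jac Ψ z b j) y
      = pd k (fun z ↦ jac Ψ z a i) y * γ' (Ψ y) a b * jac Ψ y b j
        + jac Ψ y a i * (pd 0 (fun z ↦ γ' z a b) (Ψ y) * jac Ψ y 0 k
          + pd 1 (fun z ↦ γ' z a b) (Ψ y) * jac Ψ y 1 k) * jac Ψ y b j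
        + jac Ψ y a i * γ' (Ψ y) a b * pd k (fun z ↦ jac Ψ z b j) y := by
    intro k a b i j
    rw [pd_mul ((dJ a i).fun_mul (dγΨ a b)) (dJ b j), pd_mul (dJ a i) (dγΨ a b),
      pd_comp (f := fun z ↦ γ' z a b) hd (dγ a b), Fin.sum_univ_two]
    ring
  have dt : ∀ a b i j, DifferentiableAt ℝ (fun z ↦ jac Ψ z a i * γ' (Ψ z) a b * jac Ψ z b j) y :=
    fun a b i j ↦ ((dJ a i).fun_mul (dγΨ a b)).fun_mul (dJ b j)
  have pγ : ∀ k i j, pd k (fun z ↦ γ z i j) y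
      = pd k (fun z ↦ jac Ψ z 0 i * γ' (Ψ z) 0 0 * jac Ψ z 0 j) y
        + pd k (fun z ↦ jac Ψ z 1 i * γ' (Ψ z) 1 0 * jac Ψ z 0 j) y
        + (pd k (fun z ↦ jac Ψ z 0 i * γ' (Ψ z) 0 1 * jac Ψ z 1 j) y
        + pd k (fun z ↦ jac Ψ z 1 i * γ' (Ψ z) 1 1 * jac Ψ z 1 j) y) := by
    intro k i j
    rw [← pd_add (dt 0 0 i j) (dt 1 0 i j), ← pd_add (dt 0 1 i j) (dt 1 1 i j),
      ← pd_add ((dt 0 0 i j).fun_add (dt 1 0 i j)) ((dt 0 1 i j).fun_add (dt 1 1 i j))]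
    refine pd_congr ?_
    filter_upwards [hγ] with z hz
    rw [hz]
    simp only [Matrix.mul_apply, Fin.sum_univ_two, Matrix.transpose_apply]
    ring
  have pξ : ∀ k a, pd 0 (fun z ↦ ξ' z a) (Ψ y) * jac Ψ y 0 k
        + pd 1 (fun z ↦ ξ' z a) (Ψ y) * jac Ψ y 1 k
      = pd k (fun z ↦ jac Ψ z a 0) y * ξ y 0 + jac Ψ y a 0 * pd k (fun z ↦ ξ z 0) y
        + (pd k (fun z ↦ jac Ψ z a 1) y * ξ y 1 + jac Ψ y a 1 * pd k (fun z ↦ ξ z 1) y) := by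
    intro k a
    rw [← pd_mul (dJ a 0) (dξ 0), ← pd_mul (dJ a 1) (dξ 1),
      ← pd_add ((dJ a 0).fun_mul (dξ 0)) ((dJ a 1).fun_mul (dξ 1)),
      ← Fin.sum_univ_two (fun b ↦ pd b (fun z ↦ ξ' z a) (Ψ y) * jac Ψ y b k), ← pd_comp hd (dξ' a)]
    refine pd_congr ?_
    filter_upwards [hξ] with z hz
    rw [hz, Fin.sum_univ_two]
  have hγy := hγ.self_of_nhds
  have hξy := hξ.self_of_nhds
  ext i j
  simp only [Matrix.mul_apply, Fin.sum_univ_two, Matrix.transpose_apply, lie, Matrix.of_apply,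
    pγ, triple, hγy, hξy]
  -- Differentiating the transformation laws of γ and ξ produces second derivatives of Ψ. They
  -- cancel after their symmetry has been used.
  have hij : ∀ k a, pd k (fun z ↦ jac Ψ z a i) y = pd i (fun z ↦ jac Ψ z a k) y := fun k a ↦
    pd_jac hΨ a i k
  have hij' : ∀ k a, pd k (fun z ↦ jac Ψ z a j) y = pd j (fun z ↦ jac Ψ z a k) y := fun k a ↦
    pd_jac hΨ a j k
  linear_combination
    - γ' (Ψ y) 0 0 * jac Ψ y 0 j * pξ i 0 - jac Ψ y 0 i * γ' (Ψ y) 0 0 * pξ j 0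
    - γ' (Ψ y) 0 1 * jac Ψ y 1 j * pξ i 0 - jac Ψ y 1 i * γ' (Ψ y) 1 0 * pξ j 0
    - γ' (Ψ y) 1 0 * jac Ψ y 0 j * pξ i 1 - jac Ψ y 0 i * γ' (Ψ y) 0 1 * pξ j 1
    - γ' (Ψ y) 1 1 * jac Ψ y 1 j * pξ i 1 - jac Ψ y 1 i * γ' (Ψ y) 1 1 * pξ j 1
    + ξ y 0 * γ' (Ψ y) 0 0 * jac Ψ y 0 j * hij 0 0 + ξ y 0 * γ' (Ψ y) 0 0 * jac Ψ y 0 i * hij' 0 0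
    + ξ y 0 * γ' (Ψ y) 0 1 * jac Ψ y 1 j * hij 0 0 + ξ y 0 * γ' (Ψ y) 1 0 * jac Ψ y 1 i * hij' 0 0
    + ξ y 0 * γ' (Ψ y) 1 0 * jac Ψ y 0 j * hij 0 1 + ξ y 0 * γ' (Ψ y) 0 1 * jac Ψ y 0 i * hij' 0 1
    + ξ y 0 * γ' (Ψ y) 1 1 * jac Ψ y 1 j * hij 0 1 + ξ y 0 * γ' (Ψ y) 1 1 * jac Ψ y 1 i * hij' 0 1
    + ξ y 1 * γ' (Ψ y) 0 0 * jac Ψ y 0 j * hij 1 0 + ξ y 1 * γ' (Ψ y) 0 0 * jac Ψ y 0 i * hij' 1 0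
    + ξ y 1 * γ' (Ψ y) 0 1 * jac Ψ y 1 j * hij 1 0 + ξ y 1 * γ' (Ψ y) 1 0 * jac Ψ y 1 i * hij' 1 0
    + ξ y 1 * γ' (Ψ y) 1 0 * jac Ψ y 0 j * hij 1 1 + ξ y 1 * γ' (Ψ y) 0 1 * jac Ψ y 0 i * hij' 1 1
    + ξ y 1 * γ' (Ψ y) 1 1 * jac Ψ y 1 j * hij 1 1 + ξ y 1 * γ' (Ψ y) 1 1 * jac Ψ y 1 i * hij' 1 1


end naturality

end TTSurface

/-! ### Raising indices; smoothness and naturality of the operators. -/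

namespace TTSurface

/-- The vector dual to the covector `θ`. -/
def raise (γ : Mat) (θ : Fin 2 → ℝ) : E2 := WithLp.toLp 2 fun i ↦ ∑ j, γ⁻¹ i j * θ j

/-- The squared norm of a covector. -/
def cquad (γ : Mat) (θ : Fin 2 → ℝ) : ℝ := ∑ i, ∑ j, γ⁻¹ i j * θ i * θ j

lemma sharp_eq_raise (γ h : E2 → Mat) (ξ : E2 → E2) (y : E2) :
    sharp γ h ξ y = raise (γ y) fun j ↦ ∑ k, h y j k * ξ y k := rfl

lemma bvec_eq_raise (γ : E2 → Mat) (ξ : E2 → E2) (y : E2) :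
    bvec γ ξ y = raise (γ y) fun j ↦ (∑ k, lieTF γ ξ y j k * ξ y k)
      - (1 / 2) * pd j (fun z ↦ mquad (γ z) (ξ z)) y := rfl

section congr

variable {J : Mat} (hJ : J.det ≠ 0)
include hJ

lemma raise_congr (γ : Mat) {θ θ' : Fin 2 → ℝ} (hθ : ∀ j, θ j = ∑ a, θ' a * J a j) (a : Fin 2) :
    raise γ θ' a = ∑ b, J a b * raise (J.transpose * γ * J) θ b := by
  have e := mul_inv_of_det_ne hJ
  have e' : J⁻¹.transpose * J.transpose = 1 := by
    rw [← Matrix.transpose_mul, e, Matrix.transpose_one]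
  have h1 : θ = Matrix.mulVec J.transpose θ' := by
    ext j; simp [hθ, Matrix.mulVec, dotProduct, Fin.sum_univ_two]; ring
  have h2 : ∀ (δ : Mat) (w : Fin 2 → ℝ) (i : Fin 2), raise δ w i = Matrix.mulVec δ⁻¹ w i := by
    intro δ w i; simp [raise, Matrix.mulVec, dotProduct]
  have h3 : ∑ b, J a b * raise (J.transpose * γ * J) θ b
      = Matrix.mulVec J (Matrix.mulVec (J.transpose * γ * J)⁻¹ θ) a := by
    simp [h2, Matrix.mulVec, dotProduct]
  rw [h3, h2, inv_congr, h1, Matrix.mulVec_mulVec, Matrix.mulVec_mulVec]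
  have h4 : J * (J⁻¹ * γ⁻¹ * J⁻¹.transpose) * J.transpose
      = (J * J⁻¹) * γ⁻¹ * (J⁻¹.transpose * J.transpose) := by simp only [Matrix.mul_assoc]
  rw [h4, e, e', Matrix.one_mul, Matrix.mul_one]

lemma cquad_congr (γ : Mat) {θ θ' : Fin 2 → ℝ} (hθ : ∀ j, θ j = ∑ a, θ' a * J a j) :
    cquad (J.transpose * γ * J) θ = cquad γ θ' := by
  have h1 : ∀ (δ : Mat) (w : Fin 2 → ℝ), cquad δ w = ∑ i, w i * raise δ w i := by
    intro δ w; simp [cquad, raise, Fin.sum_univ_two]; ring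
  rw [h1, h1]
  simp only [raise_congr hJ γ hθ, Fin.sum_univ_two, hθ]
  ring

end congr

/-- Smooth maps on the open set `V` with invertible derivative. -/
structure IsCoordChange (Ψ : E2 → E2) (V : Set E2) : Prop where
  isOpen : IsOpen V
  smooth : ContDiffOn ℝ ∞ Ψ V
  det_ne : ∀ y ∈ V, (jac Ψ y).det ≠ 0

namespace IsMetricOn

variable {γ : E2 → Mat} {U : Set E2} (hγ : IsMetricOn γ U) {y : E2}
include hγ

lemma contDiffOn_lie {ξ : E2 → E2} (hξ : ∀ i, ContDiffOn ℝ ∞ (fun z ↦ ξ z i) U) (i j : Fin 2) :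
    ContDiffOn ℝ ∞ (fun z ↦ lie γ ξ z i j) U := by
  simp only [lie, Matrix.of_apply]
  exact ContDiffOn.sum fun k _ ↦ (((hξ k).mul (contDiffOn_pd hγ.isOpen (hγ.smooth i j) k)).add
    ((hγ.smooth k j).mul (contDiffOn_pd hγ.isOpen (hξ k) i))).add
    ((hγ.smooth i k).mul (contDiffOn_pd hγ.isOpen (hξ k) j))

lemma contDiffOn_mtr {h : E2 → Mat} (hh : ∀ i j, ContDiffOn ℝ ∞ (fun z ↦ h z i j) U) :
    ContDiffOn ℝ ∞ (fun z ↦ mtr (γ z) (h z)) U :=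
  ContDiffOn.sum fun i _ ↦ ContDiffOn.sum fun j _ ↦ (hγ.contDiffOn_inv i j).mul (hh i j)

lemma contDiffOn_minner {h k : E2 → Mat} (hh : ∀ i j, ContDiffOn ℝ ∞ (fun z ↦ h z i j) U)
    (hk : ∀ i j, ContDiffOn ℝ ∞ (fun z ↦ k z i j) U) :
    ContDiffOn ℝ ∞ (fun z ↦ minner (γ z) (h z) (k z)) U :=
  ContDiffOn.sum fun i _ ↦ ContDiffOn.sum fun j _ ↦ ContDiffOn.sum fun p _ ↦
    ContDiffOn.sum fun q _ ↦ (((hγ.contDiffOn_inv i p).mul (hγ.contDiffOn_inv j q)).mul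
      (hh i j)).mul (hk p q)

lemma contDiffOn_mquad {ξ : E2 → E2} (hξ : ∀ i, ContDiffOn ℝ ∞ (fun z ↦ ξ z i) U) :
    ContDiffOn ℝ ∞ (fun z ↦ mquad (γ z) (ξ z)) U :=
  ContDiffOn.sum fun i _ ↦ ContDiffOn.sum fun j _ ↦ ((hγ.smooth i j).mul (hξ i)).mul (hξ j)

lemma contDiffOn_dv {ξ : E2 → E2} (hξ : ∀ i, ContDiffOn ℝ ∞ (fun z ↦ ξ z i) U) :
    ContDiffOn ℝ ∞ (dv γ ξ) U :=
  contDiffOn_const.mul (hγ.contDiffOn_mtr (hγ.contDiffOn_lie hξ))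

lemma contDiffOn_lieTF {ξ : E2 → E2} (hξ : ∀ i, ContDiffOn ℝ ∞ (fun z ↦ ξ z i) U) (i j : Fin 2) :
    ContDiffOn ℝ ∞ (fun z ↦ lieTF γ ξ z i j) U :=
  (hγ.contDiffOn_lie hξ i j).sub ((hγ.contDiffOn_dv hξ).mul (hγ.smooth i j))

lemma contDiffOn_raise {θ : E2 → Fin 2 → ℝ} (hθ : ∀ i, ContDiffOn ℝ ∞ (fun z ↦ θ z i) U)
    (i : Fin 2) : ContDiffOn ℝ ∞ (fun z ↦ raise (γ z) (θ z) i) U := by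
  simp only [raise]
  exact ContDiffOn.sum fun j _ ↦ (hγ.contDiffOn_inv i j).mul (hθ j)

lemma contDiffOn_sharp {ξ : E2 → E2} {h : E2 → Mat} (hξ : ∀ i, ContDiffOn ℝ ∞ (fun z ↦ ξ z i) U)
    (hh : ∀ i j, ContDiffOn ℝ ∞ (fun z ↦ h z i j) U) (i : Fin 2) :
    ContDiffOn ℝ ∞ (fun z ↦ sharp γ h ξ z i) U :=
  hγ.contDiffOn_raise (fun j ↦ ContDiffOn.sum fun k _ ↦ (hh j k).mul (hξ k)) i

lemma contDiffOn_bvec {ξ : E2 → E2} (hξ : ∀ i, ContDiffOn ℝ ∞ (fun z ↦ ξ z i) U) (i : Fin 2) :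
    ContDiffOn ℝ ∞ (fun z ↦ bvec γ ξ z i) U :=
  hγ.contDiffOn_raise (fun j ↦ (ContDiffOn.sum fun k _ ↦ (hγ.contDiffOn_lieTF hξ j k).mul
    (hξ k)).sub (contDiffOn_const.mul
      (contDiffOn_pd hγ.isOpen (hγ.contDiffOn_mquad hξ) j))) i

end IsMetricOn

section naturality

variable {γ γ' : E2 → Mat} {U U' V : Set E2} {Ψ : E2 → E2} {ξ ξ' : E2 → E2} {y : E2}
  (hγ : IsMetricOn γ U) (hγ' : IsMetricOn γ' U') (hΨ : IsCoordChange Ψ V) (hVU : V ⊆ U)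
  (hVU' : ∀ z ∈ V, Ψ z ∈ U')
  (hp : ∀ z ∈ V, γ z = (jac Ψ z).transpose * γ' (Ψ z) * jac Ψ z)
  (hξ : ∀ i, ContDiffOn ℝ ∞ (fun z ↦ ξ z i) U) (hξ' : ∀ i, ContDiffOn ℝ ∞ (fun z ↦ ξ' z i) U')
  (hpξ : ∀ z ∈ V, ∀ a, ξ' (Ψ z) a = ∑ b, jac Ψ z a b * ξ z b)

include hγ hγ' hΨ hVU hVU' hp hξ hξ' hpξ

lemma lie_congr_on (hy : y ∈ V) :
    lie γ ξ y = (jac Ψ y).transpose * lie γ' ξ' (Ψ y) * jac Ψ y := by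
  have hn := hΨ.isOpen.mem_nhds hy
  exact lie_congr (hΨ.smooth.contDiffAt hn) (Filter.eventually_of_mem hn hp)
    (Filter.eventually_of_mem hn hpξ) (hγ'.differentiableAt (hVU' y hy))
    (fun i ↦ ContDiffOn.differentiableAt_of_isOpen hγ.isOpen (hξ i) (hVU hy))
    (fun i ↦ ContDiffOn.differentiableAt_of_isOpen hγ'.isOpen (hξ' i) (hVU' y hy))

lemma dv_congr (hy : y ∈ V) : dv γ ξ y = dv γ' ξ' (Ψ y) := by
  rw [dv, dv, lie_congr_on hγ hγ' hΨ hVU hVU' hp hξ hξ' hpξ hy, hp y hy, mtr_congr (hΨ.det_ne y hy)]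

lemma lieTF_congr (hy : y ∈ V) :
    lieTF γ ξ y = (jac Ψ y).transpose * lieTF γ' ξ' (Ψ y) * jac Ψ y := by
  rw [lieTF, lieTF, dv_congr hγ hγ' hΨ hVU hVU' hp hξ hξ' hpξ hy,
    lie_congr_on hγ hγ' hΨ hVU hVU' hp hξ hξ' hpξ hy, Matrix.mul_sub, Matrix.sub_mul,
    Matrix.mul_smul, Matrix.smul_mul, ← hp y hy]

/-- The covector that is raised consists of the tensor `lieTF` contracted with ξ and of the
differential of the function |ξ|². Both are natural, so no transformation law for Christoffel
symbols is needed. -/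
lemma bvec_congr (hy : y ∈ V) (a : Fin 2) :
    bvec γ' ξ' (Ψ y) a = ∑ b, jac Ψ y a b * bvec γ ξ y b := by
  rw [bvec_eq_raise, bvec_eq_raise, hp y hy]
  refine raise_congr (hΨ.det_ne y hy) _ (fun j ↦ ?_) a
  have h1 := lieTF_congr hγ hγ' hΨ hVU hVU' hp hξ hξ' hpξ hy
  have h2 : pd j (fun z ↦ mquad (γ z) (ξ z)) y
      = ∑ a, pd a (fun z ↦ mquad (γ' z) (ξ' z)) (Ψ y) * jac Ψ y a j := by
    rw [← pd_comp (f := fun z ↦ mquad (γ' z) (ξ' z))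
      ((hΨ.smooth.contDiffAt (hΨ.isOpen.mem_nhds hy)).differentiableAt (by simp))
      (ContDiffOn.differentiableAt_of_isOpen hγ'.isOpen (hγ'.contDiffOn_mquad hξ') (hVU' y hy))]
    refine pd_congr_of_isOpen hΨ.isOpen hy fun z hz ↦ ?_
    rw [hp z hz, mquad_congr _ _ _ _ (hpξ z hz)]
  have h3 := hpξ y hy
  rw [h1, h2]
  simp only [Matrix.mul_apply, Fin.sum_univ_two, Matrix.transpose_apply] at h3 ⊢
  rw [h3, h3]
  ring

end naturality

/-- The Gauss curvature does not decrease under changes of coordinates. -/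
theorem gc_le_of_coordChange {γ γ' : E2 → Mat} {U U' V : Set E2} {Ψ : E2 → E2} {y : E2}
    (hγ : IsMetricOn γ U) (hγ' : IsMetricOn γ' U') (hΨ : IsCoordChange Ψ V) (hVU : V ⊆ U)
    (hVU' : ∀ z ∈ V, Ψ z ∈ U')
    (hp : ∀ z ∈ V, γ z = (jac Ψ z).transpose * γ' (Ψ z) * jac Ψ z) (hy : y ∈ V) :
    gc γ' (Ψ y) ≤ gc γ y := by
  set p := Ψ y with hpdef
  have hpU : p ∈ U' := hVU' y hy
  -- An affine field with ξ' = ∂₀ and ∇ξ' = 0 at the single point `p`: its slope cancels the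
  -- Christoffel symbols there. For such a field Bochner's formula at `p` reads div b = K |ξ'|²,
  -- which expresses K through quantities already known to be natural.
  set ξ' : E2 → E2 := fun z ↦ WithLp.toLp 2 fun a ↦
    stdVec 0 a + ∑ i, (-(chr γ' a i 0 p)) * (z i - p i) with hξ'def
  have hlin : ∀ a i : Fin 2, ∀ c : ℝ, ContDiff ℝ ∞ (fun z : E2 ↦ c * (z i - p i)) := fun a i c ↦
    contDiff_const.mul (((EuclideanSpace.proj (𝕜 := ℝ) i).contDiff).sub contDiff_const)
  have hξ'smooth : ∀ a, ContDiff ℝ ∞ (fun z ↦ ξ' z a) := fun a ↦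
    contDiff_const.add (ContDiff.sum fun i _ ↦ hlin a i _)
  have hξ'p : ξ' p = stdVec 0 := by
    ext a; simp [hξ'def]
  have hpdξ' : ∀ a k, pd k (fun z ↦ ξ' z a) p = -(chr γ' a k 0 p) := by
    intro a k
    have h1 : ∀ i : Fin 2, DifferentiableAt ℝ (fun z : E2 ↦ z i) p := fun i ↦
      (EuclideanSpace.proj (𝕜 := ℝ) i).differentiableAt
    have h2 : ∀ i k : Fin 2, pd k (fun z : E2 ↦ z i) p = if i = k then 1 else 0 := by
      intro i k
      have : HasFDerivAt (fun z : E2 ↦ z i) _ p := (EuclideanSpace.proj (𝕜 := ℝ) i).hasFDerivAt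
      rw [pd, this.fderiv]
      simp [stdVec]
    have d : ∀ i (c : ℝ), DifferentiableAt ℝ (fun z : E2 ↦ c * (z i - p i)) p := fun i c ↦
      ((h1 i).fun_sub (differentiableAt_const _)).const_mul c
    simp only [hξ'def, Fin.sum_univ_two]
    rw [pd_add (differentiableAt_const _) ((d 0 _).fun_add (d 1 _)), pd_const,
      pd_add (d 0 _) (d 1 _), pd_const_mul _ ((h1 0).fun_sub (differentiableAt_const _)),
      pd_const_mul _ ((h1 1).fun_sub (differentiableAt_const _)),
      pd_sub (h1 0) (differentiableAt_const _), pd_sub (h1 1) (differentiableAt_const _), h2, h2]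
    fin_cases k <;> simp
  have hcov : ∀ a k, cov γ' ξ' a k p = 0 := by
    intro a k
    rw [cov, hpdξ', hξ'p]
    simp [stdVec]
  -- The same field in the other coordinates, obtained by applying the inverse Jacobian.
  set ξ : E2 → E2 := fun z ↦ WithLp.toLp 2 fun a ↦ ∑ b, (jac Ψ z)⁻¹ a b * ξ' (Ψ z) b with hξdef
  have hγV : IsMetricOn γ V := ⟨hΨ.isOpen, fun i j ↦ (hγ.smooth i j).mono hVU,
    fun z hz ↦ hγ.symm z (hVU hz), fun z hz ↦ hγ.pos z (hVU hz), fun z hz ↦ hγ.det_pos z (hVU hz)⟩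
  have hjac : ∀ a b, ContDiffOn ℝ ∞ (fun z ↦ jac Ψ z a b) V := fun a b ↦
    contDiffOn_pd hΨ.isOpen ((EuclideanSpace.proj (𝕜 := ℝ) a).contDiff.comp_contDiffOn hΨ.smooth) b
  have hdet : ContDiffOn ℝ ∞ (fun z ↦ (jac Ψ z).det) V := by
    simp only [Matrix.det_fin_two]
    exact ((hjac 0 0).mul (hjac 1 1)).sub ((hjac 0 1).mul (hjac 1 0))
  have hjinv : ∀ a b, ContDiffOn ℝ ∞ (fun z ↦ (jac Ψ z)⁻¹ a b) V := by
    intro a b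
    fin_cases a <;> fin_cases b
    · exact ((hjac 1 1).div hdet hΨ.det_ne).congr fun z _ ↦ (inv_apply_fin_two _).1
    · exact ((hjac 0 1).neg.div hdet hΨ.det_ne).congr fun z _ ↦ (inv_apply_fin_two _).2.1
    · exact ((hjac 1 0).neg.div hdet hΨ.det_ne).congr fun z _ ↦ (inv_apply_fin_two _).2.2.1
    · exact ((hjac 0 0).div hdet hΨ.det_ne).congr fun z _ ↦ (inv_apply_fin_two _).2.2.2
  have hξ : ∀ a, ContDiffOn ℝ ∞ (fun z ↦ ξ z a) V := by
    intro a
    simp only [hξdef]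
    exact ContDiffOn.sum fun b _ ↦ (hjinv a b).mul ((hξ'smooth b).comp_contDiffOn hΨ.smooth)
  have hξ'U : ∀ a, ContDiffOn ℝ ∞ (fun z ↦ ξ' z a) U' := fun a ↦ (hξ'smooth a).contDiffOn
  have hpξ : ∀ z ∈ V, ∀ a, ξ' (Ψ z) a = ∑ b, jac Ψ z a b * ξ z b := by
    intro z hz a
    have e := mul_inv_of_det_ne (hΨ.det_ne z hz)
    have : ∑ b, jac Ψ z a b * ξ z b = Matrix.mulVec (jac Ψ z)
        (Matrix.mulVec (jac Ψ z)⁻¹ (fun b ↦ ξ' (Ψ z) b)) a := by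
      simp [hξdef, Matrix.mulVec, dotProduct]
    rw [this, Matrix.mulVec_mulVec, e, Matrix.one_mulVec]
  have hlie' : lie γ' ξ' p = 0 := by
    obtain ⟨l0, l1, l2, l3⟩ := hγ'.lie_apply hpU ξ'
    rw [hcov, hcov, mul_zero, mul_zero, add_zero, mul_zero] at l0 l3
    rw [hcov, hcov, hcov, hcov] at l1
    simp only [mul_zero, add_zero] at l1
    rw [l1] at l2
    ext i j; fin_cases i <;> fin_cases j <;> simp [l0, l1, l2, l3]
  have hlie : lie γ ξ y = 0 := by
    rw [lie_congr_on hγV hγ' hΨ subset_rfl hVU' hp hξ hξ'U hpξ hy, ← hpdef, hlie']; simp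
  have htf : lieTF γ ξ y = 0 := by
    have : mtr (γ y) 0 = 0 := by simp [mtr]
    rw [lieTF, dv, hlie, this]; simp
  -- The Lie derivative vanishes at `y`, so det ∇ξ ≥ 0. The sign suffices for one inequality between
  -- the curvatures; exchanging the charts gives the other.
  have hdet0 := hγV.four_mul_det_cov_le hy ξ
  have h0 : minner (γ y) 0 0 = 0 := by simp [minner]
  rw [htf, h0] at hdet0
  have b1 := hγ'.dv_bvec hpU hξ'U
  have b2 := hγV.dv_bvec hy hξ
  have b3 := dv_congr hγV hγ' hΨ subset_rfl hVU' hp (hγV.contDiffOn_bvec hξ)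
    (hγ'.contDiffOn_bvec hξ'U)
    (fun z hz a ↦ bvec_congr hγV hγ' hΨ subset_rfl hVU' hp hξ hξ'U hpξ hz a) hy
  have hq : mquad (γ y) (ξ y) = mquad (γ' p) (ξ' p) := by
    rw [hp y hy, mquad_congr _ _ _ _ (hpξ y hy)]
  have hqpos : 0 < mquad (γ' p) (ξ' p) := by
    rw [(hγ'.isPosMat hpU).mquad_eq, hξ'p]
    simpa [stdVec] using hγ'.pos p hpU
  rw [← hpdef, b1, b2, hq] at b3
  rw [hcov, hcov, hcov] at b3
  refine le_of_mul_le_mul_right ?_ hqpos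
  linarith

end TTSurface

namespace TTSurface

variable {M : Type*} [TopologicalSpace M] [ChartedSpace E2 M] [IsManifold 𝓘(ℝ, E2) ∞ M]

/-! ### Smooth charts and coordinate representations -/

/-- `e` is a chart of the smooth structure of `M`. -/
abbrev IsChart (e : OpenPartialHomeomorph M E2) : Prop :=
  e ∈ IsManifold.maximalAtlas 𝓘(ℝ, E2) ∞ M

lemma isChart_chartAt (x : M) : IsChart (chartAt E2 x) := IsManifold.chart_mem_maximalAtlas x

/-- The domain of the transition map from `e` to `e'`. -/
def transSource (e e' : OpenPartialHomeomorph M E2) : Set E2 := e.target ∩ e.symm ⁻¹' e'.source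

lemma isOpen_transSource (e e' : OpenPartialHomeomorph M E2) : IsOpen (transSource e e') :=
  e.isOpen_inter_preimage_symm e'.open_source

lemma mem_transSource {e e' : OpenPartialHomeomorph M E2} {x : M} (hx : x ∈ e.source)
    (hx' : x ∈ e'.source) : e x ∈ transSource e e' := by
  refine ⟨e.map_source hx, ?_⟩
  simpa [e.left_inv hx] using hx'

/-- The transition map from `e` to `e'`. -/
abbrev transMap (e e' : OpenPartialHomeomorph M E2) : E2 → E2 := fun y ↦ e' (e.symm y)

lemma IsChart.mdifferentiable {e : OpenPartialHomeomorph M E2} (he : IsChart e) :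
    e.MDifferentiable 𝓘(ℝ, E2) 𝓘(ℝ, E2) :=
  ⟨(contMDiffOn_of_mem_maximalAtlas he).mdifferentiableOn (by simp),
    (contMDiffOn_symm_of_mem_maximalAtlas he).mdifferentiableOn (by simp)⟩

lemma contDiffOn_transMap {e e' : OpenPartialHomeomorph M E2} (he : IsChart e) (he' : IsChart e') :
    ContDiffOn ℝ ∞ (transMap e e') (transSource e e') := by
  rw [← contMDiffOn_iff_contDiffOn]
  exact (contMDiffOn_of_mem_maximalAtlas he').comp
    ((contMDiffOn_symm_of_mem_maximalAtlas he).mono Set.inter_subset_left) fun y hy ↦ hy.2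

/-- The coordinates of tangent vectors at `x` in the chart `e`. -/
def coord (e : OpenPartialHomeomorph M E2) (x : M) : TangentSpace 𝓘(ℝ, E2) x →L[ℝ] E2 :=
  mfderiv 𝓘(ℝ, E2) 𝓘(ℝ, E2) e x

/-- The tangent vector at `x` with given coordinates in the chart `e`. -/
def frame (e : OpenPartialHomeomorph M E2) (x : M) : E2 →L[ℝ] TangentSpace 𝓘(ℝ, E2) x :=
  (coord e x).inverse

section

variable {e e' : OpenPartialHomeomorph M E2} (he : IsChart e) (he' : IsChart e') {x : M}
include he

lemma coord_isInvertible (hx : x ∈ e.source) : (coord e x).IsInvertible :=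
  ⟨he.mdifferentiable.mfderiv hx, rfl⟩

lemma coord_frame (hx : x ∈ e.source) (v : E2) : coord e x (frame e x v) = v := by
  obtain ⟨A, hA⟩ := coord_isInvertible he hx
  rw [frame, ← hA, ContinuousLinearMap.inverse_equiv]
  exact A.apply_symm_apply v

lemma frame_coord (hx : x ∈ e.source) (v : TangentSpace 𝓘(ℝ, E2) x) :
    frame e x (coord e x v) = v := by
  obtain ⟨A, hA⟩ := coord_isInvertible he hx
  rw [frame, ← hA, ContinuousLinearMap.inverse_equiv]
  exact A.symm_apply_apply v

include he'

lemma coord_trans (hx : x ∈ e.source) (hx' : x ∈ e'.source) (v : TangentSpace 𝓘(ℝ, E2) x) :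
    coord e' x v = fderiv ℝ (transMap e e') (e x) (coord e x v) := by
  have hV := mem_transSource hx hx'
  have h1 : MDifferentiableAt 𝓘(ℝ, E2) 𝓘(ℝ, E2) (transMap e e') (e x) :=
    (((contDiffOn_transMap he he').contDiffAt ((isOpen_transSource e e').mem_nhds hV)
      ).differentiableAt (by simp)).mdifferentiableAt
  have h2 := mfderiv_comp x h1 (he.mdifferentiable.mdifferentiableAt hx)
  have h3 : mfderiv 𝓘(ℝ, E2) 𝓘(ℝ, E2) (transMap e e' ∘ e) x = mfderiv 𝓘(ℝ, E2) 𝓘(ℝ, E2) e' x := by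
    apply Filter.EventuallyEq.mfderiv_eq
    filter_upwards [e.open_source.mem_nhds hx] with z hz
    simp [transMap, e.left_inv hz]
  rw [h3] at h2
  rw [coord, h2, mfderiv_eq_fderiv]
  rfl

omit he he' in
lemma jac_apply {Ψ : E2 → E2} {y : E2} (hΨ : DifferentiableAt ℝ Ψ y) (a b : Fin 2) :
    jac Ψ y a b = fderiv ℝ Ψ y (stdVec b) a := by
  have h1 := (EuclideanSpace.proj (𝕜 := ℝ) a).hasFDerivAt.comp y hΨ.hasFDerivAt
  have h2 : HasFDerivAt (fun z ↦ Ψ z a) _ y := h1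
  simp only [jac, Matrix.of_apply, pd]
  rw [h2.fderiv]; rfl

omit he he' in
lemma eq_sum_stdVec (v : E2) : v = v 0 • stdVec 0 + v 1 • stdVec 1 := by
  ext i; fin_cases i <;> simp [stdVec]

lemma differentiableAt_transMap {y : E2} (hy : y ∈ transSource e e') :
    DifferentiableAt ℝ (transMap e e') y :=
  ((contDiffOn_transMap he he').contDiffAt ((isOpen_transSource e e').mem_nhds hy)
    ).differentiableAt (by simp)

lemma coord_trans_apply (hx : x ∈ e.source) (hx' : x ∈ e'.source) (v : TangentSpace 𝓘(ℝ, E2) x)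
    (a : Fin 2) : coord e' x v a = ∑ b, jac (transMap e e') (e x) a b * coord e x v b := by
  have hd := differentiableAt_transMap he he' (mem_transSource hx hx')
  rw [coord_trans he he' hx hx']
  conv_lhs => rw [eq_sum_stdVec (coord e x v)]
  simp only [map_add, map_smul, Fin.sum_univ_two, jac_apply hd, PiLp.add_apply, PiLp.smul_apply,
    smul_eq_mul]
  ring

lemma frame_trans (hx : x ∈ e.source) (hx' : x ∈ e'.source) (b : Fin 2) :
    frame e x (stdVec b) = jac (transMap e e') (e x) 0 b • frame e' x (stdVec 0)
      + jac (transMap e e') (e x) 1 b • frame e' x (stdVec 1) := by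
  have h := coord_trans he he' hx hx' (frame e x (stdVec b))
  rw [coord_frame he hx] at h
  have hd := differentiableAt_transMap he he' (mem_transSource hx hx')
  rw [← frame_coord he' hx' (frame e x (stdVec b)), h, jac_apply hd, jac_apply hd]
  conv_lhs => rw [eq_sum_stdVec (fderiv ℝ (transMap e e') (e x) (stdVec b))]
  simp only [map_add, map_smul]

/-- The Jacobians of the two transition maps are inverse to each other by the chain rule. -/
lemma isCoordChange_transMap : IsCoordChange (transMap e e') (transSource e e') := by
  refine ⟨isOpen_transSource e e', contDiffOn_transMap he he', fun y hy ↦ ?_⟩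
  obtain ⟨hy1, hy2⟩ := hy
  have hx : e.symm y ∈ e.source := e.map_target hy1
  have hx' : e.symm y ∈ e'.source := hy2
  have key : jac (transMap e' e) (e' (e.symm y)) * jac (transMap e e') y = 1 := by
    ext a b
    have h1 := coord_trans_apply he' he hx' hx (frame e (e.symm y) (stdVec b)) a
    rw [coord_frame he hx] at h1
    have h2 : ∀ c, coord e' (e.symm y) (frame e (e.symm y) (stdVec b)) c
        = jac (transMap e e') y c b := by
      intro c
      rw [coord_trans_apply he he' hx hx', coord_frame he hx, e.right_inv hy1]
      simp [stdVec, PiLp.single_apply]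
    simp only [h2] at h1
    rw [Matrix.mul_apply, ← h1]
    simp [stdVec, PiLp.single_apply, Matrix.one_apply]
  intro h0
  have := congrArg Matrix.det key
  rw [Matrix.det_mul, h0] at this
  simp at this

end

/-- Families of bilinear forms on the tangent spaces. -/
abbrev Tens (M : Type*) [TopologicalSpace M] [ChartedSpace E2 M] : Type _ :=
  ∀ x : M, TangentSpace 𝓘(ℝ, E2) x →L[ℝ] TangentSpace 𝓘(ℝ, E2) x →L[ℝ] ℝ

/-- Families of tangent vectors. -/
abbrev VF (M : Type*) [TopologicalSpace M] [ChartedSpace E2 M] : Type _ :=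
  ∀ x : M, TangentSpace 𝓘(ℝ, E2) x

/-- The components of `h` at the point `x` in the chart `e`. -/
def repAt (h : Tens M) (e : OpenPartialHomeomorph M E2) (x : M) : Mat :=
  Matrix.of fun i j ↦ h x (frame e x (stdVec i)) (frame e x (stdVec j))

/-- The components of `X` at the point `x` in the chart `e`. -/
def vrepAt (X : VF M) (e : OpenPartialHomeomorph M E2) (x : M) : E2 := coord e x (X x)

/-- The components of `h` in the chart `e`. -/
def rep (h : Tens M) (e : OpenPartialHomeomorph M E2) (y : E2) : Mat := repAt h e (e.symm y)

/-- The components of `X` in the chart `e`. -/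
def vrep (X : VF M) (e : OpenPartialHomeomorph M E2) (y : E2) : E2 := vrepAt X e (e.symm y)

lemma rep_apply_chart (h : Tens M) {e : OpenPartialHomeomorph M E2} {x : M} (hx : x ∈ e.source) :
    rep h e (e x) = repAt h e x := by rw [rep, e.left_inv hx]

lemma vrep_apply_chart (X : VF M) {e : OpenPartialHomeomorph M E2} {x : M} (hx : x ∈ e.source) :
    vrep X e (e x) = vrepAt X e x := by rw [vrep, e.left_inv hx]

/-- Smooth vector fields. -/
def VSmooth (X : VF M) : Prop :=
  ∀ e : OpenPartialHomeomorph M E2, IsChart e → ∀ i, ContDiffOn ℝ ∞ (fun y ↦ vrep X e y i) e.target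

/-- Smooth two-tensors. -/
def TSmooth (h : Tens M) : Prop :=
  ∀ e : OpenPartialHomeomorph M E2, IsChart e →
    ∀ i j, ContDiffOn ℝ ∞ (fun y ↦ rep h e y i j) e.target

section

variable {e e' : OpenPartialHomeomorph M E2} (he : IsChart e) (he' : IsChart e') {y : E2}

include he in
lemma apply_eq_repAt (h : Tens M) {x : M} (hx : x ∈ e.source) (v w : TangentSpace 𝓘(ℝ, E2) x) :
    h x v w = ∑ i, ∑ j, repAt h e x i j * coord e x v i * coord e x w j := by
  conv_lhs => rw [← frame_coord he hx v, ← frame_coord he hx w, eq_sum_stdVec (coord e x v),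
    eq_sum_stdVec (coord e x w)]
  simp only [repAt, Matrix.of_apply, Fin.sum_univ_two, map_add, map_smul, add_apply,
    smul_apply, smul_eq_mul]
  ring

include he he'

lemma vrepAt_trans (X : VF M) {x : M} (hx : x ∈ e.source) (hx' : x ∈ e'.source) (a : Fin 2) :
    vrepAt X e' x a = ∑ b, jac (transMap e e') (e x) a b * vrepAt X e x b :=
  coord_trans_apply he he' hx hx' (X x) a

lemma repAt_trans (h : Tens M) {x : M} (hx : x ∈ e.source) (hx' : x ∈ e'.source) :
    repAt h e x = (jac (transMap e e') (e x)).transpose * repAt h e' x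
      * jac (transMap e e') (e x) := by
  ext i j
  simp only [repAt, Matrix.mul_apply, Matrix.of_apply, Matrix.transpose_apply, Fin.sum_univ_two]
  rw [frame_trans he he' hx hx' i, frame_trans he he' hx hx' j]
  simp only [map_add, map_smul, add_apply, smul_apply, smul_eq_mul]
  ring

lemma vrep_trans (X : VF M) (hy : y ∈ transSource e e') (a : Fin 2) :
    vrep X e' (transMap e e' y) a = ∑ b, jac (transMap e e') y a b * vrep X e y b := by
  have := vrepAt_trans he he' X (e.map_target hy.1) hy.2 a
  rw [vrep, transMap, e'.left_inv hy.2, this, e.right_inv hy.1]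
  rfl

lemma rep_trans (h : Tens M) (hy : y ∈ transSource e e') :
    rep h e y = (jac (transMap e e') y).transpose * rep h e' (transMap e e' y)
      * jac (transMap e e') y := by
  have := repAt_trans he he' h (e.map_target hy.1) hy.2
  rw [e.right_inv hy.1] at this
  rw [rep, this, rep, transMap, e'.left_inv hy.2]

end

lemma contDiffAt_jac {Ψ : E2 → E2} {y : E2} (hΨ : ContDiffAt ℝ ∞ Ψ y) (a b : Fin 2) :
    ContDiffAt ℝ ∞ (fun z ↦ jac Ψ z a b) y := contDiffAt_pd (hΨ.euclidean_apply a) b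

/-- A vector field is smooth if it is smooth in suitable charts. -/
lemma vSmooth_of_local {X : VF M} (h : ∀ x, ∃ e : OpenPartialHomeomorph M E2, IsChart e ∧
    x ∈ e.source ∧ ∀ i, ContDiffAt ℝ ∞ (fun y ↦ vrep X e y i) (e x)) : VSmooth X := by
  intro e' he' i y hy
  obtain ⟨e, he, hx, hs⟩ := h (e'.symm y)
  have hV : y ∈ transSource e' e := ⟨hy, hx⟩
  have hV' : e (e'.symm y) ∈ transSource e e' := mem_transSource hx (e'.map_target hy)
  have hback : ContDiffAt ℝ ∞ (transMap e' e) y :=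
    (contDiffOn_transMap he' he).contDiffAt ((isOpen_transSource e' e).mem_nhds hV)
  have hforw : ContDiffAt ℝ ∞ (transMap e e') (e (e'.symm y)) :=
    (contDiffOn_transMap he he').contDiffAt ((isOpen_transSource e e').mem_nhds hV')
  have key : ContDiffAt ℝ ∞ (fun z ↦ ∑ b, jac (transMap e e') (transMap e' e z) i b
      * vrep X e (transMap e' e z) b) y :=
    ContDiffAt.sum fun b _ ↦ (ContDiffAt.comp (g := fun z ↦ jac (transMap e e') z i b) y
      (contDiffAt_jac hforw i b) hback).mul
        (ContDiffAt.comp (g := fun z ↦ vrep X e z b) y (hs b) hback)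
  refine (key.congr_of_eventuallyEq ?_).contDiffWithinAt
  filter_upwards [(isOpen_transSource e' e).mem_nhds hV] with z hz
  have hz' : transMap e' e z ∈ transSource e e' := mem_transSource hz.2 (e'.map_target hz.1)
  rw [← vrep_trans he he' X hz' i]
  simp [transMap, e.left_inv hz.2, e'.right_inv hz.1]

/-- A tensor is smooth if it is smooth in suitable charts. -/
lemma tSmooth_of_local {h : Tens M} (hl : ∀ x, ∃ e : OpenPartialHomeomorph M E2, IsChart e ∧
    x ∈ e.source ∧ ∀ i j, ContDiffAt ℝ ∞ (fun y ↦ rep h e y i j) (e x)) : TSmooth h := by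
  intro e' he' i j y hy
  obtain ⟨e, he, hx, hs⟩ := hl (e'.symm y)
  have hV : y ∈ transSource e' e := ⟨hy, hx⟩
  have hback : ContDiffAt ℝ ∞ (transMap e' e) y :=
    (contDiffOn_transMap he' he).contDiffAt ((isOpen_transSource e' e).mem_nhds hV)
  have key : ContDiffAt ℝ ∞ (fun z ↦ ∑ b, (∑ a, jac (transMap e' e) z a i
      * rep h e (transMap e' e z) a b) * jac (transMap e' e) z b j) y :=
    ContDiffAt.sum fun b _ ↦ (ContDiffAt.sum fun a _ ↦ (contDiffAt_jac hback a i).mul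
      (ContDiffAt.comp (g := fun z ↦ rep h e z a b) y (hs a b) hback)).mul
        (contDiffAt_jac hback b j)
  refine (key.congr_of_eventuallyEq ?_).contDiffWithinAt
  filter_upwards [(isOpen_transSource e' e).mem_nhds hV] with z hz
  rw [rep_trans he' he h hz]
  simp [Matrix.mul_apply]

/-! ### Sections of bundles and their components -/

/-- The bridge between the trivialization used in the statement and the derivative of the chart,
which is defined for every chart of the maximal atlas and is used from here on. -/
lemma coordVec_eq_frame (c x : M) (hx : x ∈ (chartAt E2 c).source) (i : Fin 2) :
    coordVec c x i = frame (chartAt E2 c) x (stdVec i) := by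
  have h1 : (trivializationAt E2 (TangentSpace 𝓘(ℝ, E2) : M → Type _) c).continuousLinearMapAt ℝ x
      = coord (chartAt E2 c) x := by
    rw [TangentBundle.continuousLinearMapAt_trivializationAt hx]
    exact (hasMFDerivAt_extChartAt hx).mfderiv
  have hb : x ∈ (trivializationAt E2 (TangentSpace 𝓘(ℝ, E2) : M → Type _) c).baseSet := by
    rwa [TangentBundle.trivializationAt_baseSet]
  have h2 := Bundle.Trivialization.symmL_continuousLinearMapAt (R := ℝ)
    (trivializationAt E2 (TangentSpace 𝓘(ℝ, E2) : M → Type _) c) hb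
    (frame (chartAt E2 c) x (stdVec i))
  rw [h1, coord_frame (isChart_chartAt c) hx] at h2
  exact h2

lemma coordCovec_eq_coord (c x : M) (hx : x ∈ (chartAt E2 c).source) (i : Fin 2)
    (v : TangentSpace 𝓘(ℝ, E2) x) : coordCovec c x i v = coord (chartAt E2 c) x v i := by
  have h1 : (trivializationAt E2 (TangentSpace 𝓘(ℝ, E2) : M → Type _) c).continuousLinearMapAt ℝ x
      = coord (chartAt E2 c) x := by
    rw [TangentBundle.continuousLinearMapAt_trivializationAt hx]
    exact (hasMFDerivAt_extChartAt hx).mfderiv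
  rw [coordCovec, h1]; rfl

lemma components_eq_rep (h : Tens M) (c : M) {y : E2} (hy : y ∈ (chartAt E2 c).target) :
    components h c ((chartAt E2 c).symm y) = rep h (chartAt E2 c) y := by
  ext i j
  simp only [components, rep, repAt, Matrix.of_apply]
  rw [coordVec_eq_frame c _ ((chartAt E2 c).map_target hy),
    coordVec_eq_frame c _ ((chartAt E2 c).map_target hy)]

end TTSurface

/-! ### Smooth sections and smooth components. -/

namespace TTSurface

variable {M : Type*} [TopologicalSpace M] [ChartedSpace E2 M] [IsManifold 𝓘(ℝ, E2) ∞ M]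

/-- The coordinate expression of `h` with respect to the trivialization at `x₀`. -/
def inCoord (h : Tens M) (x₀ x : M) : E2 →L[ℝ] E2 →L[ℝ] ℝ :=
  ContinuousLinearMap.inCoordinates E2 (fun x : M ↦ TangentSpace 𝓘(ℝ, E2) x) (E2 →L[ℝ] ℝ)
    (fun x : M ↦ TangentSpace 𝓘(ℝ, E2) x →L[ℝ] ℝ) x₀ x x₀ x (h x)

lemma inCoord_stdVec (h : Tens M) {x₀ x : M} (hx : x ∈ (chartAt E2 x₀).source) (i j : Fin 2) :
    inCoord h x₀ x (stdVec i) (stdVec j) = rep h (chartAt E2 x₀) (chartAt E2 x₀ x) i j := by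
  have hb : x ∈ (trivializationAt E2 (TangentSpace 𝓘(ℝ, E2) : M → Type _) x₀).baseSet := by
    rwa [TangentBundle.trivializationAt_baseSet]
  rw [rep_apply_chart _ hx]
  have := inCoordinates_apply_eq₂ (𝕜 := ℝ) (F₃ := ℝ) (E₃ := fun _ : M ↦ ℝ)
    (ϕ := h x) (v := stdVec i) (w := stdVec j) hb hb (Set.mem_univ x)
  refine Eq.trans this ?_
  simp only [repAt, Matrix.of_apply]
  rw [← coordVec_eq_frame x₀ x hx, ← coordVec_eq_frame x₀ x hx]
  simp only [coordVec]
  rw [Bundle.Trivialization.symmL_apply _ hb, Bundle.Trivialization.symmL_apply _ hb]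
  simp

lemma inCoord_apply (h : Tens M) {x₀ x : M} (hx : x ∈ (chartAt E2 x₀).source) (v w : E2) :
    inCoord h x₀ x v w
      = ∑ i, ∑ j, rep h (chartAt E2 x₀) (chartAt E2 x₀ x) i j * (v i * w j) := by
  conv_lhs => rw [eq_sum_stdVec v, eq_sum_stdVec w]
  simp only [map_add, map_smul, add_apply, smul_apply, smul_eq_mul, inCoord_stdVec h hx,
    Fin.sum_univ_two]
  ring

/-- Smoothness of a section of the Hom bundle is smoothness of its coordinate expression at every
base point. -/
lemma contMDiff_iff_inCoord (h : Tens M) :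
    ContMDiff 𝓘(ℝ, E2) (𝓘(ℝ, E2).prod 𝓘(ℝ, E2 →L[ℝ] E2 →L[ℝ] ℝ)) ∞
      (fun x ↦ Bundle.TotalSpace.mk' (E2 →L[ℝ] E2 →L[ℝ] ℝ)
        (E := fun x : M ↦ TangentSpace 𝓘(ℝ, E2) x →L[ℝ] TangentSpace 𝓘(ℝ, E2) x →L[ℝ] ℝ) x (h x))
    ↔ ∀ x₀ : M, ContMDiffAt 𝓘(ℝ, E2) 𝓘(ℝ, E2 →L[ℝ] E2 →L[ℝ] ℝ) ∞ (inCoord h x₀) x₀ := by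
  refine forall_congr' fun x₀ ↦ ?_
  rw [contMDiffAt_hom_bundle]
  exact and_iff_right contMDiffAt_id

lemma tSmooth_of_contMDiff {h : Tens M}
    (hh : ∀ x₀ : M, ContMDiffAt 𝓘(ℝ, E2) 𝓘(ℝ, E2 →L[ℝ] E2 →L[ℝ] ℝ) ∞ (inCoord h x₀) x₀) :
    TSmooth h := by
  refine tSmooth_of_local fun x₀ ↦ ⟨chartAt E2 x₀, isChart_chartAt x₀, mem_chart_source E2 x₀, ?_⟩
  intro i j
  set c := chartAt E2 x₀ with hc
  have hx₀ : x₀ ∈ c.source := mem_chart_source E2 x₀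
  have h1 : ContMDiffAt 𝓘(ℝ, E2) 𝓘(ℝ, E2) ∞ c.symm (c x₀) :=
    contMDiffAt_symm_of_mem_maximalAtlas (isChart_chartAt x₀) (c.map_source hx₀)
  have h2 : ContMDiffAt 𝓘(ℝ, E2) 𝓘(ℝ, E2 →L[ℝ] E2 →L[ℝ] ℝ) ∞ (inCoord h x₀) (c.symm (c x₀)) := by
    rw [c.left_inv hx₀]; exact hh x₀
  have h3 := (h2.comp (c x₀) h1).contDiffAt
  have h4 := (h3.clm_apply (contDiffAt_const (c := stdVec i))).clm_apply
    (contDiffAt_const (c := stdVec j))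
  refine h4.congr_of_eventuallyEq ?_
  filter_upwards [c.open_target.mem_nhds (c.map_source hx₀)] with y hy
  rw [Function.comp_apply, inCoord_stdVec h (c.map_target hy), c.right_inv hy]

set_option synthInstance.maxHeartbeats 400000 in
lemma contMDiffAt_inCoord {h : Tens M} (hh : TSmooth h) (x₀ : M) :
    ContMDiffAt 𝓘(ℝ, E2) 𝓘(ℝ, E2 →L[ℝ] E2 →L[ℝ] ℝ) ∞ (inCoord h x₀) x₀ := by
  set c := chartAt E2 x₀ with hc
  have hx₀ : x₀ ∈ c.source := mem_chart_source E2 x₀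
  have h1 : ContMDiffAt 𝓘(ℝ, E2) 𝓘(ℝ, E2) ∞ c x₀ :=
    contMDiffAt_of_mem_maximalAtlas (isChart_chartAt x₀) hx₀
  have h2 : ContDiffOn ℝ ∞ (fun y ↦ inCoord h x₀ (c.symm y)) c.target := by
    refine contDiffOn_clm_apply.2 fun v ↦ contDiffOn_clm_apply.2 fun w ↦ ?_
    have : ContDiffOn ℝ ∞ (fun y ↦ ∑ i, ∑ j, rep h c y i j * (v i * w j)) c.target :=
      ContDiffOn.sum fun i _ ↦ ContDiffOn.sum fun j _ ↦
        (hh c (isChart_chartAt x₀) i j).mul contDiffOn_const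
    refine this.congr fun y hy ↦ ?_
    rw [inCoord_apply h (c.map_target hy), ← hc, c.right_inv hy]
  have h3 := (h2.contDiffAt (c.open_target.mem_nhds (c.map_source hx₀))).contMDiffAt
  refine (h3.comp x₀ h1).congr_of_eventuallyEq ?_
  filter_upwards [c.open_source.mem_nhds hx₀] with x hx
  rw [Function.comp_apply, c.left_inv hx]

lemma Tensor2.tSmooth (h : Tensor2 M) : TSmooth (fun x ↦ h x) :=
  tSmooth_of_contMDiff ((contMDiff_iff_inCoord fun x ↦ h x).1 h.contMDiff_toFun)

/-- The smooth section defined by a smooth tensor. -/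
def mkTensor2 (h : Tens M) (hh : TSmooth h) : Tensor2 M :=
  ⟨h, (contMDiff_iff_inCoord h).2 (contMDiffAt_inCoord hh)⟩

lemma Metric.tSmooth (g : Metric M) : TSmooth g.inner :=
  tSmooth_of_contMDiff ((contMDiff_iff_inCoord g.inner).1 g.contMDiff)

section

variable {e : OpenPartialHomeomorph M E2} (he : IsChart e)
include he

lemma frame_ne_zero {x : M} (hx : x ∈ e.source) {v : E2} (hv : v ≠ 0) : frame e x v ≠ 0 := by
  intro h
  have := coord_frame he hx v
  rw [h, map_zero] at this
  exact hv this.symm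

lemma Metric.isPosMat (g : Metric M) {x : M} (hx : x ∈ e.source) :
    IsPosMat (repAt g.inner e x) := by
  have hs : repAt g.inner e x 1 0 = repAt g.inner e x 0 1 := g.symm _ _ _
  have hpos : ∀ v : E2, v ≠ 0 → 0 < mquad (repAt g.inner e x) v := by
    intro v hv
    have := g.pos x _ (frame_ne_zero he hx hv)
    rw [apply_eq_repAt he g.inner hx, coord_frame he hx] at this
    exact this
  have h0 : stdVec 0 ≠ 0 := fun h ↦ by simpa [stdVec] using congrArg (fun v : E2 ↦ v 0) h
  have hE : 0 < repAt g.inner e x 0 0 := by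
    have := hpos _ h0
    simpa [mquad, stdVec] using this
  refine ⟨hs, hE, ?_⟩
  set γ := repAt g.inner e x
  -- On this vector the quadratic form takes the value γ₀₀ det γ, so positivity of the determinant
  -- follows.
  set v : E2 := WithLp.toLp 2 ![- γ 0 1, γ 0 0] with hv
  have hv0 : v ≠ 0 := fun h ↦ by
    have := congrArg (fun v : E2 ↦ v 1) h
    simp [hv] at this
    exact hE.ne' this
  have := hpos v hv0
  have e1 : mquad γ v = γ 0 0 * (γ 0 0 * γ 1 1 - γ 0 1 * γ 0 1) := by
    simp [mquad, hv, hs]; ring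
  rw [e1] at this
  exact (mul_pos_iff_of_pos_left hE).1 this

lemma Metric.isMetricOn (g : Metric M) : IsMetricOn (rep g.inner e) e.target where
  isOpen := e.open_target
  smooth := Metric.tSmooth g e he
  symm _ hy := (Metric.isPosMat he g (e.map_target hy)).symm
  pos _ hy := (Metric.isPosMat he g (e.map_target hy)).pos
  det_pos _ hy := (Metric.isPosMat he g (e.map_target hy)).det_pos

end

/-! ### Tensors and vector fields with prescribed components -/

/-- The bilinear form at `x` with components `m` in the chart `e`. -/
def bilinOf (e : OpenPartialHomeomorph M E2) (x : M) (m : Mat) :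
    TangentSpace 𝓘(ℝ, E2) x →L[ℝ] TangentSpace 𝓘(ℝ, E2) x →L[ℝ] ℝ :=
  ∑ i, ∑ j, m i j • (((EuclideanSpace.proj i : E2 →L[ℝ] ℝ) ∘L coord e x).smulRight
    ((EuclideanSpace.proj j : E2 →L[ℝ] ℝ) ∘L coord e x))

lemma bilinOf_apply (e : OpenPartialHomeomorph M E2) (x : M) (m : Mat)
    (v w : TangentSpace 𝓘(ℝ, E2) x) :
    bilinOf e x m v w = ∑ i, ∑ j, m i j * (coord e x v i * coord e x w j) := by
  simp [bilinOf, Fin.sum_univ_two]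

lemma repAt_bilinOf {e : OpenPartialHomeomorph M E2} (he : IsChart e) {x : M} (hx : x ∈ e.source)
    (h : Tens M) {m : Mat} (hm : h x = bilinOf e x m) : repAt h e x = m := by
  ext i j
  simp only [repAt, Matrix.of_apply]
  rw [hm, bilinOf_apply, coord_frame he hx, coord_frame he hx]
  fin_cases i <;> fin_cases j <;> simp [stdVec]

lemma vrepAt_frame {e : OpenPartialHomeomorph M E2} (he : IsChart e) {x : M} (hx : x ∈ e.source)
    (X : VF M) {v : E2} (hv : X x = frame e x v) : vrepAt X e x = v := by
  rw [vrepAt, hv, coord_frame he hx]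

/-- Coordinate expressions of a two-tensor which are compatible with changes of charts. -/
def Natural2 (F : OpenPartialHomeomorph M E2 → E2 → Mat) : Prop :=
  ∀ e e', IsChart e → IsChart e' → ∀ y ∈ transSource e e',
    F e y = (jac (transMap e e') y).transpose * F e' (transMap e e' y) * jac (transMap e e') y

/-- Coordinate expressions of a vector field which are compatible with changes of charts. -/
def Natural1 (F : OpenPartialHomeomorph M E2 → E2 → E2) : Prop :=
  ∀ e e', IsChart e → IsChart e' → ∀ y ∈ transSource e e', ∀ a,
    F e' (transMap e e' y) a = ∑ b, jac (transMap e e') y a b * F e y b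

/-- The tensor with given coordinate expressions. -/
def tensOf (F : OpenPartialHomeomorph M E2 → E2 → Mat) : Tens M := fun x ↦
  bilinOf (chartAt E2 x) x (F (chartAt E2 x) (chartAt E2 x x))

/-- The vector field with given coordinate expressions. -/
def vfOf (F : OpenPartialHomeomorph M E2 → E2 → E2) : VF M := fun x ↦
  frame (chartAt E2 x) x (F (chartAt E2 x) (chartAt E2 x x))

/-- The tensor is defined at each point through the preferred chart there; naturality makes its
components correct in every chart. -/
lemma rep_tensOf {F : OpenPartialHomeomorph M E2 → E2 → Mat} (hF : Natural2 F)
    {e : OpenPartialHomeomorph M E2} (he : IsChart e) {y : E2} (hy : y ∈ e.target) :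
    rep (tensOf F) e y = F e y := by
  set x := e.symm y with hx
  have h1 : x ∈ e.source := e.map_target hy
  have h2 : x ∈ (chartAt E2 x).source := mem_chart_source E2 x
  have h3 := repAt_trans he (isChart_chartAt x) (tensOf F) h1 h2
  have h4 := hF e (chartAt E2 x) he (isChart_chartAt x) (e x) (mem_transSource h1 h2)
  rw [repAt_bilinOf (isChart_chartAt x) h2 (tensOf F) rfl] at h3
  rw [transMap, e.left_inv h1] at h4
  rw [rep, ← hx, h3, ← h4, hx, e.right_inv hy]

lemma vrep_vfOf {F : OpenPartialHomeomorph M E2 → E2 → E2} (hF : Natural1 F)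
    {e : OpenPartialHomeomorph M E2} (he : IsChart e) {y : E2} (hy : y ∈ e.target) :
    vrep (vfOf F) e y = F e y := by
  set x := e.symm y with hx
  have h1 : x ∈ e.source := e.map_target hy
  have h2 : x ∈ (chartAt E2 x).source := mem_chart_source E2 x
  have h3 := vrepAt_trans (isChart_chartAt x) he (vfOf F) h2 h1
  have h4 := hF (chartAt E2 x) e (isChart_chartAt x) he (chartAt E2 x x) (mem_transSource h2 h1)
  rw [vrepAt_frame (isChart_chartAt x) h2 (vfOf F) rfl] at h3
  rw [transMap, (chartAt E2 x).left_inv h2] at h4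
  ext a
  rw [vrep, ← hx, h3, ← h4, hx, e.right_inv hy]

lemma tSmooth_tensOf {F : OpenPartialHomeomorph M E2 → E2 → Mat} (hF : Natural2 F)
    (hs : ∀ e, IsChart e → ∀ i j, ContDiffOn ℝ ∞ (fun y ↦ F e y i j) e.target) :
    TSmooth (tensOf F) := fun e he i j ↦
  (hs e he i j).congr fun y hy ↦ by rw [rep_tensOf hF he hy]

lemma vSmooth_vfOf {F : OpenPartialHomeomorph M E2 → E2 → E2} (hF : Natural1 F)
    (hs : ∀ e, IsChart e → ∀ i, ContDiffOn ℝ ∞ (fun y ↦ F e y i) e.target) :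
    VSmooth (vfOf F) := fun e he i ↦
  (hs e he i).congr fun y hy ↦ by rw [vrep_vfOf hF he hy]

/-! ### Natural operations on vector fields and tensors -/

section natural

variable (g : Metric M)

/-- The trace-free part of the Lie derivative of the metric. -/
def lieT (X : VF M) : Tens M := tensOf fun e ↦ lieTF (rep g.inner e) (vrep X e)

/-- The divergence of a vector field. -/
def dvM (X : VF M) (x : M) : ℝ :=
  dv (rep g.inner (chartAt E2 x)) (vrep X (chartAt E2 x)) (chartAt E2 x x)

/-- The vector field dual to `h(X, ·)`. -/
def sharpM (h : Tens M) (X : VF M) : VF M :=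
  vfOf fun e ↦ sharp (rep g.inner e) (rep h e) (vrep X e)

/-- The vector field `∇_X X - (div X) X`. -/
def bvecM (X : VF M) : VF M := vfOf fun e ↦ bvec (rep g.inner e) (vrep X e)

variable {X : VF M} (hX : VSmooth X)

lemma transMap_mem_target {e e' : OpenPartialHomeomorph M E2} {y : E2}
    (hy : y ∈ transSource e e') : transMap e e' y ∈ e'.target := e'.map_source hy.2

include hX

lemma natural_lieTF : Natural2 fun e ↦ lieTF (rep g.inner e) (vrep X e) :=
  fun e e' he he' _ hy ↦ lieTF_congr (Metric.isMetricOn he g) (Metric.isMetricOn he' g)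
    (isCoordChange_transMap he he') Set.inter_subset_left (fun _ hz ↦ transMap_mem_target hz)
    (fun _ hz ↦ rep_trans he he' g.inner hz) (hX e he) (hX e' he')
    (fun _ hz ↦ vrep_trans he he' X hz) hy

lemma natural_bvec : Natural1 fun e ↦ bvec (rep g.inner e) (vrep X e) :=
  fun e e' he he' _ hy ↦ bvec_congr (Metric.isMetricOn he g) (Metric.isMetricOn he' g)
    (isCoordChange_transMap he he') Set.inter_subset_left (fun _ hz ↦ transMap_mem_target hz)
    (fun _ hz ↦ rep_trans he he' g.inner hz) (hX e he) (hX e' he')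
    (fun _ hz ↦ vrep_trans he he' X hz) hy

lemma dvM_apply {e : OpenPartialHomeomorph M E2} (he : IsChart e) {x : M} (hx : x ∈ e.source) :
    dvM g X x = dv (rep g.inner e) (vrep X e) (e x) := by
  set c := chartAt E2 x with hcdef
  have hc : IsChart c := isChart_chartAt x
  have hxc : x ∈ c.source := mem_chart_source E2 x
  have := dv_congr (Metric.isMetricOn hc g) (Metric.isMetricOn he g)
    (isCoordChange_transMap hc he) Set.inter_subset_left (fun _ hz ↦ transMap_mem_target hz)
    (fun _ hz ↦ rep_trans hc he g.inner hz) (hX c hc) (hX e he)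
    (fun _ hz ↦ vrep_trans hc he X hz) (mem_transSource hxc hx)
  rw [transMap, c.left_inv hxc] at this
  exact this

lemma tSmooth_lieT : TSmooth (lieT g X) :=
  tSmooth_tensOf (natural_lieTF g hX) fun e he ↦ (Metric.isMetricOn he g).contDiffOn_lieTF (hX e he)

lemma vSmooth_bvecM : VSmooth (bvecM g X) :=
  vSmooth_vfOf (natural_bvec g hX) fun e he ↦ (Metric.isMetricOn he g).contDiffOn_bvec (hX e he)

omit hX in
lemma natural_sharp (h : Tens M) (X : VF M) :
    Natural1 fun e ↦ sharp (rep g.inner e) (rep h e) (vrep X e) := by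
  intro e e' he he' y hy a
  have h1 := rep_trans he he' h hy
  have h2 := vrep_trans he he' X hy
  simp only [sharp_eq_raise]
  rw [rep_trans he he' g.inner hy]
  refine raise_congr ((isCoordChange_transMap he he').det_ne y hy) _ (fun j ↦ ?_) a
  rw [h1]
  simp only [Matrix.mul_apply, Fin.sum_univ_two, Matrix.transpose_apply] at h2 ⊢
  rw [h2, h2]
  ring

lemma vSmooth_sharpM {h : Tens M} (hh : TSmooth h) : VSmooth (sharpM g h X) :=
  vSmooth_vfOf (natural_sharp g h X) fun e he ↦
    (Metric.isMetricOn he g).contDiffOn_sharp (hX e he) (hh e he)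

end natural

end TTSurface

namespace TTSurface

variable {M : Type*} [TopologicalSpace M] [ChartedSpace E2 M] [IsManifold 𝓘(ℝ, E2) ∞ M]

/-! ### The quantities of the statement in terms of coordinate expressions -/

lemma components_self (h : Tens M) (x : M) : components h x x = repAt h (chartAt E2 x) x := by
  ext i j
  simp only [components, repAt, Matrix.of_apply, coordVec_eq_frame x x (mem_chart_source E2 x)]

lemma partialDeriv_eq {c : M} {f : M → ℝ} {F : E2 → ℝ}
    (h : ∀ y ∈ (chartAt E2 c).target, f ((chartAt E2 c).symm y) = F y) {x : M}
    (hx : x ∈ (chartAt E2 c).source) (k : Fin 2) :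
    partialDeriv c k f x = pd k F (chartAt E2 c x) :=
  pd_congr_of_isOpen (chartAt E2 c).open_target ((chartAt E2 c).map_source hx) h

section

variable (g : Metric M)

lemma invMetric_self (x : M) : invMetric g x x = (repAt g.inner (chartAt E2 x) x)⁻¹ := by
  rw [invMetric, components_self]

lemma christoffel_symm_apply {c : M} (k i j : Fin 2) {y : E2} (hy : y ∈ (chartAt E2 c).target) :
    christoffel g c k i j ((chartAt E2 c).symm y) = chr (rep g.inner (chartAt E2 c)) k i j y := by
  have hs := (chartAt E2 c).map_target hy
  have h1 : ∀ a b l, partialDeriv c l (fun z ↦ components g.inner c z a b) ((chartAt E2 c).symm y)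
      = pd l (fun z ↦ rep g.inner (chartAt E2 c) z a b) y := by
    intro a b l
    rw [partialDeriv_eq (F := fun z ↦ rep g.inner (chartAt E2 c) z a b)
      (fun z hz ↦ by rw [components_eq_rep _ _ hz]) hs, (chartAt E2 c).right_inv hy]
  simp only [christoffel, chr, h1, invMetric, components_eq_rep _ _ hy]

lemma christoffel_eq {c x : M} (k i j : Fin 2) (hx : x ∈ (chartAt E2 c).source) :
    christoffel g c k i j x = chr (rep g.inner (chartAt E2 c)) k i j (chartAt E2 c x) := by
  rw [← christoffel_symm_apply g k i j ((chartAt E2 c).map_source hx), (chartAt E2 c).left_inv hx]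

lemma gaussCurvature_eq (x : M) :
    gaussCurvature g x = gc (rep g.inner (chartAt E2 x)) (chartAt E2 x x) := by
  have hx := mem_chart_source E2 x
  have h1 : ∀ a b d l, partialDeriv x l (christoffel g x a b d) x
      = pd l (chr (rep g.inner (chartAt E2 x)) a b d) (chartAt E2 x x) := fun a b d l ↦
    partialDeriv_eq (fun z hz ↦ christoffel_symm_apply g a b d hz) hx l
  simp only [gaussCurvature, gc, riemannCurv, rc, h1, christoffel_eq g _ _ _ hx, components_self,
    rep_apply_chart _ hx]

/-- The statement computes the curvature in the preferred chart of each point. The one-sided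
inequality `gc_le_of_coordChange`, applied in both directions, shows that the chart does not matter.
-/
lemma gc_eq_gaussCurvature {e : OpenPartialHomeomorph M E2} (he : IsChart e) {x : M}
    (hx : x ∈ e.source) : gc (rep g.inner e) (e x) = gaussCurvature g x := by
  rw [gaussCurvature_eq]
  set c := chartAt E2 x with hcdef
  have hc : IsChart c := isChart_chartAt x
  have hxc : x ∈ c.source := mem_chart_source E2 x
  have key : ∀ {e e' : OpenPartialHomeomorph M E2}, IsChart e → IsChart e' → x ∈ e.source →
      x ∈ e'.source → gc (rep g.inner e') (e' x) ≤ gc (rep g.inner e) (e x) := by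
    intro e e' he he' hx hx'
    have := gc_le_of_coordChange (Metric.isMetricOn he g) (Metric.isMetricOn he' g)
      (isCoordChange_transMap he he') Set.inter_subset_left (fun z hz ↦ transMap_mem_target hz)
      (fun z hz ↦ rep_trans he he' g.inner hz) (mem_transSource hx hx')
    rwa [transMap, e.left_inv hx] at this
  exact le_antisymm (key hc he hxc hx) (key he hc hx hxc)

lemma trace_eq (h : Tensor2 M) (x : M) :
    trace g h x = mtr (repAt g.inner (chartAt E2 x) x) (repAt (fun x ↦ h x) (chartAt E2 x) x) := by
  simp only [trace, mtr, invMetric_self]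
  rw [components_self]

/-- The pointwise inner product of two-tensors. -/
def tinner (h k : Tens M) (x : M) : ℝ :=
  minner (repAt g.inner (chartAt E2 x) x) (repAt h (chartAt E2 x) x) (repAt k (chartAt E2 x) x)

lemma tensorInner_eq (h k : Tensor2 M) (x : M) :
    tensorInner g h k x = tinner g (fun x ↦ h x) (fun x ↦ k x) x := by
  simp only [tensorInner, tinner, minner, invMetric_self]
  rw [components_self, components_self]

lemma covectorNormSq_eq (x : M) (α : TangentSpace 𝓘(ℝ, E2) x →L[ℝ] ℝ) :
    covectorNormSq g x α = cquad (repAt g.inner (chartAt E2 x) x)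
      fun i ↦ α (frame (chartAt E2 x) x (stdVec i)) := by
  simp only [covectorNormSq, cquad, invMetric_self, coordVec_eq_frame x x (mem_chart_source E2 x)]

lemma divergence_apply (h : Tensor2 M) (x : M) (v : TangentSpace 𝓘(ℝ, E2) x) :
    divergence g h x v = ∑ j, ldiv (rep g.inner (chartAt E2 x)) (rep (fun x ↦ h x) (chartAt E2 x)) j
      (chartAt E2 x x) * coord (chartAt E2 x) x v j := by
  have hx := mem_chart_source E2 x
  have h1 : ∀ a b l, partialDeriv x l (fun z ↦ components (fun x ↦ h x) x z a b) x
      = pd l (fun z ↦ rep (fun x ↦ h x) (chartAt E2 x) z a b) (chartAt E2 x x) := fun a b l ↦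
    partialDeriv_eq (fun z hz ↦ by rw [components_eq_rep _ _ hz]) hx l
  have h2 : ∀ i k j, covDeriv g h x i k j x
      = pd i (fun z ↦ rep (fun x ↦ h x) (chartAt E2 x) z k j) (chartAt E2 x x)
      - ∑ m, (chr (rep g.inner (chartAt E2 x)) m i k (chartAt E2 x x)
          * rep (fun x ↦ h x) (chartAt E2 x) (chartAt E2 x x) m j
        + chr (rep g.inner (chartAt E2 x)) m i j (chartAt E2 x x)
          * rep (fun x ↦ h x) (chartAt E2 x) (chartAt E2 x x) k m) := by
    intro i k j
    simp only [covDeriv, ← h1, christoffel_eq g _ _ _ hx, rep_apply_chart _ hx, ← components_self]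
  have h3 : ∀ j, ldiv (rep g.inner (chartAt E2 x)) (rep (fun x ↦ h x) (chartAt E2 x)) j
      (chartAt E2 x x) = -∑ i, ∑ k, invMetric g x x i k * covDeriv g h x i k j x := fun j ↦ by
    simp only [ldiv, h2, invMetric_self, rep_apply_chart g.inner hx]
  simp only [divergence, h3, sum_apply, smul_apply, smul_eq_mul, coordCovec_eq_coord x x hx]

variable {e : OpenPartialHomeomorph M E2} (he : IsChart e) {x : M} (hx : x ∈ e.source)
include he hx

lemma det_jac_chart_ne :
    (jac (transMap (chartAt E2 x) e) (chartAt E2 x x)).det ≠ 0 :=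
  (isCoordChange_transMap (isChart_chartAt x) he).det_ne _
    (mem_transSource (mem_chart_source E2 x) hx)

lemma tinner_apply (h k : Tens M) :
    tinner g h k x = minner (repAt g.inner e x) (repAt h e x) (repAt k e x) := by
  rw [tinner, repAt_trans (isChart_chartAt x) he g.inner (mem_chart_source E2 x) hx,
    repAt_trans (isChart_chartAt x) he h (mem_chart_source E2 x) hx,
    repAt_trans (isChart_chartAt x) he k (mem_chart_source E2 x) hx]
  exact minner_congr (det_jac_chart_ne he hx) _ _ _

lemma mtr_repAt (h : Tens M) :
    mtr (repAt g.inner (chartAt E2 x) x) (repAt h (chartAt E2 x) x)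
      = mtr (repAt g.inner e x) (repAt h e x) := by
  rw [repAt_trans (isChart_chartAt x) he g.inner (mem_chart_source E2 x) hx,
    repAt_trans (isChart_chartAt x) he h (mem_chart_source E2 x) hx]
  exact mtr_congr (det_jac_chart_ne he hx) _ _

lemma covectorNormSq_apply (α : TangentSpace 𝓘(ℝ, E2) x →L[ℝ] ℝ) :
    covectorNormSq g x α = cquad (repAt g.inner e x) fun i ↦ α (frame e x (stdVec i)) := by
  rw [covectorNormSq_eq, repAt_trans (isChart_chartAt x) he g.inner (mem_chart_source E2 x) hx]
  refine cquad_congr (det_jac_chart_ne he hx) _ fun j ↦ ?_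
  rw [frame_trans (isChart_chartAt x) he (mem_chart_source E2 x) hx]
  simp only [map_add, map_smul, smul_eq_mul, Fin.sum_univ_two]
  ring

lemma inner_eq_mquad (X : VF M) :
    g.inner x (X x) (X x) = mquad (repAt g.inner e x) (vrepAt X e x) :=
  apply_eq_repAt he g.inner hx (X x) (X x)

end

/-! ### Continuity and smoothness through charts -/

/-- A function is smooth if it is so in all charts. -/
def FSmooth (f : M → ℝ) : Prop :=
  ∀ e : OpenPartialHomeomorph M E2, IsChart e → ContDiffOn ℝ ∞ (fun y ↦ f (e.symm y)) e.target

lemma FSmooth.continuous {f : M → ℝ} (hf : FSmooth f) : Continuous f := by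
  refine continuous_iff_continuousAt.2 fun x ↦ ?_
  set c := chartAt E2 x with hc
  have hx : x ∈ c.source := mem_chart_source E2 x
  have h1 := ((hf c (isChart_chartAt x)).contDiffAt
    (c.open_target.mem_nhds (c.map_source hx))).continuousAt
  have h2 : ContinuousAt (fun z ↦ f (c.symm (c z))) x :=
    ContinuousAt.comp (f := c) (g := fun y ↦ f (c.symm y)) h1 (c.continuousAt hx)
  refine h2.congr ?_
  filter_upwards [c.open_source.mem_nhds hx] with z hz
  rw [c.left_inv hz]

lemma fSmooth_of_contMDiff {f : M → ℝ} (hf : ContMDiff 𝓘(ℝ, E2) 𝓘(ℝ, ℝ) ∞ f) : FSmooth f := by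
  intro e he
  have h1 : ContMDiffOn 𝓘(ℝ, E2) 𝓘(ℝ, E2) ∞ e.symm e.target :=
    contMDiffOn_symm_of_mem_maximalAtlas he
  exact (hf.comp_contMDiffOn h1).contDiffOn

variable (g : Metric M)

lemma fSmooth_tinner {h k : Tens M} (hh : TSmooth h) (hk : TSmooth k) : FSmooth (tinner g h k) := by
  intro e he
  refine ((Metric.isMetricOn he g).contDiffOn_minner (hh e he) (hk e he)).congr fun y hy ↦ ?_
  rw [tinner_apply g he (e.map_target hy)]
  rfl

lemma fSmooth_dvM {X : VF M} (hX : VSmooth X) : FSmooth (dvM g X) := by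
  intro e he
  refine ((Metric.isMetricOn he g).contDiffOn_dv (hX e he)).congr fun y hy ↦ ?_
  rw [dvM_apply g hX he (e.map_target hy), e.right_inv hy]

lemma fSmooth_inner {X : VF M} (hX : VSmooth X) : FSmooth fun x ↦ g.inner x (X x) (X x) := by
  intro e he
  refine ((Metric.isMetricOn he g).contDiffOn_mquad (hX e he)).congr fun y hy ↦ ?_
  exact inner_eq_mquad g he (e.map_target hy) X

/-! ### The pointwise identities on the surface -/

lemma lie_congr_of_eqOn {γ : E2 → Mat} {ξ ξ' : E2 → E2} {U : Set E2} (hU : IsOpen U) {y : E2}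
    (hy : y ∈ U) (h : ∀ z ∈ U, ξ z = ξ' z) : lie γ ξ y = lie γ ξ' y := by
  have h1 : ∀ k l, pd k (fun z ↦ ξ z l) y = pd k (fun z ↦ ξ' z l) y := fun k l ↦
    pd_congr_of_isOpen hU hy fun z hz ↦ by rw [h z hz]
  simp only [lie, h1, h y hy]

lemma dv_congr_of_eqOn {γ : E2 → Mat} {ξ ξ' : E2 → E2} {U : Set E2} (hU : IsOpen U) {y : E2}
    (hy : y ∈ U) (h : ∀ z ∈ U, ξ z = ξ' z) : dv γ ξ y = dv γ ξ' y := by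
  rw [dv, dv, lie_congr_of_eqOn hU hy h]

lemma lieTF_congr_of_eqOn {γ : E2 → Mat} {ξ ξ' : E2 → E2} {U : Set E2} (hU : IsOpen U) {y : E2}
    (hy : y ∈ U) (h : ∀ z ∈ U, ξ z = ξ' z) : lieTF γ ξ y = lieTF γ ξ' y := by
  rw [lieTF, lieTF, lie_congr_of_eqOn hU hy h, dv_congr_of_eqOn hU hy h]

/-- Pointwise symmetric and trace-free two-tensors. -/
structure STF (h : Tens M) : Prop where
  symm : ∀ x v w, h x v w = h x w v
  mtr : ∀ x, mtr (repAt g.inner (chartAt E2 x) x) (repAt h (chartAt E2 x) x) = 0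

variable {g}

lemma IsSymmTraceFree.stf {h : Tensor2 M} (hh : IsSymmTraceFree g h) : STF g fun x ↦ h x :=
  ⟨hh.symm, fun x ↦ by rw [← trace_eq, hh.trace_eq_zero]⟩

lemma STF.isSymmTraceFree {h : Tensor2 M} (hh : STF g fun x ↦ h x) : IsSymmTraceFree g h :=
  ⟨hh.symm, fun x ↦ by rw [trace_eq]; exact hh.mtr x⟩

lemma STF.repAt_symm {h : Tens M} (hh : STF g h) (e : OpenPartialHomeomorph M E2) (x : M) :
    repAt h e x 1 0 = repAt h e x 0 1 := hh.symm _ _ _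

lemma STF.mtr_apply {h : Tens M} (hh : STF g h) {e : OpenPartialHomeomorph M E2} (he : IsChart e)
    {x : M} (hx : x ∈ e.source) : TTSurface.mtr (repAt g.inner e x) (repAt h e x) = 0 := by
  rw [← mtr_repAt g he hx, hh.mtr]

lemma stf_lieT {X : VF M} (hX : VSmooth X) : STF g (lieT g X) := by
  have h : ∀ x, repAt (lieT g X) (chartAt E2 x) x
      = lieTF (rep g.inner (chartAt E2 x)) (vrep X (chartAt E2 x)) (chartAt E2 x x) := fun x ↦ by
    rw [← rep_apply_chart _ (mem_chart_source E2 x)]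
    exact rep_tensOf (natural_lieTF g hX) (isChart_chartAt x) (mem_chart_target E2 x)
  refine ⟨fun x v w ↦ ?_, fun x ↦ ?_⟩
  · have hs := (Metric.isMetricOn (isChart_chartAt x) g).lieTF_symm (mem_chart_target E2 x)
      (vrep X (chartAt E2 x))
    rw [apply_eq_repAt (isChart_chartAt x) _ (mem_chart_source E2 x),
      apply_eq_repAt (isChart_chartAt x) _ (mem_chart_source E2 x), h]
    simp only [Fin.sum_univ_two, hs]
    ring
  · rw [h, ← rep_apply_chart _ (mem_chart_source E2 x)]
    exact (Metric.isMetricOn (isChart_chartAt x) g).mtr_lieTF (mem_chart_target E2 x) _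

lemma rep_lieT {X : VF M} (hX : VSmooth X) {e : OpenPartialHomeomorph M E2} (he : IsChart e)
    {y : E2} (hy : y ∈ e.target) : rep (lieT g X) e y = lieTF (rep g.inner e) (vrep X e) y :=
  rep_tensOf (natural_lieTF g hX) he hy

/-- The coordinate identity `minner_lieTF_eq_ldiv_add_dv`, read in the preferred chart at `x`; all
terms are now globally defined. -/
theorem tinner_lieT {h : Tensor2 M} (hh : STF g fun x ↦ h x) {X : VF M} (hX : VSmooth X) (x : M) :
    tinner g (fun x ↦ h x) (lieT g X) x
      = 2 * divergence g h x (X x) + 2 * dvM g (sharpM g (fun x ↦ h x) X) x := by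
  set c := chartAt E2 x with hcdef
  have hc : IsChart c := isChart_chartAt x
  have hx : x ∈ c.source := mem_chart_source E2 x
  have hy : c x ∈ c.target := c.map_source hx
  have hγ := Metric.isMetricOn hc g
  have h1 := hγ.minner_lieTF_eq_ldiv_add_dv hy (ξ := vrep X c) (h := rep (fun x ↦ h x) c)
    (fun i ↦ ContDiffOn.differentiableAt_of_isOpen c.open_target (hX c hc i) hy)
    (fun i j ↦ ContDiffOn.differentiableAt_of_isOpen c.open_target (h.tSmooth c hc i j) hy)
    (fun z _ ↦ hh.repAt_symm c _)
    (by rw [rep_apply_chart _ hx, rep_apply_chart _ hx]; exact hh.mtr x)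
  rw [tinner, ← hcdef, ← rep_apply_chart _ hx, ← rep_apply_chart _ hx, ← rep_apply_chart _ hx,
    rep_lieT hX hc hy, h1, divergence_apply, dvM, ← hcdef]
  congr 2
  · simp only [vrep_apply_chart _ hx, vrepAt]
  · exact dv_congr_of_eqOn c.open_target hy fun z hz ↦ (vrep_vfOf (natural_sharp g _ X) hc hz).symm

end TTSurface

namespace TTSurface

open MeasureTheory

variable {M : Type*} [TopologicalSpace M] [ChartedSpace E2 M] [IsManifold 𝓘(ℝ, E2) ∞ M]

/-! ### The area measure in charts -/

lemma det_fderiv_eq {Ψ : E2 → E2} {y : E2} (hΨ : DifferentiableAt ℝ Ψ y) :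
    (fderiv ℝ Ψ y).det = (jac Ψ y).det := by
  rw [ContinuousLinearMap.det, ← LinearMap.det_toMatrix (EuclideanSpace.basisFun (Fin 2) ℝ).toBasis]
  congr 1
  ext i j
  rw [LinearMap.toMatrix_apply, jac_apply hΨ]
  simp [stdVec]

/-- The area density of `g` in the chart `e`. -/
def dens (g : Metric M) (e : OpenPartialHomeomorph M E2) (y : E2) : ℝ := √(rep g.inner e y).det

section

variable (g : Metric M) {e e' : OpenPartialHomeomorph M E2} (he : IsChart e) (he' : IsChart e')
include he

lemma dens_pos {y : E2} (hy : y ∈ e.target) : 0 < dens g e y :=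
  Real.sqrt_pos.2 ((Metric.isMetricOn he g).det_pos' hy)

lemma contDiffOn_dens : ContDiffOn ℝ ∞ (dens g e) e.target :=
  (Metric.isMetricOn he g).contDiffOn_det.sqrt fun _ hy ↦
    ((Metric.isMetricOn he g).det_pos' hy).ne'

include he' in
-- Since √det(JᵀγJ) = |det J| √det γ, densities carry exactly the Jacobian factor of the change of
-- variables formula.
lemma dens_trans {y : E2} (hy : y ∈ transSource e e') :
    dens g e y = |(fderiv ℝ (transMap e e') y).det| * dens g e' (transMap e e' y) := by
  rw [det_fderiv_eq (differentiableAt_transMap he he' hy), dens, dens,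
    rep_trans he he' g.inner hy, Matrix.det_mul, Matrix.det_mul, Matrix.det_transpose,
    ← Real.sqrt_sq_eq_abs, ← Real.sqrt_mul (sq_nonneg _)]
  congr 1
  ring

end

lemma transMap_image (e e' : OpenPartialHomeomorph M E2) :
    transMap e e' '' transSource e e' = transSource e' e := by
  ext z
  constructor
  · rintro ⟨y, ⟨hy, hy'⟩, rfl⟩
    refine ⟨e'.map_source hy', ?_⟩
    change e'.symm (e' (e.symm y)) ∈ e.source
    rw [e'.left_inv hy']
    exact e.map_target hy
  · rintro ⟨hz, hz'⟩
    refine ⟨e (e'.symm z), ⟨e.map_source hz', ?_⟩, ?_⟩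
    · change e.symm (e (e'.symm z)) ∈ e'.source
      rw [e.left_inv hz']
      exact e'.map_target hz
    · change e' (e.symm (e (e'.symm z))) = z
      rw [e.left_inv hz', e'.right_inv hz]

lemma transMap_injOn (e e' : OpenPartialHomeomorph M E2) :
    Set.InjOn (transMap e e') (transSource e e') := by
  intro y hy z hz h
  exact e.symm.injOn hy.1 hz.1 (e'.injOn hy.2 hz.2 h)

lemma symm_transMap {e e' : OpenPartialHomeomorph M E2} {y : E2} (hy : y ∈ transSource e e') :
    e'.symm (transMap e e' y) = e.symm y := e'.left_inv hy.2

variable [T2Space M] [CompactSpace M]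

lemma chartPartition_tsupport (c : M) :
    tsupport (chartPartition M c) ⊆ (chartAt E2 c).source :=
  (SmoothPartitionOfUnity.exists_isSubordinate_chartAt_source 𝓘(ℝ, E2) M).choose_spec c

variable (M) in
lemma chartPartition_finite : {c : M | (Function.support (chartPartition M c)).Nonempty}.Finite :=
  (chartPartition M).locallyFinite.finite_nonempty_of_compact

/-- The finite set of indices of the partition of unity with non-vanishing functions. -/
def partIndex (M : Type*) [TopologicalSpace M] [ChartedSpace E2 M] [IsManifold 𝓘(ℝ, E2) ∞ M]
    [T2Space M] [CompactSpace M] : Finset M := (chartPartition_finite M).toFinset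

lemma chartPartition_eq_zero {c : M} (hc : c ∉ partIndex M) (x : M) : chartPartition M c x = 0 := by
  by_contra h
  exact hc ((chartPartition_finite M).mem_toFinset.2 ⟨x, h⟩)

lemma sum_chartPartition (x : M) : ∑ c ∈ partIndex M, chartPartition M c x = 1 := by
  rw [← (chartPartition M).sum_eq_one (Set.mem_univ x), finsum_eq_sum_of_support_subset]
  intro c hc
  by_contra h
  exact hc (chartPartition_eq_zero h x)

variable [MeasurableSpace M] [BorelSpace M]

lemma aemeasurable_symm (e : OpenPartialHomeomorph M E2) :
    AEMeasurable e.symm ((volume : Measure E2).restrict e.target) :=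
  e.continuousOn_symm.aemeasurable e.open_target.measurableSet

variable (g : Metric M)

/-- By compactness only finitely many functions of the partition are nonzero, so the sum over all
points of `M` collapses to a finite one. -/
lemma lintegral_areaMeasure {f : M → ENNReal} (hf : Measurable f) :
    ∫⁻ x, f x ∂areaMeasure g = ∑ c ∈ partIndex M, ∫⁻ y in (chartAt E2 c).target,
      f ((chartAt E2 c).symm y) * ENNReal.ofReal (chartPartition M c ((chartAt E2 c).symm y)
        * dens g (chartAt E2 c) y) := by
  have hterm : ∀ c : M, ∫⁻ x, f x ∂(((volume.restrict (chartAt E2 c).target).withDensity fun y ↦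
      ENNReal.ofReal (chartPartition M c ((chartAt E2 c).symm y) *
        Real.sqrt (components g.inner c ((chartAt E2 c).symm y)).det)).map (chartAt E2 c).symm)
      = ∫⁻ y in (chartAt E2 c).target,
      f ((chartAt E2 c).symm y) * ENNReal.ofReal (chartPartition M c ((chartAt E2 c).symm y)
        * dens g (chartAt E2 c) y) := by
    intro c
    have hm := (chartAt E2 c).open_target.measurableSet
    have hs : AEMeasurable (chartAt E2 c).symm (volume.restrict (chartAt E2 c).target) :=
      aemeasurable_symm _
    have hd : (fun y ↦ ENNReal.ofReal (chartPartition M c ((chartAt E2 c).symm y) *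
        Real.sqrt (components g.inner c ((chartAt E2 c).symm y)).det))
        =ᵐ[volume.restrict (chartAt E2 c).target] fun y ↦ ENNReal.ofReal
          (chartPartition M c ((chartAt E2 c).symm y) * dens g (chartAt E2 c) y) := by
      filter_upwards [ae_restrict_mem hm] with y hy
      rw [components_eq_rep _ _ hy, dens]
    have hfs : AEMeasurable (fun y ↦ f ((chartAt E2 c).symm y))
        (volume.restrict (chartAt E2 c).target) := hf.comp_aemeasurable hs
    rw [withDensity_congr_ae hd, lintegral_map' hf.aemeasurable
      (hs.mono_ac (withDensity_absolutelyContinuous _ _)),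
      lintegral_withDensity_eq_lintegral_mul₀ _ hfs]
    · exact lintegral_congr fun y ↦ by rw [Pi.mul_apply, mul_comm]
    · refine (ContinuousOn.aemeasurable ?_ hm).ennreal_ofReal
      exact ((chartPartition M c).contMDiff.continuous.comp_continuousOn
        (chartAt E2 c).continuousOn_symm).mul
          (contDiffOn_dens g (isChart_chartAt c)).continuousOn
  rw [areaMeasure, lintegral_sum_measure, tsum_eq_sum (s := partIndex M)]
  · exact Finset.sum_congr rfl fun c _ ↦ hterm c
  · intro c hc
    rw [hterm]
    simp [chartPartition_eq_zero hc]

/-- Each piece of the partition is moved to the chart `e` by its transition map, and there the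
partition functions sum to one. In particular the measure is the Riemannian one in every chart,
whatever partition was chosen. -/
theorem setLIntegral_areaMeasure {e : OpenPartialHomeomorph M E2} (he : IsChart e)
    {f : M → ENNReal} (hf : Measurable f) :
    ∫⁻ x in e.source, f x ∂areaMeasure g
      = ∫⁻ y in e.target, f (e.symm y) * ENNReal.ofReal (dens g e y) := by
  rw [← lintegral_indicator e.open_source.measurableSet,
    lintegral_areaMeasure g (hf.indicator e.open_source.measurableSet)]
  have hm := e.open_target.measurableSet
  have hterm : ∀ c : M, ∫⁻ y in (chartAt E2 c).target,
      e.source.indicator f ((chartAt E2 c).symm y) *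
        ENNReal.ofReal (chartPartition M c ((chartAt E2 c).symm y) * dens g (chartAt E2 c) y)
      = ∫⁻ y in e.target, f (e.symm y) *
        ENNReal.ofReal (chartPartition M c (e.symm y) * dens g e y) := by
    intro c
    set d := chartAt E2 c with hdd
    have hd : IsChart d := isChart_chartAt c
    have h1 : ∫⁻ y in d.target, e.source.indicator f (d.symm y) *
        ENNReal.ofReal (chartPartition M c (d.symm y) * dens g d y)
        = ∫⁻ y in transSource d e, f (d.symm y) *
          ENNReal.ofReal (chartPartition M c (d.symm y) * dens g d y) := by
      rw [← lintegral_indicator d.open_target.measurableSet,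
        ← lintegral_indicator (isOpen_transSource d e).measurableSet]
      refine lintegral_congr fun y ↦ ?_
      by_cases hy : y ∈ d.target
      · by_cases hy' : d.symm y ∈ e.source
        · rw [Set.indicator_of_mem hy, Set.indicator_of_mem (show y ∈ transSource d e from ⟨hy, hy'⟩),
            Set.indicator_of_mem hy']
        · rw [Set.indicator_of_mem hy, Set.indicator_of_notMem hy', zero_mul,
            Set.indicator_of_notMem fun h : y ∈ transSource d e ↦ hy' h.2]
      · rw [Set.indicator_of_notMem hy, Set.indicator_of_notMem fun h ↦ hy h.1]
    have h2 : ∫⁻ y in e.target, f (e.symm y) *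
          ENNReal.ofReal (chartPartition M c (e.symm y) * dens g e y)
        = ∫⁻ y in transSource e d, f (e.symm y) *
          ENNReal.ofReal (chartPartition M c (e.symm y) * dens g e y) := by
      rw [← lintegral_indicator hm, ← lintegral_indicator (isOpen_transSource e d).measurableSet]
      refine lintegral_congr fun y ↦ ?_
      by_cases hy : y ∈ e.target
      · by_cases hy' : e.symm y ∈ d.source
        · rw [Set.indicator_of_mem hy, Set.indicator_of_mem (show y ∈ transSource e d from ⟨hy, hy'⟩)]
        · rw [Set.indicator_of_mem hy, Set.indicator_of_notMem fun h ↦ hy' h.2]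
          have : chartPartition M c (e.symm y) = 0 := by
            by_contra h0
            exact hy' (chartPartition_tsupport c (subset_tsupport _ h0))
          simp [this]
      · rw [Set.indicator_of_notMem hy, Set.indicator_of_notMem fun h ↦ hy h.1]
    -- Both integrals now live on the overlap of the two charts, where the transition map is an
    -- injective change of variables.
    rw [h1, h2, ← transMap_image e d, lintegral_image_eq_lintegral_abs_det_fderiv_mul _
      (isOpen_transSource e d).measurableSet
      (fun y hy ↦ (differentiableAt_transMap he hd hy).hasFDerivAt.hasFDerivWithinAt)
      (transMap_injOn e d)]
    refine setLIntegral_congr_fun (isOpen_transSource e d).measurableSet fun y hy ↦ ?_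
    rw [symm_transMap hy, dens_trans g he hd hy, mul_left_comm (chartPartition M c _),
      ENNReal.ofReal_mul (abs_nonneg _)]
    ring
  simp only [hterm]
  rw [← lintegral_finsetSum']
  · refine setLIntegral_congr_fun hm fun y hy ↦ ?_
    rw [← Finset.mul_sum, ← ENNReal.ofReal_sum_of_nonneg, ← Finset.sum_mul, sum_chartPartition,
      one_mul]
    exact fun c _ ↦ mul_nonneg ((chartPartition M).nonneg c _) (dens_pos g he hy).le
  · intro c _
    refine (hf.comp_aemeasurable (aemeasurable_symm e)).mul (ContinuousOn.aemeasurable ?_ hm).ennreal_ofReal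
    exact ((chartPartition M c).contMDiff.continuous.comp_continuousOn
        e.continuousOn_symm).mul (contDiffOn_dens g he).continuousOn

/-- The area measure in the chart `e`. -/
def chartMeasure (e : OpenPartialHomeomorph M E2) : Measure E2 :=
  (volume.restrict e.target).withDensity fun y ↦ ENNReal.ofReal (dens g e y)

section

variable {e : OpenPartialHomeomorph M E2} (he : IsChart e)
include he

lemma aemeasurable_dens : AEMeasurable (fun y ↦ ENNReal.ofReal (dens g e y))
    (volume.restrict e.target) :=
  ((contDiffOn_dens g he).continuousOn.aemeasurable e.open_target.measurableSet).ennreal_ofReal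

lemma restrict_areaMeasure :
    (areaMeasure g).restrict e.source = (chartMeasure g e).map e.symm := by
  have hs : AEMeasurable e.symm (chartMeasure g e) :=
    (aemeasurable_symm e).mono_ac (withDensity_absolutelyContinuous _ _)
  refine Measure.ext_of_lintegral _ fun f hf ↦ ?_
  have hfs : AEMeasurable (fun y ↦ f (e.symm y)) (volume.restrict e.target) :=
    hf.comp_aemeasurable (aemeasurable_symm e)
  rw [setLIntegral_areaMeasure g he hf, lintegral_map' hf.aemeasurable hs, chartMeasure,
    lintegral_withDensity_eq_lintegral_mul₀ (aemeasurable_dens g he) hfs]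
  exact lintegral_congr fun y ↦ by rw [Pi.mul_apply, mul_comm]

theorem setIntegral_areaMeasure {f : M → ℝ} (hf : AEStronglyMeasurable f (areaMeasure g)) :
    ∫ x in e.source, f x ∂areaMeasure g = ∫ y in e.target, dens g e y * f (e.symm y) := by
  have hs : AEMeasurable e.symm (chartMeasure g e) :=
    (aemeasurable_symm e).mono_ac (withDensity_absolutelyContinuous _ _)
  have hf' : AEStronglyMeasurable f ((areaMeasure g).restrict e.source) := hf.restrict
  rw [restrict_areaMeasure g he] at hf' ⊢
  rw [integral_map hs hf', chartMeasure]
  have := integral_withDensity_eq_integral_toReal_smul₀ (aemeasurable_dens g he)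
    (Filter.Eventually.of_forall fun _ ↦ ENNReal.ofReal_lt_top) (fun y ↦ f (e.symm y))
  rw [this]
  refine integral_congr_ae ?_
  filter_upwards [ae_restrict_mem e.open_target.measurableSet] with y hy
  rw [ENNReal.toReal_ofReal (dens_pos g he hy).le, smul_eq_mul]

lemma areaMeasure_inter {s : Set M} (hs : MeasurableSet s) :
    areaMeasure g (s ∩ e.source)
      = ∫⁻ y in e.target ∩ e.symm ⁻¹' s, ENNReal.ofReal (dens g e y) := by
  have h1 := setLIntegral_areaMeasure g he (f := s.indicator 1) (measurable_one.indicator hs)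
  have hms : MeasurableSet (e.target ∩ e.symm ⁻¹' s) := by
    have h2 : Measurable (e.target.domRestrict e.symm) :=
      (continuousOn_iff_continuous_domRestrict.1 e.continuousOn_symm).measurable
    have := e.open_target.measurableSet.subtype_image (h2 hs)
    rwa [Set.domRestrict_eq, Set.preimage_comp, Subtype.image_preimage_coe] at this
  rw [lintegral_indicator_one hs, Measure.restrict_apply hs] at h1
  rw [h1, ← lintegral_indicator e.open_target.measurableSet, ← lintegral_indicator hms]
  refine lintegral_congr fun y ↦ ?_
  by_cases hy : y ∈ e.target
  · by_cases hy' : e.symm y ∈ s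
    · rw [Set.indicator_of_mem hy, Set.indicator_of_mem hy', Set.indicator_of_mem (by exact ⟨hy, hy'⟩)]
      simp
    · rw [Set.indicator_of_mem hy, Set.indicator_of_notMem hy',
        Set.indicator_of_notMem fun h ↦ hy' h.2, zero_mul]
  · rw [Set.indicator_of_notMem hy, Set.indicator_of_notMem fun h ↦ hy h.1]

end

/-- On a compact space local finiteness is enough, and the density is bounded on small closed
coordinate balls. -/
instance instIsFiniteMeasureArea : IsFiniteMeasure (areaMeasure g) := by
  have hl : IsLocallyFiniteMeasure (areaMeasure g) := by
    refine ⟨fun x ↦ ?_⟩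
    set e := chartAt E2 x with hed
    have he : IsChart e := isChart_chartAt x
    have hx : x ∈ e.source := mem_chart_source E2 x
    obtain ⟨r, hr, hball⟩ := Metric.nhds_basis_closedBall.mem_iff.1
      (e.open_target.mem_nhds (e.map_source hx))
    have hs : e.source ∩ e ⁻¹' Metric.ball (e x) r ∈ nhds x :=
      (e.isOpen_inter_preimage Metric.isOpen_ball).mem_nhds ⟨hx, Metric.mem_ball_self hr⟩
    refine ⟨_, hs, ?_⟩
    have hopen := e.isOpen_inter_preimage (Metric.isOpen_ball (x := e x) (ε := r))
    rw [← Set.inter_eq_left.2 (Set.inter_subset_left (s := e.source)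
      (t := e ⁻¹' Metric.ball (e x) r)), areaMeasure_inter g he hopen.measurableSet]
    refine lt_of_le_of_lt (lintegral_mono_set (t := Metric.closedBall (e x) r) ?_) ?_
    · rintro y ⟨hy, -, hy'⟩
      rw [Set.mem_preimage, e.right_inv hy] at hy'
      exact Metric.ball_subset_closedBall hy'
    · have := ((contDiffOn_dens g he).continuousOn.mono hball).integrableOn_compact
        (isCompact_closedBall (e x) r) (μ := volume)
      exact lt_of_le_of_lt (lintegral_mono fun y ↦ Real.ofReal_le_enorm _) this.2
  exact CompactSpace.isFiniteMeasure

/-- The density is positive. This is what turns almost-everywhere vanishing of a continuous function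
into vanishing, hence gives definiteness of the L² product and the pointwise equation δh = 0. -/
instance instIsOpenPosMeasureArea : Measure.IsOpenPosMeasure (areaMeasure g) := by
  refine ⟨fun U hU ⟨x, hxU⟩ h0 ↦ ?_⟩
  set e := chartAt E2 x with hed
  have he : IsChart e := isChart_chartAt x
  have hx : x ∈ e.source := mem_chart_source E2 x
  have h1 : areaMeasure g (U ∩ e.source) = 0 := measure_mono_null Set.inter_subset_left h0
  rw [areaMeasure_inter g he hU.measurableSet] at h1
  have hopen : IsOpen (e.target ∩ e.symm ⁻¹' U) := e.symm.isOpen_inter_preimage hU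
  have hne : (e.target ∩ e.symm ⁻¹' U).Nonempty :=
    ⟨e x, e.map_source hx, by rw [Set.mem_preimage, e.left_inv hx]; exact hxU⟩
  have hpos := hopen.measure_pos (volume : Measure E2) hne
  rw [lintegral_eq_zero_iff' ((aemeasurable_dens g he).mono_set Set.inter_subset_left)] at h1
  have h2 : ∀ᵐ y ∂(volume.restrict (e.target ∩ e.symm ⁻¹' U)), False := by
    filter_upwards [h1, ae_restrict_mem hopen.measurableSet] with y hy hy'
    simp only [Pi.zero_apply, ENNReal.ofReal_eq_zero] at hy
    exact absurd (dens_pos g he hy'.1) (not_lt.2 hy)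
  rw [Filter.eventually_false_iff_eq_bot, ae_eq_bot, Measure.restrict_eq_zero] at h2
  exact hpos.ne' h2

lemma integrable_of_continuous {f : M → ℝ} (hf : Continuous f) : Integrable f (areaMeasure g) :=
  hf.integrable_of_hasCompactSupport (HasCompactSupport.of_compactSpace f)

end TTSurface

namespace TTSurface

open MeasureTheory

/-! ### Linearity in the vector field and conformal changes, in coordinates -/

section E2

variable {γ : E2 → Mat} {ξ ξ' : E2 → E2} {y : E2}

lemma lie_add (hξ : ∀ i, DifferentiableAt ℝ (fun z ↦ ξ z i) y)
    (hξ' : ∀ i, DifferentiableAt ℝ (fun z ↦ ξ' z i) y) :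
    lie γ (fun z ↦ ξ z + ξ' z) y = lie γ ξ y + lie γ ξ' y := by
  ext i j
  simp only [lie, Matrix.of_apply, Matrix.add_apply, PiLp.add_apply, pd_add (hξ _) (hξ' _),
    Fin.sum_univ_two]
  ring

lemma lie_smul (c : ℝ) (hξ : ∀ i, DifferentiableAt ℝ (fun z ↦ ξ z i) y) :
    lie γ (fun z ↦ c • ξ z) y = c • lie γ ξ y := by
  ext i j
  simp only [lie, Matrix.of_apply, Matrix.smul_apply, PiLp.smul_apply, smul_eq_mul,
    pd_const_mul c (hξ _), Fin.sum_univ_two]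
  ring

lemma mtr_add (γ h k : Mat) : mtr γ (h + k) = mtr γ h + mtr γ k := by
  simp only [mtr, Matrix.add_apply, Fin.sum_univ_two]; ring

lemma mtr_smul (γ : Mat) (c : ℝ) (h : Mat) : mtr γ (c • h) = c * mtr γ h := by
  simp only [mtr, Matrix.smul_apply, smul_eq_mul, Fin.sum_univ_two]; ring

lemma dv_add (hξ : ∀ i, DifferentiableAt ℝ (fun z ↦ ξ z i) y)
    (hξ' : ∀ i, DifferentiableAt ℝ (fun z ↦ ξ' z i) y) :
    dv γ (fun z ↦ ξ z + ξ' z) y = dv γ ξ y + dv γ ξ' y := by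
  rw [dv, dv, dv, lie_add hξ hξ', mtr_add]; ring

lemma dv_smul (c : ℝ) (hξ : ∀ i, DifferentiableAt ℝ (fun z ↦ ξ z i) y) :
    dv γ (fun z ↦ c • ξ z) y = c * dv γ ξ y := by
  rw [dv, dv, lie_smul c hξ, mtr_smul]; ring

lemma lieTF_add (hξ : ∀ i, DifferentiableAt ℝ (fun z ↦ ξ z i) y)
    (hξ' : ∀ i, DifferentiableAt ℝ (fun z ↦ ξ' z i) y) :
    lieTF γ (fun z ↦ ξ z + ξ' z) y = lieTF γ ξ y + lieTF γ ξ' y := by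
  rw [lieTF, lieTF, lieTF, lie_add hξ hξ', dv_add hξ hξ', add_smul]; abel

lemma lieTF_smul (c : ℝ) (hξ : ∀ i, DifferentiableAt ℝ (fun z ↦ ξ z i) y) :
    lieTF γ (fun z ↦ c • ξ z) y = c • lieTF γ ξ y := by
  rw [lieTF, lieTF, lie_smul c hξ, dv_smul c hξ, mul_smul, smul_sub]

lemma dv_zero_of_eventually (h : ∀ᶠ z in nhds y, ξ z = 0) : dv γ ξ y = 0 := by
  have h1 : ∀ k l, pd k (fun z ↦ ξ z l) y = 0 := fun k l ↦ by
    have : (fun z ↦ ξ z l) =ᶠ[nhds y] fun _ ↦ (0 : ℝ) := by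
      filter_upwards [h] with z hz; simp [hz]
    rw [pd_congr this]; exact pd_const _
  have h2 : lie γ ξ y = 0 := by
    ext i j
    simp [lie, h1, h.self_of_nhds]
  simp [dv, h2, mtr]

lemma inv_smul_mat {c : ℝ} (hc : c ≠ 0) {γ : Mat} (hd : γ.det ≠ 0) : (c • γ)⁻¹ = c⁻¹ • γ⁻¹ := by
  apply Matrix.inv_eq_left_inv
  rw [Matrix.smul_mul, Matrix.mul_smul, inv_mul_of_det_ne hd, smul_smul, inv_mul_cancel₀ hc,
    one_smul]

/-- The two inverse metrics contribute c⁻², which the two tensors scaled by c compensate. -/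
lemma minner_smul_metric {c : ℝ} (hc : c ≠ 0) {γ : Mat} (hd : γ.det ≠ 0) (h : Mat) :
    minner (c • γ) (c • h) (c • h) = minner γ h h := by
  simp only [minner, inv_smul_mat hc hd, Matrix.smul_apply, smul_eq_mul, Fin.sum_univ_two]
  field_simp

/-- L_ξ(cγ) = c L_ξ γ + (ξc) γ, and the second summand is pure trace. -/
lemma lieTF_conformal {c : E2 → ℝ} (hc : DifferentiableAt ℝ c y) (hc0 : c y ≠ 0)
    (hγ : ∀ i j, DifferentiableAt ℝ (fun z ↦ γ z i j) y) (hd : (γ y).det ≠ 0)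
    (hs : γ y 1 0 = γ y 0 1) :
    lieTF (fun z ↦ c z • γ z) ξ y = c y • lieTF γ ξ y := by
  set d : ℝ := ξ y 0 * pd 0 c y + ξ y 1 * pd 1 c y with hdd
  have h1 : lie (fun z ↦ c z • γ z) ξ y = c y • lie γ ξ y + d • γ y := by
    ext i j
    simp only [lie, Matrix.of_apply, Matrix.add_apply, Matrix.smul_apply, smul_eq_mul,
      pd_mul hc (hγ _ _), Fin.sum_univ_two, hdd]
    ring
  have htr : mtr (γ y) (γ y) = 2 := by
    rw [mtr_eq_trace]
    have : (γ y)⁻¹.transpose = (γ y)⁻¹ := by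
      obtain ⟨-, h01, h10, -⟩ := inv_apply_fin_two (γ y)
      ext i j
      fin_cases i <;> fin_cases j <;> simp [h01, h10, hs]
    rw [this, inv_mul_of_det_ne hd]
    simp
  have h2 : ∀ h : Mat, mtr (c y • γ y) h = (c y)⁻¹ * mtr (γ y) h := fun h ↦ by
    simp only [mtr, inv_smul_mat hc0 hd, Matrix.smul_apply, smul_eq_mul, Fin.sum_univ_two]; ring
  have h3 : dv (fun z ↦ c z • γ z) ξ y = dv γ ξ y + (c y)⁻¹ * d := by
    rw [dv, h2, h1, mtr_add, mtr_smul, mtr_smul, htr, dv]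
    field_simp
  rw [lieTF, h1, h3, lieTF]
  ext i j
  simp only [Matrix.sub_apply, Matrix.add_apply, Matrix.smul_apply, smul_eq_mul]
  field_simp
  ring

lemma minner_add_left (γ h h' k : Mat) : minner γ (h + h') k = minner γ h k + minner γ h' k := by
  simp only [minner, Matrix.add_apply, Fin.sum_univ_two]; ring

lemma minner_smul_left (γ : Mat) (c : ℝ) (h k : Mat) : minner γ (c • h) k = c * minner γ h k := by
  simp only [minner, Matrix.smul_apply, smul_eq_mul, Fin.sum_univ_two]; ring

lemma minner_comm {γ : Mat} (hs : γ⁻¹ 1 0 = γ⁻¹ 0 1) (h k : Mat) : minner γ h k = minner γ k h := by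
  simp only [minner, Fin.sum_univ_two, hs]; ring

lemma integral_pd_eq_zero {f : E2 → ℝ} (hf : ContDiff ℝ ∞ f) (hc : HasCompactSupport f)
    (k : Fin 2) : ∫ y, pd k f y = 0 := by
  have hd : Continuous (pd k f) := (hf.continuous_fderiv (by simp)).clm_apply continuous_const
  have hdc : HasCompactSupport (pd k f) := hc.fderiv_apply (𝕜 := ℝ) _
  have := integral_mul_fderiv_eq_neg_fderiv_mul_of_integrable (𝕜 := ℝ) (μ := volume)
    (f := fun _ : E2 ↦ (1 : ℝ)) (g := f) (v := stdVec k) (by simp)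
    (by simp only [one_mul]; exact hd.integrable_of_hasCompactSupport hdc)
    (by simpa using hf.continuous.integrable_of_hasCompactSupport hc)
    (fun _ _ ↦ differentiableAt_const _) (fun _ _ ↦ hf.differentiable (by simp) _)
  simpa [pd] using this

end E2

variable {M : Type*} [TopologicalSpace M] [ChartedSpace E2 M] [IsManifold 𝓘(ℝ, E2) ∞ M]

/-! ### Linear operations on smooth vector fields and tensors -/

lemma vrep_add (X Y : VF M) (e : OpenPartialHomeomorph M E2) :
    vrep (X + Y) e = fun y ↦ vrep X e y + vrep Y e y := by
  ext1 y; simp only [vrep, vrepAt, Pi.add_apply, map_add]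

lemma vrep_smul (c : ℝ) (X : VF M) (e : OpenPartialHomeomorph M E2) :
    vrep (c • X) e = fun y ↦ c • vrep X e y := by
  ext1 y; simp only [vrep, vrepAt, Pi.smul_apply, map_smul]

lemma vrep_zero (e : OpenPartialHomeomorph M E2) : vrep (0 : VF M) e = 0 := by
  ext1 y; simp only [vrep, vrepAt, Pi.zero_apply, map_zero]

lemma VSmooth.add {X Y : VF M} (hX : VSmooth X) (hY : VSmooth Y) : VSmooth (X + Y) :=
  fun e he i ↦ by
    rw [vrep_add]
    exact (hX e he i).add (hY e he i)

lemma VSmooth.smul (c : ℝ) {X : VF M} (hX : VSmooth X) : VSmooth (c • X) := fun e he i ↦ by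
  rw [vrep_smul]
  exact contDiffOn_const.mul (hX e he i)

lemma vSmooth_zero : VSmooth (0 : VF M) := fun e he i ↦ by
  rw [vrep_zero]
  exact contDiffOn_const

lemma VSmooth.fmul {φ : M → ℝ} (hφ : FSmooth φ) {X : VF M} (hX : VSmooth X) :
    VSmooth fun x ↦ φ x • X x := fun e he i ↦ by
  have h : ∀ y, vrep (fun x ↦ φ x • X x) e y i = φ (e.symm y) * vrep X e y i := fun y ↦ by
    simp only [vrep, vrepAt, map_smul, PiLp.smul_apply, smul_eq_mul]
  simp only [h]
  exact (hφ e he).mul (hX e he i)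

lemma VSmooth.differentiableAt {X : VF M} (hX : VSmooth X) {e : OpenPartialHomeomorph M E2}
    (he : IsChart e) {y : E2} (hy : y ∈ e.target) (i : Fin 2) :
    DifferentiableAt ℝ (fun z ↦ vrep X e z i) y :=
  ContDiffOn.differentiableAt_of_isOpen e.open_target (hX e he i) hy

variable (g : Metric M)

lemma dvM_add {X Y : VF M} (hX : VSmooth X) (hY : VSmooth Y) (x : M) :
    dvM g (X + Y) x = dvM g X x + dvM g Y x := by
  rw [dvM, vrep_add]
  exact dv_add (hX.differentiableAt (isChart_chartAt x) (mem_chart_target E2 x))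
    (hY.differentiableAt (isChart_chartAt x) (mem_chart_target E2 x))

lemma lieT_eq_iff {h : Tens M} {X : VF M} (hX : VSmooth X) {x : M}
    (hh : repAt h (chartAt E2 x) x
      = lieTF (rep g.inner (chartAt E2 x)) (vrep X (chartAt E2 x)) (chartAt E2 x x)) :
    lieT g X x = h x := by
  have hx := mem_chart_source E2 x
  rw [← rep_lieT hX (isChart_chartAt x) (mem_chart_target E2 x), rep_apply_chart _ hx] at hh
  ext v w
  rw [apply_eq_repAt (isChart_chartAt x) _ hx, apply_eq_repAt (isChart_chartAt x) _ hx, hh]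

lemma repAt_add (h k : Tens M) (e : OpenPartialHomeomorph M E2) (x : M) :
    repAt (h + k) e x = repAt h e x + repAt k e x := rfl

lemma repAt_smul (c : ℝ) (h : Tens M) (e : OpenPartialHomeomorph M E2) (x : M) :
    repAt (c • h) e x = c • repAt h e x := rfl

lemma repAt_lieT {X : VF M} (hX : VSmooth X) {e : OpenPartialHomeomorph M E2} (he : IsChart e)
    {x : M} (hx : x ∈ e.source) :
    repAt (lieT g X) e x = lieTF (rep g.inner e) (vrep X e) (e x) := by
  rw [← rep_apply_chart _ hx, rep_lieT hX he (e.map_source hx)]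

lemma lieT_add {X Y : VF M} (hX : VSmooth X) (hY : VSmooth Y) :
    lieT g (X + Y) = lieT g X + lieT g Y := by
  funext x
  refine lieT_eq_iff g (hX.add hY) ?_
  rw [repAt_add, repAt_lieT g hX (isChart_chartAt x) (mem_chart_source E2 x),
    repAt_lieT g hY (isChart_chartAt x) (mem_chart_source E2 x), vrep_add]
  exact (lieTF_add (hX.differentiableAt (isChart_chartAt x) (mem_chart_target E2 x))
    (hY.differentiableAt (isChart_chartAt x) (mem_chart_target E2 x))).symm

lemma lieT_smul (c : ℝ) {X : VF M} (hX : VSmooth X) : lieT g (c • X) = c • lieT g X := by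
  funext x
  refine lieT_eq_iff g (hX.smul c) ?_
  rw [repAt_smul, repAt_lieT g hX (isChart_chartAt x) (mem_chart_source E2 x), vrep_smul]
  exact (lieTF_smul c (hX.differentiableAt (isChart_chartAt x) (mem_chart_target E2 x))).symm

/-! ### Vector fields supported in a chart -/

variable [T2Space M]

lemma isCompact_image_chart {e : OpenPartialHomeomorph M E2} {K : Set M} (hK : IsCompact K)
    (hKe : K ⊆ e.source) : IsCompact (e '' K) := hK.image_of_continuousOn (e.continuousOn.mono hKe)

open Classical in
/-- The vector field with components `ξ` in the chart `e`, extended by zero. -/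
def localVF (e : OpenPartialHomeomorph M E2) (ξ : E2 → E2) : VF M := fun x ↦
  if x ∈ e.source then frame e x (ξ (e x)) else 0

lemma vrep_localVF {e : OpenPartialHomeomorph M E2} (he : IsChart e) (ξ : E2 → E2) {y : E2}
    (hy : y ∈ e.target) : vrep (localVF e ξ) e y = ξ y := by
  have hx := e.map_target hy
  refine vrepAt_frame he hx _ ?_
  rw [localVF, if_pos hx, e.right_inv hy]

lemma localVF_eq_zero {e : OpenPartialHomeomorph M E2} {ξ : E2 → E2} {x : M}
    (hx : x ∉ e.symm '' tsupport ξ) : localVF e ξ x = 0 := by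
  rw [localVF]
  split_ifs with h
  · have : ξ (e x) = 0 := image_eq_zero_of_notMem_tsupport fun h' ↦ hx ⟨_, h', e.left_inv h⟩
    rw [this, map_zero]
  · rfl

/-- Away from the chart domain the field vanishes near the point, because the image of the compact
support is closed in the Hausdorff space `M`. -/
lemma vSmooth_localVF {e : OpenPartialHomeomorph M E2} (he : IsChart e) {ξ : E2 → E2}
    (hξ : ∀ i, ContDiff ℝ ∞ fun y ↦ ξ y i) (hc : HasCompactSupport ξ) (hs : tsupport ξ ⊆ e.target) :
    VSmooth (localVF e ξ) := by
  have hK : IsCompact (e.symm '' tsupport ξ) :=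
    hc.image_of_continuousOn (e.continuousOn_symm.mono hs)
  refine vSmooth_of_local fun x ↦ ?_
  by_cases hx : x ∈ e.source
  · refine ⟨e, he, hx, fun i ↦ (hξ i).contDiffAt.congr_of_eventuallyEq ?_⟩
    filter_upwards [e.open_target.mem_nhds (e.map_source hx)] with y hy
    rw [vrep_localVF he ξ hy]
  · have hx' : x ∉ e.symm '' tsupport ξ := by
      rintro ⟨y, hy, rfl⟩
      exact hx (e.map_target (hs hy))
    set c := chartAt E2 x with hcd
    have hxc : x ∈ c.source := mem_chart_source E2 x
    refine ⟨c, isChart_chartAt x, hxc, fun i ↦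
      (contDiffAt_const (c := (0 : ℝ))).congr_of_eventuallyEq ?_⟩
    have hcont : ContinuousAt c.symm (c x) := c.continuousAt_symm (c.map_source hxc)
    have : (e.symm '' tsupport ξ)ᶜ ∈ nhds (c.symm (c x)) := by
      rw [c.left_inv hxc]
      exact hK.isClosed.isOpen_compl.mem_nhds hx'
    filter_upwards [hcont.preimage_mem_nhds this] with y hy
    simp only [vrep, vrepAt, localVF_eq_zero hy, map_zero]
    rfl

/-! ### The divergence theorem -/

variable [CompactSpace M] [MeasurableSpace M] [BorelSpace M]

lemma dvM_eq_zero {X : VF M} {x : M} (h : ∀ᶠ z in nhds x, X z = 0) : dvM g X x = 0 := by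
  refine dv_zero_of_eventually ?_
  have hx := mem_chart_source E2 x
  have hcont := (chartAt E2 x).continuousAt_symm (mem_chart_target E2 x)
  rw [ContinuousAt, (chartAt E2 x).left_inv hx] at hcont
  filter_upwards [hcont.eventually h] with y hy
  simp only [vrep, vrepAt, hy, map_zero]

/-- In the chart, √det γ div X = ∂ᵢ(√det γ Xⁱ), and the integral of a derivative of a compactly
supported smooth function on the plane vanishes. -/
lemma integral_dvM_of_isCompact {X : VF M} (hX : VSmooth X) {e : OpenPartialHomeomorph M E2}
    (he : IsChart e) {K : Set M} (hK : IsCompact K) (hKe : K ⊆ e.source)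
    (h0 : ∀ x, x ∉ K → X x = 0) : ∫ x, dvM g X x ∂areaMeasure g = 0 := by
  have hz : ∀ x, x ∉ K → dvM g X x = 0 := fun x hx ↦
    dvM_eq_zero g (Filter.eventually_of_mem (hK.isClosed.isOpen_compl.mem_nhds hx) h0)
  rw [← setIntegral_eq_integral_of_forall_compl_eq_zero (s := e.source)
      (fun x hx ↦ hz x fun h ↦ hx (hKe h)),
    setIntegral_areaMeasure g he (fSmooth_dvM g hX).continuous.aestronglyMeasurable]
  -- The components √det γ Xⁱ extended by zero; they are smooth on the whole plane because X
  -- vanishes outside the compact `K`.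
  set η : Fin 2 → E2 → ℝ := fun i ↦ e.target.indicator fun y ↦ dens g e y * vrep X e y i with hη
  have hK' : IsCompact (e '' K) := isCompact_image_chart hK hKe
  have hη0 : ∀ i y, y ∉ e '' K → η i y = 0 := by
    intro i y hy
    simp only [hη]
    by_cases hyt : y ∈ e.target
    · have : e.symm y ∉ K := fun h ↦ hy ⟨_, h, e.right_inv hyt⟩
      rw [Set.indicator_of_mem hyt, vrep, vrepAt, h0 _ this, map_zero]
      simp
    · exact Set.indicator_of_notMem hyt _
  have hηc : ∀ i, HasCompactSupport (η i) := fun i ↦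
    HasCompactSupport.intro hK' fun y hy ↦ hη0 i y hy
  have hηs : ∀ i, ContDiff ℝ ∞ (η i) := by
    intro i
    refine contDiff_iff_contDiffAt.2 fun y ↦ ?_
    by_cases hyt : y ∈ e.target
    · have h1 : ContDiffAt ℝ ∞ (fun y ↦ dens g e y * vrep X e y i) y :=
        ((contDiffOn_dens g he).mul (hX e he i)).contDiffAt (e.open_target.mem_nhds hyt)
      refine h1.congr_of_eventuallyEq ?_
      filter_upwards [e.open_target.mem_nhds hyt] with z hz
      exact Set.indicator_of_mem hz _
    · have : y ∉ e '' K := by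
        rintro ⟨x, hx, rfl⟩
        exact hyt (e.map_source (hKe hx))
      refine (contDiffAt_const (c := (0 : ℝ))).congr_of_eventuallyEq ?_
      filter_upwards [hK'.isClosed.isOpen_compl.mem_nhds this] with z hz
      exact hη0 i z hz
  have hpd0 : ∀ i k y, y ∉ e.target → pd k (η i) y = 0 := by
    intro i k y hyt
    have : y ∉ e '' K := by
      rintro ⟨x, hx, rfl⟩
      exact hyt (e.map_source (hKe hx))
    rw [pd_congr_of_isOpen (g := fun _ ↦ 0) hK'.isClosed.isOpen_compl this fun z hz ↦ hη0 i z hz]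
    exact pd_const _
  have hint : ∀ i, Integrable (pd i (η i)) := fun i ↦
    (((hηs i).continuous_fderiv (by simp)).clm_apply
      continuous_const).integrable_of_hasCompactSupport ((hηc i).fderiv_apply (𝕜 := ℝ) _)
  have h1 : ∫ y in e.target, dens g e y * dvM g X (e.symm y)
      = ∫ y in e.target, (pd 0 (η 0) y + pd 1 (η 1) y) := by
    refine setIntegral_congr_fun e.open_target.measurableSet fun y hy ↦ ?_
    have hpd : ∀ i k, pd k (η i) y = pd k (fun z ↦ √(rep g.inner e z).det * vrep X e z i) y :=
      fun i k ↦ pd_congr_of_isOpen e.open_target hy fun z hz ↦ Set.indicator_of_mem hz _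
    simp only [hpd]
    rw [dvM_apply g hX he (e.map_target hy), e.right_inv hy, dens,
      (Metric.isMetricOn he g).sqrt_det_mul_dv hy (hX.differentiableAt he hy)]
  rw [h1, setIntegral_eq_integral_of_forall_compl_eq_zero
    (fun y hy ↦ by rw [hpd0 _ _ _ hy, hpd0 _ _ _ hy, add_zero]),
    integral_add (hint 0) (hint 1), integral_pd_eq_zero (hηs 0) (hηc 0),
    integral_pd_eq_zero (hηs 1) (hηc 1), add_zero]

/-- Decompose X = Σ ρ_c X by the partition of unity; each summand is supported in one chart. -/
theorem integral_dvM {X : VF M} (hX : VSmooth X) : ∫ x, dvM g X x ∂areaMeasure g = 0 := by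
  have hρ : ∀ c, VSmooth (fun x ↦ chartPartition M c x • X x) := fun c ↦
    hX.fmul (fSmooth_of_contMDiff (chartPartition M c).contMDiff)
  have hsum : ∀ s : Finset M, VSmooth (∑ c ∈ s, fun x ↦ chartPartition M c x • X x) ∧
      ∫ x, dvM g (∑ c ∈ s, fun x ↦ chartPartition M c x • X x) x ∂areaMeasure g = 0 := by
    classical
    intro s
    induction s using Finset.induction_on with
    | empty =>
      rw [Finset.sum_empty]
      refine ⟨vSmooth_zero, ?_⟩
      have : ∀ x, dvM g (0 : VF M) x = 0 := fun x ↦ dvM_eq_zero g (Filter.Eventually.of_forall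
        fun _ ↦ rfl)
      simp [this]
    | insert c s hc ih =>
      rw [Finset.sum_insert hc]
      refine ⟨(hρ c).add ih.1, ?_⟩
      have h1 : ∫ x, dvM g (fun x ↦ chartPartition M c x • X x) x ∂areaMeasure g = 0 := by
        refine integral_dvM_of_isCompact g (hρ c) (isChart_chartAt c)
          (isClosed_tsupport (chartPartition M c)).isCompact (chartPartition_tsupport c)
          fun x hx ↦ ?_
        rw [image_eq_zero_of_notMem_tsupport hx, zero_smul]
      simp only [dvM_add g (hρ c) ih.1]
      rw [integral_add (integrable_of_continuous g (fSmooth_dvM g (hρ c)).continuous)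
        (integrable_of_continuous g (fSmooth_dvM g ih.1).continuous), h1, ih.2, add_zero]
  have hXe : X = ∑ c ∈ partIndex M, fun x ↦ chartPartition M c x • X x := by
    funext x
    rw [Finset.sum_apply, ← Finset.sum_smul, sum_chartPartition, one_smul]
  rw [hXe]
  exact (hsum _).2

end TTSurface

namespace TTSurface

open MeasureTheory

variable {M : Type*} [TopologicalSpace M] [ChartedSpace E2 M] [IsManifold 𝓘(ℝ, E2) ∞ M]
  [T2Space M] [CompactSpace M] [MeasurableSpace M] [BorelSpace M]

section

variable (g : Metric M)

/-! ### The adjoint of the divergence and the coercivity estimate -/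

/-- The `L²` inner product of two-tensors. -/
def l2 (h k : Tens M) : ℝ := ∫ x, tinner g h k x ∂areaMeasure g

lemma l2Inner_eq (h k : Tensor2 M) : l2Inner g h k = l2 g (fun x ↦ h x) fun x ↦ k x := by
  simp only [l2Inner, l2, tensorInner_eq]

lemma fSmooth_divergence_apply {h : Tensor2 M} (hh : STF g fun x ↦ h x) {X : VF M}
    (hX : VSmooth X) : FSmooth fun x ↦ divergence g h x (X x) := by
  have h1 : (fun x ↦ divergence g h x (X x)) = fun x ↦ (1 / 2) * tinner g (fun x ↦ h x) (lieT g X) x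
      - dvM g (sharpM g (fun x ↦ h x) X) x := by
    funext x
    rw [tinner_lieT hh hX]
    ring
  rw [h1]
  intro e he
  exact (contDiffOn_const.mul (fSmooth_tinner g h.tSmooth (tSmooth_lieT g hX) e he)).sub
    (fSmooth_dvM g (vSmooth_sharpM g hX h.tSmooth) e he)

theorem l2_lieT {h : Tensor2 M} (hh : STF g fun x ↦ h x) {X : VF M} (hX : VSmooth X) :
    l2 g (fun x ↦ h x) (lieT g X) = 2 * ∫ x, divergence g h x (X x) ∂areaMeasure g := by
  have hs := vSmooth_sharpM g hX h.tSmooth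
  simp only [l2, tinner_lieT hh hX]
  rw [integral_add, integral_const_mul, integral_const_mul, integral_dvM g hs, mul_zero, add_zero]
  · exact (integrable_of_continuous g (fSmooth_divergence_apply g hh hX).continuous).const_mul _
  · exact (integrable_of_continuous g (fSmooth_dvM g hs).continuous).const_mul _

/-- For K = -1 Bochner's formula says -4 det ∇X = 2 div b + 2 |X|², and the left side is at most |S
X|² by `four_mul_det_cov_le`. -/
lemma le_tinner_lieT (hg : IsHyperbolic g) {X : VF M} (hX : VSmooth X) (x : M) :
    2 * dvM g (bvecM g X) x + 2 * g.inner x (X x) (X x) ≤ tinner g (lieT g X) (lieT g X) x := by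
  set c := chartAt E2 x with hcdef
  have hc : IsChart c := isChart_chartAt x
  have hx : x ∈ c.source := mem_chart_source E2 x
  have hy : c x ∈ c.target := c.map_source hx
  have hγ := Metric.isMetricOn hc g
  have h1 := hγ.four_mul_det_cov_le hy (vrep X c)
  have h2 := hγ.dv_bvec hy (hX c hc)
  have h3 : dvM g (bvecM g X) x = dv (rep g.inner c) (bvec (rep g.inner c) (vrep X c)) (c x) :=
    dv_congr_of_eqOn c.open_target hy fun z hz ↦ vrep_vfOf (natural_bvec g hX) hc hz
  rw [tinner, ← hcdef, repAt_lieT g hX hc hx, h3, inner_eq_mquad g hc hx]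
  rw [rep_apply_chart _ hx] at h1 h2
  rw [vrep_apply_chart _ hx, gc_eq_gaussCurvature g hc hx, hg x] at h2
  linarith

/-- The divergence term integrates to zero. This is a quantitative form of the absence of conformal
Killing fields on a hyperbolic surface. -/
theorem two_mul_integral_inner_le (hg : IsHyperbolic g) {X : VF M} (hX : VSmooth X) :
    2 * ∫ x, g.inner x (X x) (X x) ∂areaMeasure g ≤ l2 g (lieT g X) (lieT g X) := by
  have hb := vSmooth_bvecM g hX
  have hS := tSmooth_lieT g hX
  have i1 := (integrable_of_continuous g (fSmooth_dvM g hb).continuous).const_mul 2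
  have i2 := (integrable_of_continuous g (fSmooth_inner g hX).continuous).const_mul 2
  have h1 := integral_mono (i1.add i2) (integrable_of_continuous g (fSmooth_tinner g hS hS).continuous)
    (le_tinner_lieT g hg hX)
  simp only [Pi.add_apply] at h1
  rw [integral_add i1 i2, integral_const_mul, integral_const_mul, integral_dvM g hb, mul_zero,
    zero_add] at h1
  exact h1

lemma areaMeasure_le_smul (G : Metric M) {C : ℝ} (hC : 0 ≤ C)
    (h : ∀ c : M, ∀ y ∈ (chartAt E2 c).target,
      dens G (chartAt E2 c) y ≤ C * dens g (chartAt E2 c) y) :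
    areaMeasure G ≤ ENNReal.ofReal C • areaMeasure g := by
  refine Measure.le_iff.2 fun s hs ↦ ?_
  rw [← lintegral_indicator_one hs, Measure.smul_apply, ← lintegral_indicator_one hs, smul_eq_mul]
  have hm : Measurable (s.indicator (1 : M → ENNReal)) := measurable_one.indicator hs
  rw [lintegral_areaMeasure G hm, lintegral_areaMeasure g hm, Finset.mul_sum]
  refine Finset.sum_le_sum fun c _ ↦ ?_
  rw [← lintegral_const_mul' _ _ ENNReal.ofReal_ne_top]
  refine setLIntegral_mono' (chartAt E2 c).open_target.measurableSet fun y hy ↦ ?_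
  rw [mul_left_comm, ← ENNReal.ofReal_mul hC]
  refine mul_le_mul_right (ENNReal.ofReal_le_ofReal ?_) _
  rw [mul_left_comm]
  exact mul_le_mul_of_nonneg_left (h c y hy) ((chartPartition M).nonneg c _)

lemma integral_le_mul_integral (G : Metric M) {C : ℝ} (hC : 0 ≤ C)
    (h : ∀ c : M, ∀ y ∈ (chartAt E2 c).target,
      dens G (chartAt E2 c) y ≤ C * dens g (chartAt E2 c) y) {f : M → ℝ} (hf : Continuous f)
    (h0 : ∀ x, 0 ≤ f x) : ∫ x, f x ∂areaMeasure G ≤ C * ∫ x, f x ∂areaMeasure g := by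
  have h1 := integral_mono_measure (areaMeasure_le_smul g G hC h) (Filter.Eventually.of_forall h0)
    ((integrable_of_continuous g hf).smul_measure ENNReal.ofReal_ne_top)
  rwa [integral_smul_measure, ENNReal.toReal_ofReal hC, smul_eq_mul] at h1

lemma tinner_self_nonneg {h : Tens M} (hh : STF g h) (x : M) : 0 ≤ tinner g h h x :=
  (Metric.isPosMat (isChart_chartAt x) g (mem_chart_source E2 x)).minner_self_nonneg
    (hh.repAt_symm _ _) (hh.mtr x)

lemma inner_self_nonneg' (X : VF M) (x : M) : 0 ≤ g.inner x (X x) (X x) := by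
  rw [inner_eq_mquad g (isChart_chartAt x) (mem_chart_source E2 x)]
  exact (Metric.isPosMat (isChart_chartAt x) g (mem_chart_source E2 x)).mquad_nonneg _

/-! ### From the hyperbolic metric to a conformal one. -/

section conformal

variable {g} {G : Metric M} {u : M → ℝ} (hu : FSmooth u)
  (hG : ∀ x, G.inner x = Real.exp (2 * u x) • g.inner x)

include hG

omit [T2Space M] [CompactSpace M] [MeasurableSpace M] [BorelSpace M] in
lemma rep_conformal (e : OpenPartialHomeomorph M E2) :
    rep G.inner e = fun y ↦ Real.exp (2 * u (e.symm y)) • rep g.inner e y := by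
  funext y
  ext i j
  simp only [rep, repAt, Matrix.of_apply, hG, Matrix.smul_apply, smul_apply]

lemma dens_conformal (e : OpenPartialHomeomorph M E2) (y : E2) :
    dens G e y = Real.exp (2 * u (e.symm y)) * dens g e y := by
  rw [dens, rep_conformal hG, Matrix.det_smul, Fintype.card_fin, Real.sqrt_mul (sq_nonneg _),
    Real.sqrt_sq (Real.exp_pos _).le, dens]

-- The operator scales by e^{2u} and the squared norm of two-tensors by e^{-4u}, so |S X|² is the
-- same function for both metrics.
include hu in
lemma tinner_lieT_conformal {X : VF M} (hX : VSmooth X) (x : M) :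
    tinner G (lieT G X) (lieT G X) x = tinner g (lieT g X) (lieT g X) x := by
  set c := chartAt E2 x with hcdef
  have hc : IsChart c := isChart_chartAt x
  have hx : x ∈ c.source := mem_chart_source E2 x
  have hy : c x ∈ c.target := c.map_source hx
  have hγ := Metric.isMetricOn hc g
  have hdu : DifferentiableAt ℝ (fun y ↦ u (c.symm y)) (c x) :=
    ContDiffOn.differentiableAt_of_isOpen c.open_target (hu c hc) hy
  have h1 : repAt (lieT G X) c x = Real.exp (2 * u x) • repAt (lieT g X) c x := by
    rw [repAt_lieT G hX hc hx, repAt_lieT g hX hc hx, rep_conformal hG,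
      lieTF_conformal (c := fun y ↦ Real.exp (2 * u (c.symm y))) (hdu.const_mul 2).exp
      (Real.exp_pos _).ne' (hγ.differentiableAt hy) (hγ.det_pos' hy).ne' (hγ.symm _ hy),
      c.left_inv hx]
  have h2 : repAt G.inner c x = Real.exp (2 * u x) • repAt g.inner c x := by
    rw [← rep_apply_chart _ hx, rep_conformal hG]
    simp only [rep_apply_chart _ hx, c.left_inv hx]
  have hd : (repAt g.inner c x).det ≠ 0 := by
    rw [← rep_apply_chart _ hx]; exact (hγ.det_pos' hy).ne'
  rw [tinner, tinner, ← hcdef, h1, h2, minner_smul_metric (Real.exp_pos _).ne' hd]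

-- The hyperbolic estimate is transferred to g at the price of three factors e^{2r}: one for the
-- area in ∫|S X|², one for |X|² in the two metrics, and one for the area in ∫|X|².
include hu in
theorem integral_inner_le_of_conformal (hhyp : IsHyperbolic G) {r : ℝ} (hr : ∀ x, |u x| ≤ r)
    {X : VF M} (hX : VSmooth X) :
    ∫ x, g.inner x (X x) (X x) ∂areaMeasure g
      ≤ Real.exp (6 * r) / 2 * l2 g (lieT g X) (lieT g X) := by
  have cq := (fSmooth_inner g hX).continuous
  have cQ := (fSmooth_inner G hX).continuous
  have hS := tSmooth_lieT g hX
  have cs := (fSmooth_tinner g hS hS).continuous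
  have h1 := two_mul_integral_inner_le G hhyp hX
  have h2 : l2 G (lieT G X) (lieT G X)
      ≤ Real.exp (2 * r) * l2 g (lieT g X) (lieT g X) := by
    rw [l2, funext (tinner_lieT_conformal hu hG hX)]
    refine integral_le_mul_integral g G (Real.exp_pos _).le (fun c y hy ↦ ?_) cs
      (tinner_self_nonneg g (stf_lieT hX))
    rw [dens_conformal hG]
    exact mul_le_mul_of_nonneg_right (Real.exp_le_exp.2 (by linarith [(abs_le.1 (hr ((chartAt E2 c).symm y))).2]))
      (dens_pos g (isChart_chartAt c) hy).le
  have h3 : Real.exp (-2 * r) * ∫ x, g.inner x (X x) (X x) ∂areaMeasure G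
      ≤ ∫ x, G.inner x (X x) (X x) ∂areaMeasure G := by
    rw [← integral_const_mul]
    refine integral_mono ((integrable_of_continuous G cq).const_mul _)
      (integrable_of_continuous G cQ) fun x ↦ ?_
    simp only [hG, smul_apply, smul_eq_mul]
    exact mul_le_mul_of_nonneg_right (Real.exp_le_exp.2 (by linarith [(abs_le.1 (hr x)).1]))
      (inner_self_nonneg' g X x)
  have h4 : ∫ x, g.inner x (X x) (X x) ∂areaMeasure g
      ≤ Real.exp (2 * r) * ∫ x, g.inner x (X x) (X x) ∂areaMeasure G := by
    refine integral_le_mul_integral G g (Real.exp_pos _).le (fun c y hy ↦ ?_) cq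
      (inner_self_nonneg' g X)
    rw [dens_conformal hG, ← mul_assoc, ← Real.exp_add]
    exact le_mul_of_one_le_left (dens_pos g (isChart_chartAt c) hy).le
      (Real.one_le_exp (by linarith [(abs_le.1 (hr ((chartAt E2 c).symm y))).1]))
  set q := ∫ x, g.inner x (X x) (X x) ∂areaMeasure g
  set Q := ∫ x, g.inner x (X x) (X x) ∂areaMeasure G
  set S := l2 g (lieT g X) (lieT g X)
  have e1 : Real.exp (2 * r) * (Real.exp (2 * r) * (Real.exp (2 * r))) = Real.exp (6 * r) := by
    rw [← Real.exp_add, ← Real.exp_add]; ring_nf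
  have e2 : Real.exp (2 * r) * Real.exp (-2 * r) = 1 := by
    rw [← Real.exp_add]; simp
  have h5 : 2 * (Real.exp (-2 * r) * Q) ≤ Real.exp (2 * r) * S := by linarith
  have h6 : 2 * Q ≤ Real.exp (2 * r) * (Real.exp (2 * r) * S) := by
    have := mul_le_mul_of_nonneg_left h5 (Real.exp_pos (2 * r)).le
    calc 2 * Q = 2 * (Real.exp (2 * r) * Real.exp (-2 * r)) * Q := by rw [e2]; ring
      _ = Real.exp (2 * r) * (2 * (Real.exp (-2 * r) * Q)) := by ring
      _ ≤ _ := this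
  have h7 := mul_le_mul_of_nonneg_left h6 (Real.exp_pos (2 * r)).le
  rw [← e1]
  linarith

end conformal

end

end TTSurface

namespace TTSurface

/-! ### Parallel sections of flat connections on a ball -/

section flat

variable {E V F : Type*} [NormedAddCommGroup E] [NormedSpace ℝ E] [NormedAddCommGroup V]
  [NormedSpace ℝ V] [NormedAddCommGroup F] [NormedSpace ℝ F]

/-- The derivative is C¹, hence Lipschitz near x₀, and the mean value inequality on segments gives
the second-order remainder. One constant serves for the map, its derivative and the remainder. -/
lemma exists_quadratic_bound {A : E → F} {x₀ : E} (hA : ContDiffAt ℝ ∞ A x₀) :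
    ∃ ρ > 0, ∃ K > 0, ∀ x ∈ Metric.ball x₀ ρ, DifferentiableAt ℝ A x ∧ ‖A x‖ ≤ K ∧
      (∀ w, ‖fderiv ℝ A x w‖ ≤ K * ‖w‖) ∧
      ∀ y ∈ Metric.ball x₀ ρ, ‖A y - A x - fderiv ℝ A x (y - x)‖ ≤ K * ‖y - x‖ ^ 2 := by
  have h1 : ContDiffAt ℝ 1 (fderiv ℝ A) x₀ := hA.fderiv_right (m := 1) (WithTop.coe_le_coe.2 le_top)
  obtain ⟨L, t, ht, hL⟩ := h1.exists_lipschitzOnWith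
  have c1 : ∀ᶠ x in nhds x₀, ‖A x‖ < ‖A x₀‖ + 1 :=
    hA.continuousAt.norm.eventually_lt continuousAt_const (by linarith)
  have c2 : ∀ᶠ x in nhds x₀, ‖fderiv ℝ A x‖ < ‖fderiv ℝ A x₀‖ + 1 :=
    h1.continuousAt.norm.eventually_lt continuousAt_const (by linarith)
  have c3 : ∀ᶠ x in nhds x₀, DifferentiableAt ℝ A x := by
    have h2 : ContDiffAt ℝ 1 A x₀ := hA.of_le (by exact_mod_cast le_top)
    filter_upwards [h2.eventually (by simp)] with x hx
    exact hx.differentiableAt (by simp)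
  obtain ⟨ρ, hρ, hball⟩ := Metric.mem_nhds_iff.1
    (Filter.inter_mem (Filter.inter_mem ht c1) (Filter.inter_mem c2 c3))
  refine ⟨ρ, hρ, (‖A x₀‖ + 1) + (‖fderiv ℝ A x₀‖ + 1) + L, by positivity, fun x hx ↦ ?_⟩
  obtain ⟨⟨hxt, hx1⟩, hx2, hx3⟩ := hball hx
  simp only [Set.mem_ofPred_eq] at hx1 hx2 hx3
  have n1 := norm_nonneg (A x₀)
  have n2 := norm_nonneg (fderiv ℝ A x₀)
  have n3 := L.coe_nonneg
  refine ⟨hx3, by linarith, fun w ↦ ((fderiv ℝ A x).le_opNorm w).trans (by gcongr; linarith),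
    fun y hy ↦ ?_⟩
  have hseg : segment ℝ x y ⊆ Metric.ball x₀ ρ := (convex_ball x₀ ρ).segment_subset hx hy
  have := Convex.norm_image_sub_le_of_norm_hasFDerivWithin_le' (f := A) (f' := fderiv ℝ A)
    (φ := fderiv ℝ A x) (C := L * ‖y - x‖) (s := segment ℝ x y) (x := x) (y := y)
    (fun z hz ↦ (show DifferentiableAt ℝ A z from
      (hball (hseg hz)).2.2).hasFDerivAt.hasFDerivWithinAt)
    (fun z hz ↦ ?_) (convex_segment x y) (left_mem_segment ℝ x y) (right_mem_segment ℝ x y)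
  · refine this.trans ?_
    rw [sq, ← mul_assoc]
    gcongr
    linarith
  · refine (hL.norm_sub_le (hball (hseg hz)).1.1 hxt).trans ?_
    gcongr
    obtain ⟨a, b, ha, hb, hab, rfl⟩ := hz
    have : a • x + b • y - x = b • (y - x) := by
      rw [show a = 1 - b by linarith]; module
    rw [this, norm_smul, Real.norm_of_nonneg hb]
    exact mul_le_of_le_one_left (norm_nonneg _) (by linarith)

lemma hasFDerivAt_of_quadratic {W : E → F} {T : E →L[ℝ] F} {x : E} {C : ℝ}
    (h : ∀ᶠ w in nhds (0 : E), ‖W (x + w) - W x - T w‖ ≤ C * ‖w‖ ^ 2) : HasFDerivAt W T x := by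
  rw [hasFDerivAt_iff_isLittleO_nhds_zero]
  have hbig : (fun w : E ↦ W (x + w) - W x - T w) =O[nhds 0] fun w : E ↦ ‖w‖ ^ 2 := by
    refine Asymptotics.IsBigO.of_bound C ?_
    filter_upwards [h] with w hw
    rwa [Real.norm_of_nonneg (by positivity)]
  refine hbig.trans_isLittleO ?_
  have h1 : (fun w : E ↦ ‖w‖ ^ 2) =o[nhds 0] fun w : E ↦ ‖w‖ :=
    (Asymptotics.isLittleO_pow_id (one_lt_two)).comp_tendsto (by
      simpa using (continuous_norm (E := E)).tendsto 0)
  exact h1.of_norm_right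

/-- Grönwall's inequality with rate 1/2 on a unit interval, where the exponential is at most 2. -/
lemma norm_le_of_hasDerivWithinAt {u u' : ℝ → V} {δ ε : ℝ}
    (hu : ∀ t ∈ Set.Icc (0 : ℝ) 1, HasDerivWithinAt u (u' t) (Set.Icc 0 1) t) (h0 : ‖u 0‖ ≤ δ)
    (hε : 0 ≤ ε) (hb : ∀ t ∈ Set.Icc (0 : ℝ) 1, ‖u' t‖ ≤ 1 / 2 * ‖u t‖ + ε) :
    ∀ t ∈ Set.Icc (0 : ℝ) 1, ‖u t‖ ≤ 2 * δ + 2 * ε := by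
  intro t ht
  have h1 := norm_le_gronwallBound_of_norm_deriv_right_le (f := u) (f' := u') (δ := δ)
    (K := 1 / 2) (ε := ε) (fun s hs ↦ (hu s hs).continuousWithinAt)
    (fun s hs ↦ (hu s (Set.Ico_subset_Icc_self hs)).mono_of_mem_nhdsWithin
      (Icc_mem_nhdsGE_of_mem hs)) h0 (fun s hs ↦ hb s (Set.Ico_subset_Icc_self hs)) t ht
  rw [gronwallBound_of_K_ne_0 (by norm_num)] at h1
  have hδ : 0 ≤ δ := (norm_nonneg _).trans h0
  have h2 : Real.exp (1 / 2 * (t - 0)) ≤ 2 := by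
    refine (Real.exp_le_exp.2 (show 1 / 2 * (t - 0) ≤ 1 / 2 by linarith [ht.2])).trans ?_
    have h3 : Real.exp (1 / 2) * Real.exp (1 / 2) = Real.exp 1 := by
      rw [← Real.exp_add]; norm_num
    nlinarith [Real.exp_one_lt_d9, Real.exp_pos (1 / 2)]
  calc ‖u t‖ ≤ δ * Real.exp (1 / 2 * (t - 0)) + ε / (1 / 2) * (Real.exp (1 / 2 * (t - 0)) - 1) := h1
    _ ≤ δ * 2 + ε / (1 / 2) * (2 - 1) := by gcongr
    _ = 2 * δ + 2 * ε := by ring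

/-- Picard–Lindelöf on the ball of radius ‖w₀‖ about w₀: there ‖x‖ ≤ 2‖w₀‖, so the velocity is at
most ‖w₀‖ and time one is reached inside the ball. -/
lemma exists_linear_ode [CompleteSpace V] {B : ℝ → V →L[ℝ] V}
    (hB : ContinuousOn B (Set.Icc 0 1)) (hb : ∀ t ∈ Set.Icc (0 : ℝ) 1, ‖B t‖ ≤ 1 / 2) (w₀ : V) :
    ∃ u : ℝ → V, u 0 = w₀ ∧
      ∀ t ∈ Set.Icc (0 : ℝ) 1, HasDerivWithinAt u (B t (u t)) (Set.Icc 0 1) t := by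
  have hp : IsPicardLindelof (fun t u ↦ B t u) (⟨0, by simp⟩ : Set.Icc (0 : ℝ) 1) w₀
      ‖w₀‖₊ 0 ‖w₀‖₊ (1 / 2) := by
    refine ⟨fun t ht ↦ ?_, fun x _ ↦ hB.clm_apply continuousOn_const, fun t ht x hx ↦ ?_, ?_⟩
    · refine ((B t).lipschitz.weaken ?_).lipschitzOnWith
      exact NNReal.coe_le_coe.1 (by simpa using hb t ht)
    · have hx' : ‖x‖ ≤ 2 * ‖w₀‖ := by
        have h1 : ‖x - w₀‖ ≤ ‖w₀‖ := by simpa [dist_eq_norm] using hx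
        have h2 := norm_add_le (x - w₀) w₀
        rw [sub_add_cancel] at h2
        linarith
      refine ((B t).le_opNorm x).trans ?_
      rw [coe_nnnorm]
      nlinarith [hb t ht, norm_nonneg (B t), norm_nonneg x]
    · simp
  obtain ⟨u, hu0, hu⟩ := hp.exists_eq_forall_mem_Icc_hasDerivWithinAt₀
  exact ⟨u, hu0, hu⟩

/-- Two parallel transports, along the rays towards v and v + w, are compared at time one. Their
difference agrees with the expected first-order term A(w)u up to O(‖w‖²), which replaces
differentiability of ODE solutions in a parameter. -/
lemma radial_increment_bound {x₀ : E} {A : E → E → V →L[ℝ] V} {A' : E → E → E → V →L[ℝ] V}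
    (hadd : ∀ x v w, A x (v + w) = A x v + A x w)
    (hadd' : ∀ x w v v', A' x w (v + v') = A' x w v + A' x w v')
    (hsmul' : ∀ x w v, ∀ t : ℝ, A' x (t • w) v = t • A' x w v) {ρ K δ : ℝ} (hK : 0 < K) (hδ : 0 ≤ δ)
    (hA : ∀ x ∈ Metric.ball x₀ ρ, ∀ v, ‖A x v‖ ≤ K * ‖v‖ ∧ (∀ w, ‖A' x w v‖ ≤ K * ‖w‖ * ‖v‖) ∧
      ∀ y ∈ Metric.ball x₀ ρ, ‖A y v - A x v - A' x (y - x) v‖ ≤ K * ‖y - x‖ ^ 2 * ‖v‖)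
    (hA1 : ∀ v w, ∀ t : ℝ, x₀ + t • v ∈ Metric.ball x₀ ρ →
      HasDerivAt (fun s : ℝ ↦ A (x₀ + s • v) w) (A' (x₀ + t • v) v w) t)
    (hflat : ∀ x ∈ Metric.ball x₀ ρ, ∀ v w : E, A' x w v - A' x v w
      + (A x v ∘L A x w - A x w ∘L A x v) = 0)
    (hρ : ρ ≤ 1) (hρK : K * ρ ≤ 1 / 2) {v w : E} (hv : ‖v‖ < ρ) (hvw : ‖v + w‖ < ρ)
    {u u' : ℝ → V} (h0 : u' 0 = u 0)
    (hu : ∀ t ∈ Set.Icc (0 : ℝ) 1, HasDerivWithinAt u (A (x₀ + t • v) v (u t)) (Set.Icc 0 1) t)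
    (hu' : ∀ t ∈ Set.Icc (0 : ℝ) 1,
      HasDerivWithinAt u' (A (x₀ + t • (v + w)) (v + w) (u' t)) (Set.Icc 0 1) t)
    (hub : ∀ t ∈ Set.Icc (0 : ℝ) 1, ‖u t‖ ≤ δ) :
    ‖u' 1 - u 1 - A (x₀ + v) w (u 1)‖ ≤ 2 * ((2 * K + 4 * K ^ 2) * δ * ‖w‖ ^ 2) := by
  have hmem : ∀ t ∈ Set.Icc (0 : ℝ) 1, ∀ z : E, ‖z‖ < ρ → x₀ + t • z ∈ Metric.ball x₀ ρ := by
    intro t ht z hz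
    rw [mem_ball_iff_norm, add_sub_cancel_left, norm_smul, Real.norm_of_nonneg ht.1]
    exact (mul_le_of_le_one_left (norm_nonneg _) ht.2).trans_lt hz
  have hwn : ‖w‖ ≤ 2 := by
    have := norm_sub_le (v + w) v
    rw [add_sub_cancel_left] at this
    linarith
  -- The candidate first variation of the transport is t A(w)u; D is the error of this ansatz and
  -- starts at zero.
  set D : ℝ → V := fun t ↦ u' t - u t - t • A (x₀ + t • v) w (u t) with hD
  set D' : ℝ → V := fun t ↦ A (x₀ + t • (v + w)) (v + w) (u' t) - A (x₀ + t • v) v (u t)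
    - (t • (A' (x₀ + t • v) v w (u t) + A (x₀ + t • v) w (A (x₀ + t • v) v (u t)))
      + A (x₀ + t • v) w (u t)) with hD'
  have hder : ∀ t ∈ Set.Icc (0 : ℝ) 1, HasDerivWithinAt D (D' t) (Set.Icc 0 1) t := by
    intro t ht
    have hx := hmem t ht v hv
    have hA3 := (hA1 v w t hx).hasDerivWithinAt.clm_apply (hu t ht)
    have hA4 := (hasDerivWithinAt_id t (Set.Icc (0 : ℝ) 1)).fun_smul hA3
    refine (((hu' t ht).fun_sub (hu t ht)).fun_sub hA4).congr_deriv ?_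
    simp only [hD', id, one_smul]
  have hbound : ∀ t ∈ Set.Icc (0 : ℝ) 1,
      ‖D' t‖ ≤ 1 / 2 * ‖D t‖ + (2 * K + 4 * K ^ 2) * δ * ‖w‖ ^ 2 := by
    intro t ht
    set x := x₀ + t • v with hxd
    set x' := x₀ + t • (v + w) with hxd'
    have hx : x ∈ Metric.ball x₀ ρ := hmem t ht v hv
    have hx' : x' ∈ Metric.ball x₀ ρ := hmem t ht _ hvw
    have hsub : x' - x = t • w := by rw [hxd, hxd']; module
    set R : E → V →L[ℝ] V := fun z ↦ A x' z - A x z - A' x (x' - x) z with hRd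
    have hA' : ∀ z, A x' z = A x z + t • A' x w z + R z := fun z ↦ by
      simp only [hRd, hsub, hsmul']; abel
    have hfl : A x v (A x w (u t)) = A x w (A x v (u t)) - A' x w v (u t)
        + A' x v w (u t) := by
      have h := congrArg (fun T : V →L[ℝ] V ↦ T (u t)) (hflat x hx v w)
      simp only [add_apply, sub_apply, ContinuousLinearMap.comp_apply, zero_apply] at h
      have h' := eq_neg_of_add_eq_zero_right h
      rw [sub_eq_iff_eq_add] at h'
      rw [h']; abel
    -- Flatness (`hfl`) removes all terms linear in w. What remains besides the homogeneous term is
    -- quadratic in w, so Grönwall applies with ε = O(‖w‖²).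
    have hid : D' t = A x' (v + w) (D t) + (R (v + w) (u t)
        + t • (A x' (v + w) - A x (v + w)) (A x w (u t)) + t • A' x w w (u t)
        + t • A x w (A x w (u t))) := by
      have hu'D : u' t = D t + u t + t • A x w (u t) := by simp only [hD]; abel
      have e1 : A x' (v + w) (u t) = A x (v + w) (u t) + t • A' x w (v + w) (u t)
          + R (v + w) (u t) := by
        rw [hA']; simp only [add_apply, smul_apply]
      have e2 : D' t = A x' (v + w) (u' t) - A x v (u t)
          - (t • (A' x v w (u t) + A x w (A x v (u t))) + A x w (u t)) := rfl
      rw [e2, hu'D, map_add, map_add, map_smul, e1]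
      simp only [hadd, hadd', add_apply, sub_apply, smul_sub, smul_add, hfl]
      abel
    have ht0 := ht.1
    have ht1 := ht.2
    have nw := norm_nonneg w
    have nR : ∀ z, ‖R z‖ ≤ K * ‖w‖ ^ 2 * ‖z‖ := fun z ↦ by
      refine ((hA x hx z).2.2 x' hx').trans ?_
      rw [hsub, norm_smul, Real.norm_of_nonneg ht0]
      gcongr
      exact mul_le_of_le_one_left nw ht1
    have nvw : ‖v + w‖ ≤ 1 := hvw.le.trans hρ
    have nt : ∀ z : V, ‖t • z‖ ≤ ‖z‖ := fun z ↦ by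
      rw [norm_smul, Real.norm_of_nonneg ht0]
      exact mul_le_of_le_one_left (norm_nonneg _) ht1
    have nap : ∀ {T : V →L[ℝ] V} {c d : ℝ} {z : V}, ‖T‖ ≤ c → ‖z‖ ≤ d → ‖T z‖ ≤ c * d :=
      fun {T c d z} hT hz ↦ (T.le_opNorm z).trans
        (mul_le_mul hT hz (norm_nonneg _) ((norm_nonneg _).trans hT))
    have hu1 := hub t ht
    have nA : ‖A x w‖ ≤ K * ‖w‖ := (hA x hx w).1
    have b0 : ‖A x' (v + w) (D t)‖ ≤ 1 / 2 * ‖D t‖ := by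
      refine nap (((hA x' hx' _).1).trans (le_trans ?_ hρK)) le_rfl
      gcongr
    have n1 : ‖R (v + w)‖ ≤ K * ‖w‖ ^ 2 :=
      (nR _).trans (mul_le_of_le_one_right (by positivity) nvw)
    have b1 : ‖R (v + w) (u t)‖ ≤ K * ‖w‖ ^ 2 * δ := nap n1 hu1
    have bAw : ‖A x w (u t)‖ ≤ K * ‖w‖ * δ := nap nA hu1
    have bdA : ‖A x' (v + w) - A x (v + w)‖ ≤ 3 * K * ‖w‖ := by
      have : A x' (v + w) - A x (v + w) = t • A' x w (v + w) + R (v + w) := by rw [hA']; abel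
      rw [this]
      have e1 : ‖t • A' x w (v + w)‖ ≤ K * ‖w‖ := by
        rw [norm_smul, Real.norm_of_nonneg ht0]
        refine (mul_le_of_le_one_left (norm_nonneg _) ht1).trans ?_
        exact ((hA x hx _).2.1 w).trans (mul_le_of_le_one_right (by positivity) nvw)
      have e2 : ‖R (v + w)‖ ≤ K * (2 * ‖w‖) := n1.trans (by rw [sq]; gcongr)
      calc _ ≤ _ := norm_add_le _ _
        _ ≤ K * ‖w‖ + K * (2 * ‖w‖) := add_le_add e1 e2
        _ = 3 * K * ‖w‖ := by ring
    have b2 : ‖t • (A x' (v + w) - A x (v + w)) (A x w (u t))‖ ≤ 3 * K * ‖w‖ * (K * ‖w‖ * δ) :=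
      (nt _).trans (nap bdA bAw)
    have b3 : ‖t • A' x w w (u t)‖ ≤ K * ‖w‖ * ‖w‖ * δ :=
      (nt _).trans (nap ((hA x hx w).2.1 w) hu1)
    have b4 : ‖t • A x w (A x w (u t))‖ ≤ K * ‖w‖ * (K * ‖w‖ * δ) := (nt _).trans (nap nA bAw)
    rw [hid]
    refine (norm_add_le _ _).trans (add_le_add b0 ?_)
    calc _ ≤ K * ‖w‖ ^ 2 * δ + 3 * K * ‖w‖ * (K * ‖w‖ * δ) + K * ‖w‖ * ‖w‖ * δ
          + K * ‖w‖ * (K * ‖w‖ * δ) :=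
        norm_add_le_of_le (norm_add_le_of_le (norm_add_le_of_le b1 b2) b3) b4
      _ = _ := by ring
  have hfin := norm_le_of_hasDerivWithinAt (δ := 0) hder (by simp [hD, h0]) (by positivity) hbound 1
    (by simp)
  simpa [hD] using hfin

/-- The connection form with components `A 0`, `A 1`. -/
def connForm (A : Fin 2 → E2 → V →L[ℝ] V) (x v : E2) : V →L[ℝ] V := v 0 • A 0 x + v 1 • A 1 x

/-- The derivative of a parallel section. -/
def connDeriv (A : Fin 2 → E2 → V →L[ℝ] V) (x : E2) (u : V) : E2 →L[ℝ] V :=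
  (EuclideanSpace.proj 0 : E2 →L[ℝ] ℝ).smulRight (A 0 x u)
    + (EuclideanSpace.proj 1 : E2 →L[ℝ] ℝ).smulRight (A 1 x u)

lemma connDeriv_apply (A : Fin 2 → E2 → V →L[ℝ] V) (x : E2) (u : V) (v : E2) :
    connDeriv A x u v = connForm A x v u := rfl

variable {A : Fin 2 → E2 → V →L[ℝ] V} {x₀ : E2}

-- Frobenius' theorem by radial transport: W is defined by solving along rays from x₀, and
-- `radial_increment_bound` shows that its derivative is the connection form in all directions, not
-- only radially.
set_option maxHeartbeats 1000000 in
theorem exists_parallel [CompleteSpace V] {U : Set E2} (hU : IsOpen U) (hx₀ : x₀ ∈ U)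
    (hA : ∀ i, ContDiffOn ℝ ∞ (A i) U)
    (hflat : ∀ x ∈ U, fderiv ℝ (A 0) x (stdVec 1) - fderiv ℝ (A 1) x (stdVec 0)
      + (A 0 x ∘L A 1 x - A 1 x ∘L A 0 x) = 0) (w₀ : V) :
    ∃ ρ > 0, Metric.ball x₀ ρ ⊆ U ∧ ∃ W : E2 → V, W x₀ = w₀ ∧
      ∀ x ∈ Metric.ball x₀ ρ, HasFDerivAt W (connDeriv A x (W x)) x := by
  obtain ⟨r0, hr0, K0, hK0, hq0⟩ := exists_quadratic_bound ((hA 0).contDiffAt (hU.mem_nhds hx₀))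
  obtain ⟨r1, hr1, K1, hK1, hq1⟩ := exists_quadratic_bound ((hA 1).contDiffAt (hU.mem_nhds hx₀))
  obtain ⟨r2, hr2, hball⟩ := Metric.isOpen_iff.1 hU x₀ hx₀
  set K := K0 + K1 with hKd
  have hK : 0 < K := by positivity
  -- Besides staying in the domains of the bounds, the radius satisfies ρ ≤ 1 and Kρ ≤ 1/2, so that
  -- the connection form along a ray has norm at most 1/2.
  set ρ := min (min r2 (min r0 r1)) (min 1 (1 / (2 * K))) with hρd
  have hρ : 0 < ρ := by positivity
  have l0 : ρ ≤ r0 := (min_le_left _ _).trans ((min_le_right _ _).trans (min_le_left _ _))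
  have l1 : ρ ≤ r1 := (min_le_left _ _).trans ((min_le_right _ _).trans (min_le_right _ _))
  have l2 : ρ ≤ r2 := (min_le_left _ _).trans (min_le_left _ _)
  have l3 : ρ ≤ 1 := (min_le_right _ _).trans (min_le_left _ _)
  have l4 : K * ρ ≤ 1 / 2 := by
    have : ρ ≤ 1 / (2 * K) := (min_le_right _ _).trans (min_le_right _ _)
    calc K * ρ ≤ K * (1 / (2 * K)) := by gcongr
      _ = 1 / 2 := by field_simp
  have hsub : Metric.ball x₀ ρ ⊆ U := (Metric.ball_subset_ball l2).trans hball
  set A' : E2 → E2 → E2 → V →L[ℝ] V := fun x w v ↦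
    v 0 • fderiv ℝ (A 0) x w + v 1 • fderiv ℝ (A 1) x w with hA'd
  have comb : ∀ (v : E2) {S T : V →L[ℝ] V} {c : ℝ}, ‖S‖ ≤ K0 * c → ‖T‖ ≤ K1 * c →
      ‖v 0 • S + v 1 • T‖ ≤ K * c * ‖v‖ := by
    intro v S T c hS hT
    refine (norm_add_le _ _).trans ?_
    rw [norm_smul, norm_smul]
    calc _ ≤ ‖v‖ * (K0 * c) + ‖v‖ * (K1 * c) := by
          gcongr
          · exact PiLp.norm_apply_le v 0
          · exact PiLp.norm_apply_le v 1
      _ = _ := by rw [hKd]; ring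
  have hAb : ∀ x ∈ Metric.ball x₀ ρ, ∀ v, ‖connForm A x v‖ ≤ K * ‖v‖ ∧
      (∀ w, ‖A' x w v‖ ≤ K * ‖w‖ * ‖v‖) ∧ ∀ y ∈ Metric.ball x₀ ρ,
        ‖connForm A y v - connForm A x v - A' x (y - x) v‖ ≤ K * ‖y - x‖ ^ 2 * ‖v‖ := by
    intro x hx v
    obtain ⟨-, a0, b0, c0⟩ := hq0 x (Metric.ball_subset_ball l0 hx)
    obtain ⟨-, a1, b1, c1⟩ := hq1 x (Metric.ball_subset_ball l1 hx)
    refine ⟨?_, fun w ↦ comb v (b0 w) (b1 w), fun y hy ↦ ?_⟩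
    · have := comb v (S := A 0 x) (T := A 1 x) (c := 1) (by simpa using a0) (by simpa using a1)
      rwa [mul_one] at this
    · have := comb v (c0 y (Metric.ball_subset_ball l0 hy)) (c1 y (Metric.ball_subset_ball l1 hy))
      refine le_trans (le_of_eq (congrArg _ ?_)) this
      simp only [connForm, hA'd]
      module
  have hder : ∀ v w : E2, ∀ t : ℝ, x₀ + t • v ∈ Metric.ball x₀ ρ →
      HasDerivAt (fun s : ℝ ↦ connForm A (x₀ + s • v) w) (A' (x₀ + t • v) v w) t := by
    intro v w t hx
    have hc : HasDerivAt (fun s : ℝ ↦ x₀ + s • v) v t := by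
      simpa using ((hasDerivAt_id t).smul_const v).const_add x₀
    have d0 := (hq0 _ (Metric.ball_subset_ball l0 hx)).1.hasFDerivAt.comp_hasDerivAt t hc
    have d1 := (hq1 _ (Metric.ball_subset_ball l1 hx)).1.hasFDerivAt.comp_hasDerivAt t hc
    exact (d0.const_smul (w 0)).add (d1.const_smul (w 1))
  have hadd : ∀ x v w, connForm A x (v + w) = connForm A x v + connForm A x w := fun x v w ↦ by
    simp only [connForm, PiLp.add_apply]; module
  have hadd' : ∀ x w v v', A' x w (v + v') = A' x w v + A' x w v' := fun x w v v' ↦ by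
    simp only [hA'd, PiLp.add_apply]; module
  have hsmul' : ∀ x w v, ∀ t : ℝ, A' x (t • w) v = t • A' x w v := fun x w v t ↦ by
    simp only [hA'd, map_smul]; module
  have hfl : ∀ x ∈ Metric.ball x₀ ρ, ∀ v w : E2, A' x w v - A' x v w
      + (connForm A x v ∘L connForm A x w - connForm A x w ∘L connForm A x v) = 0 := by
    intro x hx v w
    have h := hflat x (hsub hx)
    -- The curvature is an alternating form in (v, w), so in the plane it is v ∧ w times its value
    -- on the basis.
    have e : A' x w v - A' x v w
      + (connForm A x v ∘L connForm A x w - connForm A x w ∘L connForm A x v)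
      = (v 0 * w 1 - v 1 * w 0) • (fderiv ℝ (A 0) x (stdVec 1) - fderiv ℝ (A 1) x (stdVec 0)
      + (A 0 x ∘L A 1 x - A 1 x ∘L A 0 x)) := by
      ext z
      simp only [hA'd, connForm]
      conv_lhs => rw [eq_sum_stdVec v, eq_sum_stdVec w]
      simp only [map_add, map_smul, add_apply, sub_apply, smul_apply,
        ContinuousLinearMap.comp_apply]
      simp [stdVec]
      module
    rw [e, h, smul_zero]
  have hmem : ∀ t ∈ Set.Icc (0 : ℝ) 1, ∀ z : E2, ‖z‖ < ρ → x₀ + t • z ∈ Metric.ball x₀ ρ := by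
    intro t ht z hz
    rw [mem_ball_iff_norm, add_sub_cancel_left, norm_smul, Real.norm_of_nonneg ht.1]
    exact (mul_le_of_le_one_left (norm_nonneg _) ht.2).trans_lt hz
  have hAh : ∀ z : E2, ‖z‖ < ρ → ∀ t ∈ Set.Icc (0 : ℝ) 1,
      ‖connForm A (x₀ + t • z) z‖ ≤ 1 / 2 := by
    intro z hz t ht
    refine (hAb _ (hmem t ht z hz) z).1.trans (le_trans ?_ l4)
    gcongr
  have hode : ∀ z : E2, ∃ u : ℝ → V, u 0 = w₀ ∧ (‖z‖ < ρ → ∀ t ∈ Set.Icc (0 : ℝ) 1,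
      HasDerivWithinAt u (connForm A (x₀ + t • z) z (u t)) (Set.Icc 0 1) t) := by
    intro z
    by_cases hz : ‖z‖ < ρ
    · have hc : ContinuousOn (fun t : ℝ ↦ connForm A (x₀ + t • z) z) (Set.Icc 0 1) := by
        have hl : ∀ i, ContinuousOn (fun t : ℝ ↦ A i (x₀ + t • z)) (Set.Icc 0 1) := fun i ↦
          (hA i).continuousOn.comp (by fun_prop) fun t ht ↦ hsub (hmem t ht z hz)
        exact ((hl 0).const_smul (z 0)).add ((hl 1).const_smul (z 1))
      obtain ⟨u, h1, h2⟩ := exists_linear_ode hc (hAh z hz) w₀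
      exact ⟨u, h1, fun _ ↦ h2⟩
    -- An arbitrary value for rays that leave the ball.
    · exact ⟨fun _ ↦ w₀, rfl, fun h ↦ absurd h hz⟩
  choose u hu0 hu using hode
  have hub : ∀ z : E2, ‖z‖ < ρ → ∀ t ∈ Set.Icc (0 : ℝ) 1, ‖u z t‖ ≤ 2 * ‖w₀‖ := by
    intro z hz t ht
    have := norm_le_of_hasDerivWithinAt (δ := ‖w₀‖) (ε := 0) (hu z hz) (by rw [hu0]) le_rfl
      (fun s hs ↦ ?_) t ht
    · simpa using this
    · rw [add_zero]
      exact ((connForm A _ z).le_opNorm _).trans (by gcongr; exact hAh z hz s hs)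
  refine ⟨ρ, hρ, hsub, fun x ↦ u (x - x₀) 1, ?_, fun x hx ↦ ?_⟩
  -- The ray to the centre is constant, so the transport along it does not move w₀.
  · have h0 : ‖(0 : E2)‖ < ρ := by simpa using hρ
    have := norm_image_sub_le_of_norm_deriv_le_segment_01' (C := 0) (hu 0 h0)
      (by simp [connForm])
    rw [hu0, norm_le_zero_iff, sub_eq_zero] at this
    simpa using this
  · have hv : ‖x - x₀‖ < ρ := by simpa [dist_eq_norm] using hx
    set v := x - x₀ with hvd
    set C := 2 * ((2 * K + 4 * K ^ 2) * (2 * ‖w₀‖)) with hC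
    refine hasFDerivAt_of_quadratic (C := C) ?_
    have hnear : ∀ᶠ w : E2 in nhds 0, ‖v + w‖ < ρ := by
      refine ContinuousAt.eventually_lt (f := fun w : E2 ↦ ‖v + w‖) (by fun_prop)
        continuousAt_const ?_
      simpa using hv
    filter_upwards [hnear] with w hw
    have hinc := radial_increment_bound hadd hadd' hsmul' hK (by positivity) hAb hder hfl l3 l4
      hv hw (u := u v) (u' := u (v + w)) (by rw [hu0, hu0]) (hu v hv) (hu _ hw) (hub v hv)
    have e1 : x + w - x₀ = v + w := by rw [hvd]; abel
    have e2 : x₀ + v = x := by rw [hvd]; abel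
    rw [e2] at hinc
    rw [e1, connDeriv_apply]
    refine hinc.trans (le_of_eq ?_)
    rw [hC]
    ring

/-- Bootstrapping: the derivative of W is a smooth expression in W, so each order of
differentiability yields the next. -/
theorem contDiffOn_of_parallel {U : Set E2} (hU : IsOpen U) (hA : ∀ i, ContDiffOn ℝ ∞ (A i) U)
    {W : E2 → V} (hW : ∀ x ∈ U, HasFDerivAt W (connDeriv A x (W x)) x) : ContDiffOn ℝ ∞ W U := by
  rw [contDiffOn_infty]
  intro n
  induction n with
  | zero =>
    exact contDiffOn_zero.2 fun x hx ↦ (hW x hx).continuousAt.continuousWithinAt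
  | succ n ih =>
    push_cast
    rw [contDiffOn_succ_iff_fderiv_of_isOpen hU]
    refine ⟨fun x hx ↦ (hW x hx).differentiableAt.differentiableWithinAt, by simp, ?_⟩
    have h1 : ∀ i, ContDiffOn ℝ n (fun x ↦ A i x (W x)) U := fun i ↦
      ((hA i).of_le (by exact_mod_cast (le_top : (n : ℕ∞) ≤ ⊤))).clm_apply ih
    have h2 : ContDiffOn ℝ n (fun x ↦ connDeriv A x (W x)) U :=
      (contDiffOn_const.smulRight (h1 0)).add (contDiffOn_const.smulRight (h1 1))
    exact h2.congr fun x hx ↦ (hW x hx).fderiv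

end flat

end TTSurface

namespace TTSurface

/-! ### Functions with Hessian `f γ` on a surface of curvature `-1` -/

/-- The continuous linear map with a given matrix. -/
def matCLM (m : Fin 3 → Fin 3 → ℝ) : (Fin 3 → ℝ) →L[ℝ] (Fin 3 → ℝ) :=
  ∑ a, ∑ b, m a b • (ContinuousLinearMap.proj b : (Fin 3 → ℝ) →L[ℝ] ℝ).smulRight
    (Pi.single a (1 : ℝ) : Fin 3 → ℝ)

lemma matCLM_apply (m : Fin 3 → Fin 3 → ℝ) (u : Fin 3 → ℝ) (a : Fin 3) :
    matCLM m u a = ∑ b, m a b * u b := by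
  simp only [matCLM, sum_apply, smul_apply, Finset.sum_apply, Pi.smul_apply,
    ContinuousLinearMap.smulRight_apply, ContinuousLinearMap.proj_apply, smul_eq_mul]
  rw [Finset.sum_eq_single a]
  · simp
  · intro c _ hc
    simp [hc.symm]
  · simp

lemma contDiffOn_matCLM {m : E2 → Fin 3 → Fin 3 → ℝ} {U : Set E2}
    (hm : ∀ a b, ContDiffOn ℝ ∞ (fun y ↦ m y a b) U) : ContDiffOn ℝ ∞ (fun y ↦ matCLM (m y)) U :=
  ContDiffOn.sum fun a _ ↦ ContDiffOn.sum fun b _ ↦ (hm a b).smul contDiffOn_const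

lemma fderiv_matCLM {m : E2 → Fin 3 → Fin 3 → ℝ} {x : E2}
    (hm : ∀ a b, DifferentiableAt ℝ (fun y ↦ m y a b) x) (k : Fin 2) :
    fderiv ℝ (fun y ↦ matCLM (m y)) x (stdVec k) = matCLM fun a b ↦ pd k (fun y ↦ m y a b) x := by
  have h : HasFDerivAt (fun y ↦ matCLM (m y)) (∑ a, ∑ b, (fderiv ℝ (fun y ↦ m y a b) x).smulRight
      ((ContinuousLinearMap.proj b : (Fin 3 → ℝ) →L[ℝ] ℝ).smulRight
        (Pi.single a (1 : ℝ) : Fin 3 → ℝ))) x :=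
    HasFDerivAt.fun_sum fun a _ ↦ HasFDerivAt.fun_sum fun b _ ↦
      HasFDerivAt.smul_const (F := (Fin 3 → ℝ) →L[ℝ] (Fin 3 → ℝ)) (hm a b).hasFDerivAt _
  rw [h.fderiv]
  simp only [sum_apply, ContinuousLinearMap.smulRight_apply, matCLM, pd]

/-- The matrices of the first order system for `(f, ∂₀ f, ∂₁ f)` expressing that the Hessian of
`f` is `f γ`. -/
def hessMat (γ : E2 → Mat) (i : Fin 2) (y : E2) : Fin 3 → Fin 3 → ℝ :=
  ![![0, if i = 0 then 1 else 0, if i = 1 then 1 else 0],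
    ![γ y i 0, chr γ 0 i 0 y, chr γ 1 i 0 y], ![γ y i 1, chr γ 0 i 1 y, chr γ 1 i 1 y]]

/-- The pairing `⟨df, df'⟩ - f f'` of two functions. -/
def hessPair (γ : E2 → Mat) (W W' : E2 → Fin 3 → ℝ) (y : E2) : ℝ :=
  (γ y)⁻¹ 0 0 * W y 1 * W' y 1 + (γ y)⁻¹ 0 1 * (W y 1 * W' y 2 + W y 2 * W' y 1)
    + (γ y)⁻¹ 1 1 * W y 2 * W' y 2 - W y 0 * W' y 0

namespace IsMetricOn

variable {γ : E2 → Mat} {U : Set E2} (hγ : IsMetricOn γ U)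
include hγ

lemma contDiffOn_hessMat (i : Fin 2) (a b : Fin 3) :
    ContDiffOn ℝ ∞ (fun y ↦ hessMat γ i y a b) U := by
  fin_cases a <;> fin_cases b <;>
    simp only [hessMat, Fin.zero_eta, Fin.mk_one, Fin.reduceFinMk, Fin.isValue,
      Matrix.cons_val] <;>
    first
      | exact contDiffOn_const
      | exact hγ.smooth _ _
      | exact hγ.contDiffOn_chr _ _ _

/-- The compatibility condition of the system. Its first row is symmetry of γ and of the Christoffel
symbols; the other two are the Ricci identity for df, which is compatible with Hess f = f γ because
K = -1. -/
lemma hessMat_flat (hK : ∀ y ∈ U, gc γ y = -1) {y : E2} (hy : y ∈ U) :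
    fderiv ℝ (fun y ↦ matCLM (hessMat γ 0 y)) y (stdVec 1)
      - fderiv ℝ (fun y ↦ matCLM (hessMat γ 1 y)) y (stdVec 0)
      + (matCLM (hessMat γ 0 y) ∘L matCLM (hessMat γ 1 y)
        - matCLM (hessMat γ 1 y) ∘L matCLM (hessMat γ 0 y)) = 0 := by
  have hd : ∀ i a b, DifferentiableAt ℝ (fun y ↦ hessMat γ i y a b) y := fun i a b ↦
    ContDiffOn.differentiableAt_of_isOpen hγ.isOpen (hγ.contDiffOn_hessMat i a b) hy
  rw [fderiv_matCLM (hd 0), fderiv_matCLM (hd 1)]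
  obtain ⟨m000, m001, m011⟩ := hγ.pd_metric hy 0
  obtain ⟨m100, m101, m111⟩ := hγ.pd_metric hy 1
  have s0 := hγ.chr_symm hy 0
  have s1 := hγ.chr_symm hy 1
  have hs := hγ.symm y hy
  have ms0 := hγ.pd_symm hy 0
  have ms1 := hγ.pd_symm hy 1
  obtain ⟨r00, r01, r10, r11⟩ := hγ.rc_eq hy
  rw [hK y hy] at r00 r01 r10 r11
  simp only [rc, Fin.sum_univ_two] at r00 r01 r10 r11
  refine ContinuousLinearMap.ext fun u ↦ funext fun a ↦ ?_
  simp only [add_apply, sub_apply, ContinuousLinearMap.comp_apply, Pi.add_apply, Pi.sub_apply,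
    matCLM_apply, Fin.sum_univ_three, zero_apply, Pi.zero_apply]
  fin_cases a
  · simp [hessMat, pd_const]
    rw [s0, s1, hs]
    ring
  · simp [hessMat]
    rw [m100, ms0, m001, hs, s0, s1]
    simp only [s0, s1] at r00 r10
    linear_combination (- u 1) * r00 - u 2 * r10
  · simp [hessMat]
    rw [m101, m011, hs, s0, s1]
    simp only [s0, s1] at r01 r11
    linear_combination (- u 1) * r01 - u 2 * r11

/-- `W` is the triple (f, ∂₀f, ∂₁f). Since the connection is flat, the 1-jet at `y₀` can be
prescribed freely. -/
theorem exists_hessian_solution (hK : ∀ y ∈ U, gc γ y = -1) {y₀ : E2} (hy₀ : y₀ ∈ U)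
    (w₀ : Fin 3 → ℝ) : ∃ ρ > 0, Metric.ball y₀ ρ ⊆ U ∧ ∃ W : E2 → Fin 3 → ℝ, W y₀ = w₀ ∧
      (∀ a, ContDiffOn ℝ ∞ (fun y ↦ W y a) (Metric.ball y₀ ρ)) ∧
      ∀ y ∈ Metric.ball y₀ ρ, ∀ i a,
        pd i (fun z ↦ W z a) y = ∑ b, hessMat γ i y a b * W y b := by
  have hA : ∀ i, ContDiffOn ℝ ∞ (fun y ↦ matCLM (hessMat γ i y)) U := fun i ↦
    contDiffOn_matCLM (hγ.contDiffOn_hessMat i)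
  obtain ⟨ρ, hρ, hsub, W, hW0, hW⟩ := exists_parallel (A := fun i y ↦ matCLM (hessMat γ i y))
    hγ.isOpen hy₀ hA (fun x hx ↦ hγ.hessMat_flat hK hx) w₀
  have hWs := contDiffOn_of_parallel Metric.isOpen_ball (fun i ↦ (hA i).mono hsub) hW
  refine ⟨ρ, hρ, hsub, W, hW0, fun a ↦ contDiffOn_pi.1 hWs a, fun y hy i a ↦ ?_⟩
  have h1 : HasFDerivAt (fun z ↦ W z a) ((ContinuousLinearMap.proj a : (Fin 3 → ℝ) →L[ℝ] ℝ) ∘L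
      connDeriv (fun i y ↦ matCLM (hessMat γ i y)) y (W y)) y :=
    (ContinuousLinearMap.proj (R := ℝ) (φ := fun _ : Fin 3 ↦ ℝ) a).hasFDerivAt.comp y (hW y hy)
  rw [pd, h1.fderiv, ContinuousLinearMap.comp_apply, connDeriv_apply, connForm,
    ContinuousLinearMap.proj_apply, ← matCLM_apply]
  fin_cases i <;> simp [stdVec]

/-- From ∇df = f γ one gets d⟨df, df'⟩ = f df' + f' df = d(f f'). Solutions are the restrictions of
linear functions to the hyperboloid, and this pairing is the Minkowski form on them. -/
lemma hessPair_const {y₀ : E2} {ρ : ℝ} (hsub : Metric.ball y₀ ρ ⊆ U) {W W' : E2 → Fin 3 → ℝ}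
    (hs : ∀ a, ContDiffOn ℝ ∞ (fun y ↦ W y a) (Metric.ball y₀ ρ))
    (hs' : ∀ a, ContDiffOn ℝ ∞ (fun y ↦ W' y a) (Metric.ball y₀ ρ))
    (hW : ∀ y ∈ Metric.ball y₀ ρ, ∀ i a,
      pd i (fun z ↦ W z a) y = ∑ b, hessMat γ i y a b * W y b)
    (hW' : ∀ y ∈ Metric.ball y₀ ρ, ∀ i a,
      pd i (fun z ↦ W' z a) y = ∑ b, hessMat γ i y a b * W' y b)
    {y : E2} (hy : y ∈ Metric.ball y₀ ρ) : hessPair γ W W' y = hessPair γ W W' y₀ := by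
  have hopen : IsOpen (Metric.ball y₀ ρ) := Metric.isOpen_ball
  have hy₀ : y₀ ∈ Metric.ball y₀ ρ := Metric.mem_ball_self (Metric.pos_of_mem_ball hy)
  have hd : ∀ z ∈ Metric.ball y₀ ρ, ∀ a, DifferentiableAt ℝ (fun y ↦ W y a) z := fun z hz a ↦
    ContDiffOn.differentiableAt_of_isOpen hopen (hs a) hz
  have hd' : ∀ z ∈ Metric.ball y₀ ρ, ∀ a, DifferentiableAt ℝ (fun y ↦ W' y a) z := fun z hz a ↦
    ContDiffOn.differentiableAt_of_isOpen hopen (hs' a) hz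
  have hi : ∀ z ∈ Metric.ball y₀ ρ, ∀ a b, DifferentiableAt ℝ (fun y ↦ (γ y)⁻¹ a b) z :=
    fun z hz ↦ hγ.differentiableAt_inv (hsub hz)
  have hdQ : ∀ z ∈ Metric.ball y₀ ρ, DifferentiableAt ℝ (hessPair γ W W') z := by
    intro z hz
    have d := hd z hz
    have d' := hd' z hz
    have i := hi z hz
    exact (((((i 0 0).fun_mul (d 1)).fun_mul (d' 1)).fun_add ((i 0 1).fun_mul
      (((d 1).fun_mul (d' 2)).fun_add ((d 2).fun_mul (d' 1))))).fun_add
      (((i 1 1).fun_mul (d 2)).fun_mul (d' 2))).fun_sub ((d 0).fun_mul (d' 0))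
  have hpd : ∀ z ∈ Metric.ball y₀ ρ, ∀ k, pd k (hessPair γ W W') z = 0 := by
    intro z hz k
    have d := hd z hz
    have d' := hd' z hz
    have i := hi z hz
    obtain ⟨p00, p01, p11⟩ := hγ.pd_inv_metric (hsub hz) k
    obtain ⟨i1, i2, i3, i4⟩ := hγ.inv_rel (hsub hz)
    have hsy := hγ.symm z (hsub hz)
    rw [show hessPair γ W W' = fun y ↦ (γ y)⁻¹ 0 0 * W y 1 * W' y 1
      + (γ y)⁻¹ 0 1 * (W y 1 * W' y 2 + W y 2 * W' y 1) + (γ y)⁻¹ 1 1 * W y 2 * W' y 2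
      - W y 0 * W' y 0 from rfl]
    rw [pd_sub (((((i 0 0).fun_mul (d 1)).fun_mul (d' 1)).fun_add ((i 0 1).fun_mul
        (((d 1).fun_mul (d' 2)).fun_add ((d 2).fun_mul (d' 1))))).fun_add
        (((i 1 1).fun_mul (d 2)).fun_mul (d' 2))) ((d 0).fun_mul (d' 0)),
      pd_add ((((i 0 0).fun_mul (d 1)).fun_mul (d' 1)).fun_add ((i 0 1).fun_mul
        (((d 1).fun_mul (d' 2)).fun_add ((d 2).fun_mul (d' 1)))))
        (((i 1 1).fun_mul (d 2)).fun_mul (d' 2)),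
      pd_add (((i 0 0).fun_mul (d 1)).fun_mul (d' 1)) ((i 0 1).fun_mul
        (((d 1).fun_mul (d' 2)).fun_add ((d 2).fun_mul (d' 1)))),
      pd_mul ((i 0 0).fun_mul (d 1)) (d' 1), pd_mul (i 0 0) (d 1),
      pd_mul (i 0 1) (((d 1).fun_mul (d' 2)).fun_add ((d 2).fun_mul (d' 1))),
      pd_add ((d 1).fun_mul (d' 2)) ((d 2).fun_mul (d' 1)), pd_mul (d 1) (d' 2),
      pd_mul (d 2) (d' 1), pd_mul ((i 1 1).fun_mul (d 2)) (d' 2), pd_mul (i 1 1) (d 2),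
      pd_mul (d 0) (d' 0)]
    simp only [hW z hz, hW' z hz, p00, p01, p11, Fin.sum_univ_three]
    fin_cases k
    · simp [hessMat]
      linear_combination (W z 0 * W' z 1 + W z 1 * W' z 0) * i1
        + (W z 0 * W' z 2 + W z 2 * W' z 0) * i2
    · simp [hessMat]
      rw [hsy]
      linear_combination (W z 0 * W' z 1 + W z 1 * W' z 0) * i3
        + (W z 0 * W' z 2 + W z 2 * W' z 0) * i4
  have hfd : ∀ z ∈ Metric.ball y₀ ρ, fderiv ℝ (hessPair γ W W') z = 0 := by
    intro z hz
    ext v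
    rw [fderiv_apply_eq_sum_pd, hpd z hz, hpd z hz]
    simp
  exact hopen.is_const_of_fderiv_eq_zero (convex_ball y₀ ρ).isPreconnected
    (fun z hz ↦ (hdQ z hz).differentiableWithinAt) hfd hy hy₀

end IsMetricOn

end TTSurface

namespace TTSurface

/-! ### Isothermal coordinates -/

lemma jac_ratio {f h : E2 → ℝ} {y : E2} (hf : DifferentiableAt ℝ f y) (hh : DifferentiableAt ℝ h y)
    (h0 : f y ≠ 0) (k : Fin 2) :
    jac (fun z ↦ WithLp.toLp 2 ![h z * (f z)⁻¹, (f z)⁻¹]) y 0 k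
        = (pd k h y * f y - h y * pd k f y) / f y ^ 2 ∧
      jac (fun z ↦ WithLp.toLp 2 ![h z * (f z)⁻¹, (f z)⁻¹]) y 1 k = - pd k f y / f y ^ 2 := by
  have hi : DifferentiableAt ℝ (fun z ↦ (f z)⁻¹) y := hf.inv h0
  constructor
  · simp only [jac, Matrix.of_apply, Matrix.cons_val_zero]
    rw [pd_mul hh hi, pd_inv hf h0]
    field_simp
    ring
  · simp only [jac, Matrix.of_apply, Matrix.cons_val_one, Matrix.cons_val_fin_one]
    rw [pd_inv hf h0]

/-- Take a solution f > 0 that is null for the pairing and a unit solution h orthogonal to it. Then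
|df|² = f², ⟨df, dh⟩ = f h and |dh|² = 1 + h², whence d(h/f) and d(1/f) are orthogonal, both of
squared length f⁻². These are the upper half-plane coordinates. -/
theorem IsMetricOn.exists_conformal_map {γ : E2 → Mat} {U : Set E2} (hγ : IsMetricOn γ U)
    (hK : ∀ y ∈ U, gc γ y = -1) {y₀ : E2} (hy₀ : y₀ ∈ U) :
    ∃ B : Set E2, IsOpen B ∧ y₀ ∈ B ∧ B ⊆ U ∧ ∃ φ : E2 → E2, ContDiffOn ℝ ∞ φ B ∧
      ∀ y ∈ B, ∃ s : ℝ, 0 < s ∧ jac φ y * (γ y)⁻¹ * (jac φ y).transpose = s • (1 : Mat) := by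
  have hP := (hγ.isPosMat hy₀).inv
  set a := (γ y₀)⁻¹ 0 0 with ha
  set b := (γ y₀)⁻¹ 0 1 with hb
  set c := (γ y₀)⁻¹ 1 1 with hc
  have ha0 : 0 < a := hP.pos
  have hD : 0 < a * c - b * b := hP.det_pos
  set z := √(a / (a * c - b * b)) with hz
  have hz2 : z ^ 2 * (a * c - b * b) = a := by
    rw [hz, Real.sq_sqrt (by positivity), div_mul_cancel₀ _ hD.ne']
  have hsa : √a ^ 2 = a := Real.sq_sqrt ha0.le
  have hsa0 : √a ≠ 0 := (Real.sqrt_pos.2 ha0).ne'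
  -- The 1-jets at `y₀`, with a, b, c the entries of the inverse metric: f = 1 with df of unit
  -- length, and h = 0 with dh of unit length and orthogonal to df. This fixes `z`.
  obtain ⟨ρ, hρ, hsub, W, hW0, hWs, hW⟩ := hγ.exists_hessian_solution hK hy₀ ![1, 1 / √a, 0]
  obtain ⟨ρ', hρ', hsub', W', hW0', hWs', hW'⟩ :=
    hγ.exists_hessian_solution hK hy₀ ![0, -(b * z / a), z]
  set R := min ρ ρ' with hR
  have hRρ : Metric.ball y₀ R ⊆ Metric.ball y₀ ρ := Metric.ball_subset_ball (min_le_left _ _)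
  have hRρ' : Metric.ball y₀ R ⊆ Metric.ball y₀ ρ' := Metric.ball_subset_ball (min_le_right _ _)
  have hRU : Metric.ball y₀ R ⊆ U := hRρ.trans hsub
  have hR0 : 0 < R := lt_min hρ hρ'
  have hs : ∀ a, ContDiffOn ℝ ∞ (fun y ↦ W y a) (Metric.ball y₀ R) := fun a ↦ (hWs a).mono hRρ
  have hs' : ∀ a, ContDiffOn ℝ ∞ (fun y ↦ W' y a) (Metric.ball y₀ R) := fun a ↦ (hWs' a).mono hRρ'
  have hw : ∀ y ∈ Metric.ball y₀ R, ∀ i a,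
    pd i (fun z ↦ W z a) y = ∑ b, hessMat γ i y a b * W y b := fun y hy ↦ hW y (hRρ hy)
  have hw' : ∀ y ∈ Metric.ball y₀ R, ∀ i a,
    pd i (fun z ↦ W' z a) y = ∑ b, hessMat γ i y a b * W' y b := fun y hy ↦ hW' y (hRρ' hy)
  -- Positivity of f holds at `y₀` but must be imposed nearby in order to divide by f.
  set B := Metric.ball y₀ R ∩ (fun y ↦ W y 0) ⁻¹' Set.Ioi 0 with hBd
  have hBo : IsOpen B := (hs 0).continuousOn.isOpen_inter_preimage Metric.isOpen_ball isOpen_Ioi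
  refine ⟨B, hBo, ⟨Metric.mem_ball_self hR0, ?_⟩, Set.inter_subset_left.trans hRU,
    fun y ↦ WithLp.toLp 2 ![W' y 0 * (W y 0)⁻¹, (W y 0)⁻¹], ?_, ?_⟩
  · simp [hW0]
  · have hinv : ContDiffOn ℝ ∞ (fun y ↦ (W y 0)⁻¹) B :=
      ((hs 0).mono Set.inter_subset_left).inv fun y hy ↦ (Set.mem_Ioi.1 hy.2).ne'
    rw [contDiffOn_euclidean]
    intro i
    fin_cases i
    · exact ((hs' 0).mono Set.inter_subset_left).mul hinv
    · exact hinv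
  · rintro y ⟨hy, hpos⟩
    have hpos : 0 < W y 0 := hpos
    have hf0 := hpos.ne'
    have q1 := hγ.hessPair_const hRU hs hs hw hw hy
    have q2 := hγ.hessPair_const hRU hs hs' hw hw' hy
    have q3 := hγ.hessPair_const hRU hs' hs' hw' hw' hy
    simp only [hessPair, hW0, hW0', ← ha, ← hb, ← hc, Matrix.cons_val] at q1 q2 q3
    have e1 : a * (1 / √a) * (1 / √a) + b * (1 / √a * 0 + 0 * (1 / √a)) + c * 0 * 0 - 1 * 1 = 0 := by
      field_simp
      linarith
    have e2 : a * (1 / √a) * -(b * z / a) + b * (1 / √a * z + 0 * -(b * z / a)) + c * 0 * z - 1 * 0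
        = 0 := by
      field_simp
      ring
    have e3 : a * -(b * z / a) * -(b * z / a) + b * (-(b * z / a) * z + z * -(b * z / a))
        + c * z * z - 0 * 0 = 1 := by
      have : a * -(b * z / a) * -(b * z / a) + b * (-(b * z / a) * z + z * -(b * z / a))
        + c * z * z - 0 * 0 = z ^ 2 * (a * c - b * b) / a := by
        field_simp
        ring
      rw [this, hz2, div_self ha0.ne']
    rw [e1] at q1
    rw [e2] at q2
    rw [e3] at q3
    have hdW : DifferentiableAt ℝ (fun y ↦ W y 0) y :=
      ContDiffOn.differentiableAt_of_isOpen Metric.isOpen_ball (hs 0) hy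
    have hdW' : DifferentiableAt ℝ (fun y ↦ W' y 0) y :=
      ContDiffOn.differentiableAt_of_isOpen Metric.isOpen_ball (hs' 0) hy
    have hp : ∀ k, pd k (fun y ↦ W y 0) y = W y (if k = 0 then 1 else 2) := by
      intro k
      rw [hw y hy]
      fin_cases k <;> simp [hessMat, Fin.sum_univ_three]
    have hp' : ∀ k, pd k (fun y ↦ W' y 0) y = W' y (if k = 0 then 1 else 2) := by
      intro k
      rw [hw' y hy]
      fin_cases k <;> simp [hessMat, Fin.sum_univ_three]
    obtain ⟨j00, j10⟩ := jac_ratio hdW hdW' hf0 0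
    obtain ⟨j01, j11⟩ := jac_ratio hdW hdW' hf0 1
    rw [hp, hp'] at j00 j01
    rw [hp] at j10 j11
    simp only [if_true, one_ne_zero, if_false] at j00 j01 j10 j11
    have hsy := hγ.inv_symm (hRU hy)
    refine ⟨(W y 0 ^ 2)⁻¹, by positivity, ?_⟩
    ext i j
    fin_cases i <;> fin_cases j <;>
      simp [Matrix.mul_apply, Fin.sum_univ_two, j00, j01, j10, j11, hsy] <;> field_simp
    · linear_combination (W y 0 ^ 2) * q3 - 2 * W y 0 * W' y 0 * q2 + W' y 0 ^ 2 * q1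
    · linear_combination - W y 0 * q2 + W' y 0 * q1
    · linear_combination - W y 0 * q2 + W' y 0 * q1
    · linear_combination q1

lemma isUnit_det_of_mul {J γ' : Mat} {s : ℝ} (hs : 0 < s) (h : J * γ' * J.transpose = s • (1 : Mat)) :
    J.det ≠ 0 := by
  intro h0
  have := congrArg Matrix.det h
  rw [Matrix.det_mul, Matrix.det_mul, h0, Matrix.det_smul] at this
  simp only [zero_mul, Fintype.card_fin, Matrix.det_one, mul_one] at this
  exact (pow_pos hs 2).ne this

lemma exists_equiv_fderiv {φ : E2 → E2} {y : E2} (hφ : DifferentiableAt ℝ φ y)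
    (h : (jac φ y).det ≠ 0) : ∃ L : E2 ≃L[ℝ] E2, HasFDerivAt φ (L : E2 →L[ℝ] E2) y := by
  have hd : (fderiv ℝ φ y).det ≠ 0 := by rwa [det_fderiv_eq hφ]
  refine ⟨(fderiv ℝ φ y).toContinuousLinearEquivOfDetNeZero hd, ?_⟩
  rw [ContinuousLinearMap.coe_toContinuousLinearEquivOfDetNeZero]
  exact hφ.hasFDerivAt

variable {M : Type*} [TopologicalSpace M] [ChartedSpace E2 M] [IsManifold 𝓘(ℝ, E2) ∞ M]

lemma isChart_trans {e : OpenPartialHomeomorph M E2} (he : IsChart e)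
    {Φ : OpenPartialHomeomorph E2 E2} (h1 : ContDiffOn ℝ ∞ Φ Φ.source)
    (h2 : ContDiffOn ℝ ∞ Φ.symm Φ.target) : IsChart (e ≫ₕ Φ) := by
  have hΦ : Φ ∈ contDiffGroupoid ∞ 𝓘(ℝ, E2) := by
    rw [contDiffGroupoid, mem_groupoid_of_pregroupoid]
    simp only [contDiffPregroupoid, mfld_simps]
    exact ⟨h1, h2⟩
  intro a ha
  obtain ⟨l, r⟩ := he a ha
  refine ⟨?_, ?_⟩
  · rw [OpenPartialHomeomorph.trans_symm_eq_symm_trans_symm, OpenPartialHomeomorph.trans_assoc]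
    exact StructureGroupoid.trans _ (StructureGroupoid.symm _ hΦ) l
  · rw [← OpenPartialHomeomorph.trans_assoc]
    exact StructureGroupoid.trans _ r hΦ

/-- The metric is a multiple of the Euclidean metric in the chart `e`. -/
def IsIsothermal (g : Metric M) (e : OpenPartialHomeomorph M E2) : Prop :=
  IsChart e ∧ ∀ y ∈ e.target, ∃ s : ℝ, 0 < s ∧ rep g.inner e y = s • (1 : Mat)

/-- The conformal map has invertible differential, so by the inverse function theorem it may be
composed with the chart to give a new chart, in which the inverse metric, and hence the metric, is a
multiple of the identity. -/
theorem exists_isothermal {G : Metric M} (hG : IsHyperbolic G) (x : M) :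
    ∃ e : OpenPartialHomeomorph M E2, IsIsothermal G e ∧ x ∈ e.source := by
  set e := chartAt E2 x with hed
  have he : IsChart e := isChart_chartAt x
  have hx : x ∈ e.source := mem_chart_source E2 x
  have hγ := Metric.isMetricOn he G
  have hK : ∀ y ∈ e.target, gc (rep G.inner e) y = -1 := fun y hy ↦ by
    have := gc_eq_gaussCurvature G he (e.map_target hy)
    rwa [e.right_inv hy, hG] at this
  obtain ⟨B, hBo, hyB, hBU, φ, hφ, hc⟩ := hγ.exists_conformal_map hK (e.map_source hx)
  have hdet : ∀ y ∈ B, (jac φ y).det ≠ 0 := fun y hy ↦ by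
    obtain ⟨s, hs, h⟩ := hc y hy
    exact isUnit_det_of_mul hs h
  have hφa : ∀ y ∈ B, ContDiffAt ℝ ∞ φ y := fun y hy ↦ hφ.contDiffAt (hBo.mem_nhds hy)
  obtain ⟨L, hL⟩ := exists_equiv_fderiv ((hφa _ hyB).differentiableAt (by simp)) (hdet _ hyB)
  set Φ₀ := (hφa _ hyB).toOpenPartialHomeomorph φ hL (by simp) with hΦ₀
  set Φ := Φ₀.restrOpen B hBo with hΦ
  have hΦc : ∀ y, Φ y = φ y := fun y ↦ rfl
  have hΦs : Φ.source ⊆ B := by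
    rw [hΦ, OpenPartialHomeomorph.restrOpen_source]
    exact Set.inter_subset_right
  have hmem : e x ∈ Φ.source := by
    rw [hΦ, OpenPartialHomeomorph.restrOpen_source]
    exact ⟨(hφa _ hyB).mem_toOpenPartialHomeomorph_source hL (by simp), hyB⟩
  have hsm : ContDiffOn ℝ ∞ Φ.symm Φ.target := by
    intro y hy
    have hs := hΦs (Φ.map_target hy)
    obtain ⟨L', hL'⟩ := exists_equiv_fderiv ((hφa _ hs).differentiableAt (by simp)) (hdet _ hs)
    exact (Φ.contDiffAt_symm hy hL' (hφa _ hs)).contDiffWithinAt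
  have he' : IsChart (e ≫ₕ Φ) := isChart_trans he (hφ.mono hΦs) hsm
  have hsrc : x ∈ (e ≫ₕ Φ).source := by
    rw [OpenPartialHomeomorph.trans_source]
    exact ⟨hx, hmem⟩
  refine ⟨e ≫ₕ Φ, ⟨he', fun y' hy' ↦ ?_⟩, hsrc⟩
  set x' := (e ≫ₕ Φ).symm y' with hx'
  have hx's : x' ∈ (e ≫ₕ Φ).source := (e ≫ₕ Φ).map_target hy'
  have hx'e : x' ∈ e.source := by
    rw [OpenPartialHomeomorph.trans_source] at hx's
    exact hx's.1
  have hx'B : e x' ∈ B := by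
    rw [OpenPartialHomeomorph.trans_source] at hx's
    exact hΦs hx's.2
  have hyt : e x' ∈ transSource e (e ≫ₕ Φ) := mem_transSource hx'e hx's
  have hT : ∀ z ∈ transSource e (e ≫ₕ Φ), transMap e (e ≫ₕ Φ) z = φ z := fun z hz ↦ by
    change φ (e (e.symm z)) = φ z
    rw [e.right_inv hz.1]
  have hj : jac (transMap e (e ≫ₕ Φ)) (e x') = jac φ (e x') := by
    ext a b
    exact pd_congr_of_isOpen (isOpen_transSource _ _) hyt fun z hz ↦ by rw [hT z hz]
  have hr := rep_trans he he' G.inner hyt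
  rw [hj] at hr
  have ht : transMap e (e ≫ₕ Φ) (e x') = y' := by
    rw [transMap, e.left_inv hx'e, hx', (e ≫ₕ Φ).right_inv hy']
  rw [ht] at hr
  obtain ⟨s, hs, h⟩ := hc _ hx'B
  have hd := hdet _ hx'B
  rw [hr, inv_congr] at h
  have hdt : (jac φ (e x')).transpose.det ≠ 0 := by rwa [Matrix.det_transpose]
  have h' : (rep G.inner (e ≫ₕ Φ) y')⁻¹ = s • (1 : Mat) := by
    rw [← h, ← Matrix.mul_assoc, ← Matrix.mul_assoc, mul_inv_of_det_ne hd, Matrix.one_mul,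
      Matrix.mul_assoc, ← Matrix.transpose_mul, mul_inv_of_det_ne hd, Matrix.transpose_one,
      Matrix.mul_one]
  have hdG : (rep G.inner (e ≫ₕ Φ) y').det ≠ 0 :=
    ((Metric.isMetricOn he' G).det_pos' hy').ne'
  refine ⟨s⁻¹, inv_pos.2 hs, ?_⟩
  have h3 := mul_inv_of_det_ne hdG
  rw [h', Matrix.mul_smul, Matrix.mul_one] at h3
  rw [← h3, smul_smul, inv_mul_cancel₀ hs.ne', one_smul]

lemma IsIsothermal.of_conformal {g G : Metric M} {u : M → ℝ}
    (hG : ∀ x, G.inner x = Real.exp (2 * u x) • g.inner x) {e : OpenPartialHomeomorph M E2}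
    (he : IsIsothermal G e) : IsIsothermal g e := by
  refine ⟨he.1, fun y hy ↦ ?_⟩
  obtain ⟨s, hs, h⟩ := he.2 y hy
  rw [rep_conformal hG] at h
  refine ⟨(Real.exp (2 * u (e.symm y)))⁻¹ * s, by positivity, ?_⟩
  rw [mul_smul, ← h, smul_smul, inv_mul_cancel₀ (Real.exp_pos _).ne', one_smul]

end TTSurface

namespace TTSurface

open MeasureTheory Filter Topology

/-! ### A Weyl lemma for the trace-free part of the Lie derivative -/

/-- A smooth step from `0` on `(-∞, 1/2]` to `1` on `[1, ∞)`. -/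
def smoothStep (t : ℝ) : ℝ := Real.smoothTransition (2 * t - 1)

lemma contDiff_smoothStep : ContDiff ℝ ∞ smoothStep :=
  Real.smoothTransition.contDiff.comp ((contDiff_const.mul contDiff_id).sub contDiff_const)

lemma differentiable_smoothStep : Differentiable ℝ smoothStep :=
  contDiff_smoothStep.differentiable (by simp)

lemma smoothStep_of_le {t : ℝ} (h : t ≤ 1 / 2) : smoothStep t = 0 :=
  Real.smoothTransition.zero_of_nonpos (by linarith)

lemma smoothStep_of_ge {t : ℝ} (h : 1 ≤ t) : smoothStep t = 1 :=
  Real.smoothTransition.one_of_one_le (by linarith)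

lemma deriv_smoothStep_nonneg (t : ℝ) : 0 ≤ deriv smoothStep t := by
  have : Monotone smoothStep := fun a b h ↦ Real.smoothTransition.monotone (by linarith)
  exact this.deriv_nonneg

lemma deriv_smoothStep_of_gt {t : ℝ} (h : 1 < t) : deriv smoothStep t = 0 := by
  have : smoothStep =ᶠ[𝓝 t] fun _ ↦ 1 := by
    filter_upwards [Ioi_mem_nhds h] with s hs using smoothStep_of_ge (le_of_lt hs)
  rw [this.deriv_eq, deriv_const]

lemma contDiff_deriv_smoothStep : ContDiff ℝ ∞ (deriv smoothStep) :=
  (contDiff_infty_iff_deriv.1 contDiff_smoothStep).2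

lemma exists_deriv_smoothStep_pos : ∃ t, 0 < t ∧ 0 < deriv smoothStep t := by
  obtain ⟨t, ht, h⟩ := exists_deriv_eq_slope smoothStep (a := 0) (b := 1) one_pos
    differentiable_smoothStep.continuous.continuousOn differentiable_smoothStep.differentiableOn
  rw [smoothStep_of_ge le_rfl, smoothStep_of_le (by norm_num)] at h
  exact ⟨t, ht.1, by rw [h]; norm_num⟩

/-- The radial mollifier at scale `ε` (not normalised). -/
def mollifier (ε : ℝ) (z : E2) : ℝ := (ε ^ 2)⁻¹ * deriv smoothStep (‖z‖ ^ 2 / ε ^ 2)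

lemma mollifier_nonneg (ε : ℝ) (z : E2) : 0 ≤ mollifier ε z :=
  mul_nonneg (by positivity) (deriv_smoothStep_nonneg _)

lemma contDiff_mollifier (ε : ℝ) : ContDiff ℝ ∞ (mollifier ε) :=
  contDiff_const.mul (contDiff_deriv_smoothStep.comp ((contDiff_norm_sq ℝ).div_const _))

lemma mollifier_eq_zero {ε : ℝ} (hε : 0 < ε) {z : E2} (h : ε < ‖z‖) : mollifier ε z = 0 := by
  rw [mollifier, deriv_smoothStep_of_gt, mul_zero]
  rw [lt_div_iff₀ (by positivity), one_mul]
  exact pow_lt_pow_left₀ h hε.le two_ne_zero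

lemma mollifier_neg (ε : ℝ) (z : E2) : mollifier ε (-z) = mollifier ε z := by
  simp [mollifier]

lemma support_mollifier {ε : ℝ} (hε : 0 < ε) :
    Function.support (mollifier ε) ⊆ Metric.closedBall 0 ε := by
  intro z hz
  by_contra h
  rw [mem_closedBall_zero_iff, not_le] at h
  exact hz (mollifier_eq_zero hε h)

lemma hasCompactSupport_mollifier {ε : ℝ} (hε : 0 < ε) : HasCompactSupport (mollifier ε) :=
  HasCompactSupport.of_support_subset_isCompact (isCompact_closedBall 0 ε) (support_mollifier hε)

lemma exists_mollifier_le : ∃ C, ∀ z, mollifier 1 z ≤ C := by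
  obtain ⟨C, hC⟩ := (hasCompactSupport_mollifier one_pos).exists_bound_of_continuous
    (contDiff_mollifier 1).continuous
  exact ⟨C, fun z ↦ (le_abs_self _).trans (hC z)⟩

lemma mollifier_eq {ε : ℝ} (hε : 0 < ε) (z : E2) :
    mollifier ε z = (ε ^ 2)⁻¹ * mollifier 1 (ε⁻¹ • z) := by
  rw [mollifier, mollifier, norm_smul, Real.norm_of_nonneg (inv_nonneg.2 hε.le)]
  congr 2
  · simp
    congr 1
    field_simp

/-- The integral of the mollifiers. -/
def mollifierMass : ℝ := ∫ z, mollifier 1 z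

lemma mollifierMass_pos : 0 < mollifierMass := by
  obtain ⟨t, ht, h⟩ := exists_deriv_smoothStep_pos
  refine (contDiff_mollifier 1).continuous.integral_pos_of_hasCompactSupport_nonneg_nonzero
    (hasCompactSupport_mollifier one_pos) (fun z ↦ mollifier_nonneg 1 z)
    (x := EuclideanSpace.single 0 (√t)) ?_
  have : ‖(EuclideanSpace.single 0 (√t) : E2)‖ ^ 2 / 1 ^ 2 = t := by
    simp [Real.sq_sqrt ht.le]
  rw [mollifier, this]
  simp [h.ne']

lemma integral_mollifier {ε : ℝ} (hε : 0 < ε) (x : E2) :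
    ∫ z, mollifier ε (z - x) = mollifierMass := by
  rw [integral_sub_right_eq_self (mollifier ε) x]
  simp_rw [mollifier_eq hε]
  rw [integral_const_mul, Measure.integral_comp_inv_smul_of_nonneg _ _ hε.le,
    finrank_euclideanSpace_fin, smul_eq_mul, ← mul_assoc, inv_mul_cancel₀ (by positivity), one_mul,
    mollifierMass]

/-- A mean value property implies smoothness: if mollification at x does not depend on the scale,
letting δ → 0 at Lebesgue points identifies f almost everywhere with its mollification at the fixed
scale ε₀. -/
theorem ae_eq_contDiff_of_integral_mollifier_eq {f : E2 → ℝ} (hf : Integrable f) {U : Set E2}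
    (hU : MeasurableSet U) {ε₀ : ℝ} (hε₀ : 0 < ε₀)
    (h : ∀ x ∈ U, ∀ δ, 0 < δ → δ < ε₀ →
      ∫ y, f y * mollifier ε₀ (y - x) = ∫ y, f y * mollifier δ (y - x)) :
    ∃ F : E2 → ℝ, ContDiff ℝ ∞ F ∧ f =ᵐ[volume.restrict U] F := by
  have hconv : ContDiff ℝ ∞ (convolution f (mollifier ε₀) (ContinuousLinearMap.mul ℝ ℝ) volume) :=
    HasCompactSupport.contDiff_convolution_right _ (hasCompactSupport_mollifier hε₀)
      hf.locallyIntegrable (contDiff_mollifier ε₀)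
  refine ⟨fun x ↦ mollifierMass⁻¹ * ∫ y, f y * mollifier ε₀ (y - x), ?_, ?_⟩
  · have hx : (fun x ↦ ∫ y, f y * mollifier ε₀ (y - x))
        = convolution f (mollifier ε₀) (ContinuousLinearMap.mul ℝ ℝ) volume := by
      funext x
      rw [convolution_def]
      refine integral_congr_ae (.of_forall fun y ↦ ?_)
      simp only [ContinuousLinearMap.mul_apply']
      rw [← mollifier_neg, neg_sub]
    rw [← hx] at hconv
    exact contDiff_const.mul hconv
  · rw [Filter.EventuallyEq, ae_restrict_iff' hU]
    obtain ⟨C, hC⟩ := exists_mollifier_le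
    filter_upwards [IsUnifLocDoublingMeasure.ae_tendsto_average_norm_sub (μ := (volume : Measure E2))
      hf.locallyIntegrable 1] with x hx hxU
    -- The Lebesgue point property along balls centred at x. The mollifiers are bounded by a
    -- multiple of the normalized indicator of these balls, so their averages converge too.
    have hlim := hx (l := 𝓝[>] (0 : ℝ)) (fun _ ↦ x) id tendsto_id (by
      filter_upwards [self_mem_nhdsWithin] with δ hδ
      simpa using le_of_lt hδ)
    have hvol : ∀ δ : ℝ, 0 < δ → (volume : Measure E2).real (Metric.closedBall x δ)
        = δ ^ 2 * (volume : Measure E2).real (Metric.closedBall 0 1) := by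
      intro δ hδ
      rw [Measure.addHaar_real_closedBall' _ _ hδ.le, finrank_euclideanSpace_fin]
    have hV : 0 < (volume : Measure E2).real (Metric.closedBall 0 1) :=
      ENNReal.toReal_pos (Metric.measure_closedBall_pos volume 0 one_pos).ne'
        measure_closedBall_lt_top.ne
    have h1 : Tendsto (fun δ : ℝ ↦ ∫ y, (mollifierMass⁻¹ * mollifier δ (y - x)) • f y)
        (𝓝[>] 0) (𝓝 (f x)) := by
      refine tendsto_integral_smul_of_tendsto_average_norm_sub
        (mollifierMass⁻¹ * C * (volume : Measure E2).real (Metric.closedBall 0 1)) hlim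
        (.of_forall fun δ ↦ hf.integrableOn) ?_ ?_ ?_
      · refine tendsto_const_nhds.congr' ?_
        filter_upwards [self_mem_nhdsWithin] with δ hδ
        rw [integral_const_mul, integral_mollifier hδ, inv_mul_cancel₀ mollifierMass_pos.ne']
      · filter_upwards [self_mem_nhdsWithin] with δ hδ y hy
        have := support_mollifier hδ (right_ne_zero_of_mul hy)
        rwa [mem_closedBall_zero_iff, ← dist_eq_norm] at this
      · filter_upwards [self_mem_nhdsWithin] with δ hδ y
        have hδ' : (0 : ℝ) < δ := hδ
        simp only [id]
        rw [hvol δ hδ, mul_div_mul_right _ _ hV.ne', abs_of_nonneg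
          (mul_nonneg (inv_nonneg.2 mollifierMass_pos.le) (mollifier_nonneg _ _)), mollifier_eq hδ,
          mul_div_assoc]
        refine mul_le_mul_of_nonneg_left ?_ (inv_nonneg.2 mollifierMass_pos.le)
        rw [div_eq_inv_mul]
        exact mul_le_mul_of_nonneg_left (hC _) (by positivity)
    have h2 : Tendsto (fun δ : ℝ ↦ ∫ y, (mollifierMass⁻¹ * mollifier δ (y - x)) • f y)
        (𝓝[>] 0) (𝓝 (mollifierMass⁻¹ * ∫ y, f y * mollifier ε₀ (y - x))) := by
      refine tendsto_const_nhds.congr' ?_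
      filter_upwards [Ioo_mem_nhdsGT hε₀] with δ hδ
      rw [h x hxU δ hδ.1 hδ.2, ← integral_const_mul]
      refine integral_congr_ae (.of_forall fun y ↦ ?_)
      simp only [smul_eq_mul]
      ring
    exact tendsto_nhds_unique h1 h2

/-- The difference of two steps at the scales `ε` and `δ`, divided by the argument. -/
def stepQuot (ε δ σ : ℝ) : ℝ := (smoothStep (σ / ε ^ 2) - smoothStep (σ / δ ^ 2)) * σ⁻¹

section stepQuot

variable {ε δ : ℝ} (hδ : 0 < δ) (hε : δ < ε)
include hδ hε

lemma stepQuot_of_lt {σ : ℝ} (h : σ < δ ^ 2 / 2) : stepQuot ε δ σ = 0 := by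
  have h1 : σ / δ ^ 2 ≤ 1 / 2 := by
    rw [div_le_iff₀ (by positivity)]; linarith
  have h2 : σ / ε ^ 2 ≤ 1 / 2 := by
    have := pow_lt_pow_left₀ hε hδ.le two_ne_zero
    rw [div_le_iff₀ ((pow_pos hδ 2).trans this)]; linarith
  rw [stepQuot, smoothStep_of_le h1, smoothStep_of_le h2, sub_self, zero_mul]

lemma stepQuot_of_ge {σ : ℝ} (h : ε ^ 2 ≤ σ) : stepQuot ε δ σ = 0 := by
  have h3 := pow_lt_pow_left₀ hε hδ.le two_ne_zero
  have h1 : 1 ≤ σ / δ ^ 2 := by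
    rw [le_div_iff₀ (by positivity)]; linarith
  have h2 : 1 ≤ σ / ε ^ 2 := by
    rw [le_div_iff₀ ((pow_pos hδ 2).trans h3)]; linarith
  rw [stepQuot, smoothStep_of_ge h1, smoothStep_of_ge h2, sub_self, zero_mul]

/-- The factor σ⁻¹ is harmless since both steps vanish near σ = 0. -/
lemma contDiff_stepQuot : ContDiff ℝ ∞ (stepQuot ε δ) := by
  rw [contDiff_iff_contDiffAt]
  intro σ
  rcases lt_or_ge σ (δ ^ 2 / 2) with h | h
  · refine (contDiffAt_const (c := (0 : ℝ))).congr_of_eventuallyEq ?_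
    filter_upwards [Iio_mem_nhds h] with s hs using stepQuot_of_lt hδ hε hs
  · have h0 : σ ≠ 0 := (lt_of_lt_of_le (by positivity) h).ne'
    exact (((contDiff_smoothStep.comp (contDiff_id.div_const _)).sub
      (contDiff_smoothStep.comp (contDiff_id.div_const _))).contDiffAt).mul (contDiffAt_inv ℝ h0)

/-- For k the step quotient, σ k(σ) is the difference of two steps, so (σ k)' is the difference of
the two mollifier profiles. This makes differences of mollifiers first-order expressions in
compactly supported fields. -/
lemma deriv_stepQuot (σ : ℝ) : deriv (stepQuot ε δ) σ * σ + stepQuot ε δ σ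
    = (ε ^ 2)⁻¹ * deriv smoothStep (σ / ε ^ 2) - (δ ^ 2)⁻¹ * deriv smoothStep (σ / δ ^ 2) := by
  have hq : (fun s ↦ stepQuot ε δ s * s)
      = fun s ↦ smoothStep (s / ε ^ 2) - smoothStep (s / δ ^ 2) := by
    funext s
    rcases eq_or_ne s 0 with rfl | hs
    · simp
    · rw [stepQuot, mul_assoc, inv_mul_cancel₀ hs, mul_one]
  have h1 : HasDerivAt (fun s ↦ stepQuot ε δ s * s)
      (deriv (stepQuot ε δ) σ * σ + stepQuot ε δ σ * 1) σ :=
    (((contDiff_stepQuot hδ hε).differentiable (by simp)) σ).hasDerivAt.mul (hasDerivAt_id σ)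
  have hs : ∀ a : ℝ, HasDerivAt (fun s ↦ smoothStep (s / a)) (deriv smoothStep (σ / a) * (1 / a)) σ :=
    fun a ↦ HasDerivAt.comp (h₂ := smoothStep) (h := fun s : ℝ ↦ s / a) σ
      (differentiable_smoothStep (σ / a)).hasDerivAt ((hasDerivAt_id σ).div_const a)
  have h2 := (hs (ε ^ 2)).sub (hs (δ ^ 2))
  rw [hq] at h1
  have := h1.unique h2
  rw [mul_one] at this
  rw [this]
  ring

end stepQuot

lemma norm_sub_sq_eq (x y : E2) : ‖y - x‖ ^ 2 = (y 0 - x 0) ^ 2 + (y 1 - x 1) ^ 2 := by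
  rw [EuclideanSpace.norm_sq_eq]
  simp [Fin.sum_univ_two]

lemma pd_coord_sub (x y : E2) (i j : Fin 2) :
    pd i (fun z : E2 ↦ z j - x j) y = if j = i then 1 else 0 := by
  have h : HasFDerivAt (fun z : E2 ↦ z j - x j) (EuclideanSpace.proj j : E2 →L[ℝ] ℝ) y :=
    (EuclideanSpace.proj j : E2 →L[ℝ] ℝ).hasFDerivAt.sub_const _
  rw [pd, h.fderiv]
  simp

lemma pd_comp_norm_sub_sq {k : ℝ → ℝ} (hk : Differentiable ℝ k) (x y : E2) (i : Fin 2) :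
    pd i (fun z ↦ k (‖z - x‖ ^ 2)) y = deriv k (‖y - x‖ ^ 2) * (2 * (y i - x i)) := by
  have h : HasFDerivAt (fun z : E2 ↦ ‖z - x‖ ^ 2) (2 • (innerSL ℝ (y - x))) y := by
    have := (hasStrictFDerivAt_norm_sq (y - x)).hasFDerivAt.comp y
      ((hasFDerivAt_id y).sub_const x)
    rwa [ContinuousLinearMap.comp_id] at this
  have h2 := (hk (‖y - x‖ ^ 2)).hasDerivAt.comp_hasFDerivAt y h
  rw [pd, show (fun z : E2 ↦ k (‖z - x‖ ^ 2)) = k ∘ fun z : E2 ↦ ‖z - x‖ ^ 2 from rfl, h2.fderiv]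
  simp [EuclideanSpace.inner_single_right]

section testFields

variable {k : ℝ → ℝ} (hk : ContDiff ℝ ∞ k) (x : E2)
include hk

lemma contDiff_coord_mul (i : Fin 2) : ContDiff ℝ ∞ fun y : E2 ↦ (y i - x i) * k (‖y - x‖ ^ 2) :=
  ((contDiff_euclidean.1 contDiff_id i).sub contDiff_const).mul
    (hk.comp ((contDiff_norm_sq ℝ).comp (contDiff_id.sub contDiff_const)))

lemma pd_coord_mul (y : E2) (i j : Fin 2) :
    pd i (fun y : E2 ↦ (y j - x j) * k (‖y - x‖ ^ 2)) y
      = (if j = i then 1 else 0) * k (‖y - x‖ ^ 2)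
        + (y j - x j) * (deriv k (‖y - x‖ ^ 2) * (2 * (y i - x i))) := by
  rw [pd_mul, pd_coord_sub, pd_comp_norm_sub_sq (hk.differentiable (by simp))]
  · exact (((contDiff_euclidean.1 contDiff_id j).sub contDiff_const).differentiable (n := ∞)
      (by simp)) y
  · exact ((hk.comp ((contDiff_norm_sq ℝ).comp (contDiff_id.sub contDiff_const))).differentiable
      (by simp)) y

end testFields

/-- **Weyl lemma**: distributional solutions of the system adjoint to
`ξ ↦ (∂₀ξ⁰ - ∂₁ξ¹, ∂₀ξ¹ + ∂₁ξ⁰)` are smooth. -/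
theorem weyl_lemma {y₀ : E2} {R : ℝ} (hR : 0 < R) {p q : E2 → ℝ}
    (hp : IntegrableOn p (Metric.ball y₀ R)) (hq : IntegrableOn q (Metric.ball y₀ R))
    (h : ∀ ξ : E2 → E2, (∀ i, ContDiff ℝ ∞ fun y ↦ ξ y i) → HasCompactSupport ξ →
      tsupport ξ ⊆ Metric.ball y₀ R →
      ∫ y in Metric.ball y₀ R, (p y * (pd 0 (fun z ↦ ξ z 0) y - pd 1 (fun z ↦ ξ z 1) y)
        + q y * (pd 0 (fun z ↦ ξ z 1) y + pd 1 (fun z ↦ ξ z 0) y)) = 0) :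
    (∃ P : E2 → ℝ, ContDiff ℝ ∞ P ∧ p =ᵐ[volume.restrict (Metric.ball y₀ (R / 2))] P) ∧
      ∃ Q : E2 → ℝ, ContDiff ℝ ∞ Q ∧ q =ᵐ[volume.restrict (Metric.ball y₀ (R / 2))] Q := by
  have hB : MeasurableSet (Metric.ball y₀ R) := Metric.isOpen_ball.measurableSet
  have hB2 : MeasurableSet (Metric.ball y₀ (R / 2)) := Metric.isOpen_ball.measurableSet
  have hsub : Metric.ball y₀ (R / 2) ⊆ Metric.ball y₀ R := Metric.ball_subset_ball (by linarith)
  -- Test fields centred in the half ball and supported within distance R/4 stay inside the full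
  -- ball.
  have hR4 : 0 < R / 4 := by positivity
  -- It remains to show that f annihilates the difference of any two mollifiers; the factor 2 is the
  -- one produced by the test fields below.
  have key : ∀ f : E2 → ℝ, IntegrableOn f (Metric.ball y₀ R) →
      (∀ x ∈ Metric.ball y₀ (R / 2), ∀ δ, 0 < δ → δ < R / 4 → ∫ y in Metric.ball y₀ R, f y *
        (2 * (mollifier (R / 4) (y - x) - mollifier δ (y - x))) = 0) →
      ∃ P : E2 → ℝ, ContDiff ℝ ∞ P ∧ f =ᵐ[volume.restrict (Metric.ball y₀ (R / 2))] P := by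
    intro f hf hfx
    obtain ⟨P, hP, hfP⟩ := ae_eq_contDiff_of_integral_mollifier_eq
      (f := (Metric.ball y₀ R).indicator f) ((integrable_indicator_iff hB).2 hf) hB2 hR4 (by
        intro x hx δ hδ hδR
        have hint : ∀ ε : ℝ, 0 < ε →
            Integrable fun y ↦ (Metric.ball y₀ R).indicator f y * mollifier ε (y - x) := by
          intro ε hε
          obtain ⟨C, hC⟩ := (hasCompactSupport_mollifier hε).exists_bound_of_continuous
            (contDiff_mollifier ε).continuous
          exact ((integrable_indicator_iff hB).2 hf).mul_bdd (c := C)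
            ((contDiff_mollifier ε).continuous.comp (by fun_prop)).aestronglyMeasurable
            (.of_forall fun y ↦ hC _)
        rw [← sub_eq_zero, ← integral_sub (hint _ hR4) (hint _ hδ)]
        have h1 := hfx x hx δ hδ hδR
        rw [← integral_indicator hB] at h1
        have h2 := congrArg (fun t ↦ (1 / 2 : ℝ) * t) h1
        simp only [mul_zero] at h2
        rw [← integral_const_mul] at h2
        rw [← h2]
        refine integral_congr_ae (.of_forall fun y ↦ ?_)
        by_cases hy : y ∈ Metric.ball y₀ R
        · simp only [Set.indicator_of_mem hy]; ring
        · simp only [Set.indicator_of_notMem hy]; ring)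
    refine ⟨P, hP, ?_⟩
    rw [Filter.EventuallyEq, ae_restrict_iff' hB2] at hfP ⊢
    filter_upwards [hfP] with y hy hyB
    rw [← hy hyB, Set.indicator_of_mem (hsub hyB)]
  have htest : ∀ x ∈ Metric.ball y₀ (R / 2), ∀ δ, 0 < δ → δ < R / 4 → ∀ a b : E2 → ℝ,
      ContDiff ℝ ∞ a → ContDiff ℝ ∞ b →
      (∀ y, a y = 0 ∨ stepQuot (R / 4) δ (‖y - x‖ ^ 2) ≠ 0) →
      (∀ y, b y = 0 ∨ stepQuot (R / 4) δ (‖y - x‖ ^ 2) ≠ 0) →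
      ∫ y in Metric.ball y₀ R, (p y * (pd 0 a y - pd 1 b y) + q y * (pd 0 b y + pd 1 a y)) = 0 := by
    intro x hx δ hδ hδR a b ha hb ha0 hb0
    have hsupp : Function.support (fun y ↦ (WithLp.toLp 2 ![a y, b y] : E2))
        ⊆ Metric.closedBall x (R / 4) := by
      intro y hy
      by_contra hn
      rw [Metric.mem_closedBall, dist_eq_norm, not_le] at hn
      have h0 : stepQuot (R / 4) δ (‖y - x‖ ^ 2) = 0 :=
        stepQuot_of_ge hδ hδR (pow_lt_pow_left₀ hn hR4.le two_ne_zero).le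
      refine hy ?_
      ext i
      fin_cases i
      · simpa using (ha0 y).resolve_right (not_not.2 h0)
      · simpa using (hb0 y).resolve_right (not_not.2 h0)
    have hts := closure_minimal hsupp Metric.isClosed_closedBall
    have := h (fun y ↦ WithLp.toLp 2 ![a y, b y]) (by
        intro i
        fin_cases i
        · simpa using ha
        · simpa using hb)
      (HasCompactSupport.of_support_subset_isCompact (isCompact_closedBall x (R / 4)) hsupp)
      (hts.trans (by
        intro y hy
        rw [Metric.mem_closedBall] at hy
        rw [Metric.mem_ball] at hx ⊢
        linarith [dist_triangle y x y₀]))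
    simpa using this
  have hrel : ∀ x y : E2, ∀ δ, 0 < δ → δ < R / 4 →
      mollifier (R / 4) (y - x) - mollifier δ (y - x)
        = deriv (stepQuot (R / 4) δ) (‖y - x‖ ^ 2) * ((y 0 - x 0) ^ 2 + (y 1 - x 1) ^ 2)
          + stepQuot (R / 4) δ (‖y - x‖ ^ 2) := by
    intro x y δ hδ hδR
    rw [← norm_sub_sq_eq, deriv_stepQuot hδ hδR]
    rfl
  constructor
  · refine key p hp fun x hx δ hδ hδR ↦ ?_
    have hk := contDiff_stepQuot hδ hδR
    -- With k radial, the field ((y⁰ - x⁰)k, -(y¹ - x¹)k) has ∂₀ξ¹ + ∂₁ξ⁰ = 0, and ∂₀ξ⁰ - ∂₁ξ¹ is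
    -- twice the difference of mollifiers. It isolates p.
    rw [← htest x hx δ hδ hδR _ (fun y ↦ -((y 1 - x 1) * stepQuot (R / 4) δ (‖y - x‖ ^ 2)))
      (contDiff_coord_mul hk x 0) (contDiff_coord_mul hk x 1).neg
      (fun y ↦ by rw [mul_eq_zero]; tauto) (fun y ↦ by rw [neg_eq_zero, mul_eq_zero]; tauto)]
    refine integral_congr_ae (.of_forall fun y ↦ ?_)
    simp only [pd_neg, pd_coord_mul hk, hrel x y δ hδ hδR]
    simp
    ring
  · refine key q hq fun x hx δ hδ hδR ↦ ?_
    have hk := contDiff_stepQuot hδ hδR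
    -- The field ((y¹ - x¹)k, (y⁰ - x⁰)k) exchanges the two roles and isolates q.
    rw [← htest x hx δ hδ hδR _ _ (contDiff_coord_mul hk x 1) (contDiff_coord_mul hk x 0)
      (fun y ↦ by rw [mul_eq_zero]; tauto) (fun y ↦ by rw [mul_eq_zero]; tauto)]
    refine integral_congr_ae (.of_forall fun y ↦ ?_)
    simp only [pd_coord_mul hk, hrel x y δ hδ hδR]
    simp
    ring

end TTSurface

namespace TTSurface

open MeasureTheory Filter Topology

/-! ### Projections in incomplete inner product spaces -/

/-- If weak limits of Cauchy sequences that become orthogonal to `K` exist, then the orthogonal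
projection onto the closure of `K` exists. -/
theorem exists_orthogonal_of_weak_limits {F : Type*} [NormedAddCommGroup F] [InnerProductSpace ℝ F]
    (K : Submodule ℝ F) (κ : F)
    (hreg : ∀ τ : ℕ → F, CauchySeq τ → (∀ s ∈ K, Tendsto (fun n ↦ inner ℝ (τ n) s) atTop (𝓝 0)) →
      ∃ θ : F, ∀ η, Tendsto (fun n ↦ inner ℝ (τ n) η) atTop (𝓝 (inner ℝ θ η))) :
    ∃ θ : F, (∀ s ∈ K, inner ℝ θ s = 0) ∧ κ - θ ∈ closure (K : Set F) := by
  let ι : F →L[ℝ] UniformSpace.Completion F := UniformSpace.Completion.toComplL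
  let K' : Submodule ℝ (UniformSpace.Completion F) :=
    (K.map (ι : F →ₗ[ℝ] UniformSpace.Completion F)).topologicalClosure
  have : CompleteSpace K' := (Submodule.isClosed_topologicalClosure _).completeSpace_coe
  -- The projection exists in the completion. It is approximated by s n ∈ K, and κ - s n is then
  -- Cauchy and asymptotically orthogonal to K.
  have hP : K'.starProjection (κ : UniformSpace.Completion F) ∈ K' :=
    Submodule.starProjection_apply_mem _ _
  have hP' : K'.starProjection (κ : UniformSpace.Completion F)
      ∈ closure ((K.map (ι : F →ₗ[ℝ] UniformSpace.Completion F) : Submodule ℝ _) : Set _) := hP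
  obtain ⟨w, hw, hwl⟩ := mem_closure_iff_seq_limit.1 hP'
  choose s hs hsw using fun n ↦ Submodule.mem_map.1 (hw n)
  have hsl : Tendsto (fun n ↦ (s n : UniformSpace.Completion F)) atTop
      (𝓝 (K'.starProjection (κ : UniformSpace.Completion F))) := by
    refine hwl.congr fun n ↦ ?_
    rw [← hsw n]
    rfl
  have hτl : Tendsto (fun n ↦ ((κ - s n : F) : UniformSpace.Completion F)) atTop
      (𝓝 ((κ : UniformSpace.Completion F) - K'.starProjection (κ : UniformSpace.Completion F))) := by
    simp only [UniformSpace.Completion.coe_sub]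
    exact tendsto_const_nhds.sub hsl
  set p := (κ : UniformSpace.Completion F) - K'.starProjection (κ : UniformSpace.Completion F)
    with hp
  have hKp : ∀ t ∈ K, inner ℝ p (t : UniformSpace.Completion F) = 0 := fun t ht ↦
    Submodule.starProjection_inner_eq_zero _ _
      (Submodule.le_topologicalClosure _ (Submodule.mem_map_of_mem ht))
  have hinner : ∀ η : F, Tendsto (fun n ↦ inner ℝ (κ - s n) η) atTop
      (𝓝 (inner ℝ p (η : UniformSpace.Completion F))) := by
    intro η
    refine (hτl.inner (tendsto_const_nhds (x := (η : UniformSpace.Completion F)))).congr fun n ↦ ?_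
    rw [UniformSpace.Completion.inner_coe]
  have hcau : CauchySeq fun n ↦ κ - s n := by
    have := hτl.cauchySeq
    rw [CauchySeq, show (fun n ↦ ((κ - s n : F) : UniformSpace.Completion F))
      = (fun v : F ↦ (v : UniformSpace.Completion F)) ∘ fun n ↦ κ - s n from rfl,
      ← Filter.map_map] at this
    exact ((UniformSpace.Completion.isUniformInducing_coe F).cauchy_map_iff).1 this
  obtain ⟨θ, hθ⟩ := hreg (fun n ↦ κ - s n) hcau fun t ht ↦ by
    have := hinner t
    rwa [hKp t ht] at this
  -- The weak limit in F and the strong limit in the completion have the same pairings with the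
  -- dense subspace F, so the residual of the projection already lies in F.
  have hpθ : p = (θ : UniformSpace.Completion F) := by
    rw [← sub_eq_zero]
    refine UniformSpace.Completion.denseRange_coe.eq_zero_of_inner_left ℝ fun η ↦ ?_
    rw [inner_sub_left, UniformSpace.Completion.inner_coe,
      tendsto_nhds_unique (hinner η) (hθ η), sub_self]
  refine ⟨θ, fun t ht ↦ ?_, ?_⟩
  · rw [← UniformSpace.Completion.inner_coe, ← hpθ, hKp t ht]
  · refine mem_closure_of_tendsto (f := s) (b := atTop) ?_ (.of_forall hs)
    rw [(UniformSpace.Completion.isUniformInducing_coe F).isInducing.tendsto_nhds_iff]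
    rw [UniformSpace.Completion.coe_sub, ← hpθ, hp, sub_sub_cancel]
    exact hsl

/-! ### The space of smooth symmetric trace-free tensors -/

variable {M : Type*} [TopologicalSpace M] [ChartedSpace E2 M] [IsManifold 𝓘(ℝ, E2) ∞ M]

lemma repAt_zero (e : OpenPartialHomeomorph M E2) (x : M) : repAt (0 : Tens M) e x = 0 := by
  ext i j
  simp [repAt]

lemma repAt_eq_zero {h : Tens M} {x : M} (hx : h x = 0) (e : OpenPartialHomeomorph M E2) :
    repAt h e x = 0 := by
  ext i j
  simp only [repAt, hx, Matrix.of_apply, Matrix.zero_apply]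
  rfl

variable {g : Metric M}

lemma STF.add {h k : Tens M} (hh : STF g h) (hk : STF g k) : STF g (h + k) where
  symm x v w := by
    change h x v w + k x v w = h x w v + k x w v
    rw [hh.symm, hk.symm]
  mtr x := by rw [repAt_add, mtr_add, hh.mtr, hk.mtr, add_zero]

lemma STF.smul (c : ℝ) {h : Tens M} (hh : STF g h) : STF g (c • h) where
  symm x v w := by
    change c * h x v w = c * h x w v
    rw [hh.symm]
  mtr x := by rw [repAt_smul, mtr_smul, hh.mtr, mul_zero]

lemma stf_zero : STF g (0 : Tens M) where
  symm x v w := rfl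
  mtr x := by rw [repAt_zero]; simp [mtr]

lemma tinner_comm (h k : Tens M) (x : M) : tinner g h k x = tinner g k h x := by
  have hp := (Metric.isPosMat (isChart_chartAt x) g (mem_chart_source E2 x)).inv
  exact minner_comm hp.symm _ _

lemma tinner_add_left (h h' k : Tens M) (x : M) :
    tinner g (h + h') k x = tinner g h k x + tinner g h' k x := by
  simp only [tinner, repAt_add, minner_add_left]

lemma tinner_smul_left (c : ℝ) (h k : Tens M) (x : M) :
    tinner g (c • h) k x = c * tinner g h k x := by
  simp only [tinner, repAt_smul, minner_smul_left]

lemma tinner_eq_zero_of_left {h : Tens M} {x : M} (hx : h x = 0) (k : Tens M) :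
    tinner g h k x = 0 := by
  rw [tinner, repAt_eq_zero hx]
  simp [minner]

lemma STF.eq_zero_of_tinner_self {h : Tens M} (hh : STF g h) {x : M} (hx : tinner g h h x = 0) :
    h x = 0 := by
  have h0 : repAt h (chartAt E2 x) x = 0 :=
    (Metric.isPosMat (isChart_chartAt x) g (mem_chart_source E2 x)).eq_zero_of_minner_self
      (hh.repAt_symm _ _) (hh.mtr x) hx
  ext v w
  rw [apply_eq_repAt (isChart_chartAt x) h (mem_chart_source E2 x) v w, h0]
  simp

variable [T2Space M] [CompactSpace M] [MeasurableSpace M] [BorelSpace M]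

lemma integrable_tinner {h k : Tens M} (hh : TSmooth h) (hk : TSmooth k) :
    Integrable (tinner g h k) (areaMeasure g) :=
  integrable_of_continuous g (fSmooth_tinner g hh hk).continuous

set_option synthInstance.maxHeartbeats 400000 in
instance instAddCommGroupTensor2 : AddCommGroup (Tensor2 M) := inferInstance

set_option synthInstance.maxHeartbeats 400000 in
instance instModuleTensor2 : Module ℝ (Tensor2 M) := inferInstance

variable (g) in
/-- The smooth symmetric trace-free tensors. -/
def tfSubmodule : Submodule ℝ (Tensor2 M) where
  carrier := {h | STF g fun x ↦ h x}
  add_mem' ha hb := STF.add ha hb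
  zero_mem' := stf_zero
  smul_mem' c _ h := STF.smul c h

variable (g) in
/-- The space of smooth symmetric trace-free tensors, with the `L²` inner product. -/
def TFTens : Type _ := tfSubmodule g

instance : AddCommGroup (TFTens g) := inferInstanceAs (AddCommGroup (tfSubmodule g))

instance : Module ℝ (TFTens g) := inferInstanceAs (Module ℝ (tfSubmodule g))

/-- The section underlying an element of `TFTens g`. -/
def TFTens.sec (h : TFTens g) : Tensor2 M := Subtype.val h

/-- The tensor underlying an element of `TFTens g`. -/
def TFTens.val (h : TFTens g) : Tens M := fun x ↦ h.sec x

lemma TFTens.tSmooth (h : TFTens g) : TSmooth h.val := h.sec.tSmooth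

lemma TFTens.stf (h : TFTens g) : STF g h.val := Subtype.prop h

lemma TFTens.val_add (h k : TFTens g) : (h + k).val = h.val + k.val := rfl

lemma TFTens.val_smul (c : ℝ) (h : TFTens g) : (c • h).val = c • h.val := rfl

lemma TFTens.sec_sub (h k : TFTens g) : (h - k).sec = h.sec - k.sec := rfl

lemma TFTens.val_zero : (0 : TFTens g).val = 0 := rfl

lemma TFTens.ext {h k : TFTens g} (hk : h.val = k.val) : h = k :=
  Subtype.ext (DFunLike.ext _ _ (congrFun hk))

/-- The element of `TFTens g` given by a smooth symmetric trace-free tensor. -/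
def mkTFTens (h : Tens M) (hs : TSmooth h) (hh : STF g h) : TFTens g := ⟨mkTensor2 h hs, hh⟩

lemma mkTFTens_val (h : Tens M) (hs : TSmooth h) (hh : STF g h) : (mkTFTens h hs hh).val = h := rfl

lemma TFTens.eq_zero_of_l2 (h : TFTens g) (h0 : l2 g h.val h.val = 0) : h = 0 := by
  have hc := (fSmooth_tinner g h.tSmooth h.tSmooth).continuous
  have h1 := (integral_eq_zero_iff_of_nonneg (tinner_self_nonneg g h.stf)
    (integrable_tinner h.tSmooth h.tSmooth)).1 h0
  have h2 : tinner g h.val h.val = 0 := (hc.ae_eq_iff_eq (areaMeasure g) continuous_const).1 h1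
  exact TFTens.ext (funext fun x ↦ h.stf.eq_zero_of_tinner_self (congrFun h2 x))

instance : InnerProductSpace.Core ℝ (TFTens g) where
  inner h k := l2 g h.val k.val
  conj_inner_symm h k := by
    simp only [l2, starRingEnd_apply, star_trivial]
    exact integral_congr_ae (.of_forall fun x ↦ tinner_comm _ _ _)
  re_inner_nonneg h := integral_nonneg (tinner_self_nonneg g h.stf)
  add_left h h' k := by
    simp only [l2, TFTens.val_add, tinner_add_left]
    exact integral_add (integrable_tinner h.tSmooth k.tSmooth)
      (integrable_tinner h'.tSmooth k.tSmooth)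
  smul_left h k c := by
    simp only [l2, TFTens.val_smul, tinner_smul_left, starRingEnd_apply, star_trivial]
    exact integral_const_mul _ _
  definite h h0 := h.eq_zero_of_l2 h0

instance : NormedAddCommGroup (TFTens g) :=
  InnerProductSpace.Core.toNormedAddCommGroup (𝕜 := ℝ)

instance : InnerProductSpace ℝ (TFTens g) := InnerProductSpace.ofCore _

lemma TFTens.inner_eq (h k : TFTens g) : inner ℝ h k = l2 g h.val k.val := rfl

lemma TFTens.inner_eq_l2Inner (h k : TFTens g) : inner ℝ h k = l2Inner g h.sec k.sec := by
  rw [l2Inner_eq]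
  rfl

variable (g) in
/-- The image of `X ↦ lieT g X`. -/
def tfLieRange : Submodule ℝ (TFTens g) where
  carrier := {h | ∃ X : VF M, VSmooth X ∧ h.val = lieT g X}
  add_mem' := by
    rintro h k ⟨X, hX, h1⟩ ⟨Y, hY, h2⟩
    exact ⟨X + Y, hX.add hY, by rw [lieT_add g hX hY, TFTens.val_add, h1, h2]⟩
  zero_mem' := ⟨(0 : ℝ) • (0 : VF M), vSmooth_zero.smul 0, by
    rw [lieT_smul g 0 vSmooth_zero, zero_smul, TFTens.val_zero]⟩
  smul_mem' := by
    rintro c h ⟨X, hX, h1⟩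
    exact ⟨c • X, hX.smul c, by rw [lieT_smul g c hX, TFTens.val_smul, h1]⟩

end TTSurface

namespace TTSurface

open MeasureTheory Filter Topology

/-! ### Weak limits in isothermal coordinates -/

/-- Completeness of L² gives a strong limit; only its pairings are needed afterwards. -/
lemma exists_weak_limit_of_memLp {α : Type*} [MeasurableSpace α] {μ : Measure α} {p : ℕ → α → ℝ}
    (hp : ∀ n, MemLp (p n) 2 μ)
    (hc : ∀ ε, 0 < ε → ∃ N, ∀ m ≥ N, ∀ n ≥ N, ∫ y, (p m y - p n y) ^ 2 ∂μ < ε) :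
    ∃ f, MemLp f 2 μ ∧ ∀ a, MemLp a 2 μ →
      Tendsto (fun n ↦ ∫ y, p n y * a y ∂μ) atTop (𝓝 (∫ y, f y * a y ∂μ)) := by
  have hinner : ∀ {u v : α → ℝ} (hu : MemLp u 2 μ) (hv : MemLp v 2 μ),
      inner ℝ (hu.toLp u) (hv.toLp v) = ∫ y, u y * v y ∂μ := by
    intro u v hu hv
    rw [L2.inner_def]
    refine integral_congr_ae ?_
    filter_upwards [hu.coeFn_toLp, hv.coeFn_toLp] with y h1 h2
    rw [h1, h2]
    simp [mul_comm]
  have hcau : CauchySeq fun n ↦ (hp n).toLp (p n) := by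
    rw [Metric.cauchySeq_iff]
    intro ε hε
    obtain ⟨N, hN⟩ := hc (ε ^ 2) (by positivity)
    refine ⟨N, fun m hm n hn ↦ ?_⟩
    rw [dist_eq_norm, ← MemLp.toLp_sub]
    refine lt_of_pow_lt_pow_left₀ 2 hε.le ?_
    rw [← real_inner_self_eq_norm_sq, hinner]
    refine lt_of_le_of_lt (le_of_eq ?_) (hN m hm n hn)
    exact integral_congr_ae (.of_forall fun y ↦ by simp only [Pi.sub_apply, sq])
  obtain ⟨F, hF⟩ := cauchySeq_tendsto_of_complete hcau
  have hFm : MemLp F 2 μ := Lp.memLp F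
  refine ⟨F, hFm, fun a ha ↦ ?_⟩
  have h1 := Filter.Tendsto.inner (𝕜 := ℝ) hF (tendsto_const_nhds (x := ha.toLp a))
  rw [← Lp.toLp_coeFn F hFm] at h1
  simpa only [hinner] using h1

variable {M : Type*} [TopologicalSpace M] [ChartedSpace E2 M] [IsManifold 𝓘(ℝ, E2) ∞ M]
  {g : Metric M} {e : OpenPartialHomeomorph M E2}

/-- For the Euclidean metric S is the Cauchy–Riemann operator applied to ξ⁰ + iξ¹. -/
lemma lieTF_one {ξ : E2 → E2} (y : E2) :
    lieTF (fun _ ↦ (1 : Mat)) ξ y 0 0 = pd 0 (fun z ↦ ξ z 0) y - pd 1 (fun z ↦ ξ z 1) y ∧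
      lieTF (fun _ ↦ (1 : Mat)) ξ y 0 1 = pd 0 (fun z ↦ ξ z 1) y + pd 1 (fun z ↦ ξ z 0) y := by
  have hpd : ∀ (k : Fin 2) (c : ℝ), pd k (fun _ ↦ c) y = 0 := fun k c ↦ by simp [pd]
  constructor
  · simp [lieTF, dv, mtr, lie, hpd, Fin.sum_univ_two]
    ring
  · simp [lieTF, dv, mtr, lie, hpd, Fin.sum_univ_two]
    ring

lemma lieTF_congr_metric {γ γ' : E2 → Mat} {ξ : E2 → E2} {U : Set E2} (hU : IsOpen U) {y : E2}
    (hy : y ∈ U) (h : ∀ z ∈ U, γ z = γ' z) : lieTF γ ξ y = lieTF γ' ξ y := by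
  have h1 : ∀ k i j, pd k (fun z ↦ γ z i j) y = pd k (fun z ↦ γ' z i j) y := fun k i j ↦
    pd_congr_of_isOpen hU hy fun z hz ↦ by rw [h z hz]
  simp only [lieTF, dv, lie, h1, h y hy]

namespace IsIsothermal

variable (he : IsIsothermal g e) {y : E2} (hy : y ∈ e.target)
include he hy

lemma rep_pos : 0 < rep g.inner e y 0 0 := by
  obtain ⟨s, hs, h⟩ := he.2 y hy
  rw [h]
  simpa using hs

lemma rep_eq : rep g.inner e y = rep g.inner e y 0 0 • (1 : Mat) := by
  obtain ⟨s, hs, h⟩ := he.2 y hy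
  rw [h]
  simp

lemma dens_eq : dens g e y = rep g.inner e y 0 0 := by
  obtain ⟨s, hs, h⟩ := he.2 y hy
  rw [dens, h]
  simp [Real.sqrt_sq hs.le]

/-- With conformal factor s, area contributes s and the inner product s⁻². The remaining s⁻¹ cancels
against the factor s in `rep_lieT_localVF`, which makes the pairing with S X Euclidean. -/
lemma dens_mul_tinner {h k : Tens M} (hh : STF g h) (hk : STF g k) :
    dens g e y * tinner g h k (e.symm y) = 2 * (rep g.inner e y 0 0)⁻¹ *
      (rep h e y 0 0 * rep k e y 0 0 + rep h e y 0 1 * rep k e y 0 1) := by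
  have hx := e.map_target hy
  have hpos := he.rep_pos hy
  have h1 := (Metric.isPosMat he.1 g hx).minner_eq (hh.repAt_symm e _) (hk.repAt_symm e _)
    (hh.mtr_apply he.1 hx) (hk.mtr_apply he.1 hx)
  rw [he.dens_eq hy, tinner_apply g he.1 hx]
  change rep g.inner e y 0 0 ^ 2 * minner (rep g.inner e y) (rep h e y) (rep k e y)
    = 2 * rep h e y 0 0 * rep k e y 0 0 + 2 * (rep g.inner e y 0 0 * rep h e y 0 1
      - rep g.inner e y 0 1 * rep h e y 0 0) * (rep g.inner e y 0 0 * rep k e y 0 1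
      - rep g.inner e y 0 1 * rep k e y 0 0) / (rep g.inner e y).det at h1
  change rep g.inner e y 0 0 * minner (rep g.inner e y) (rep h e y) (rep k e y) = _
  have h01 : rep g.inner e y 0 1 = 0 := by rw [he.rep_eq hy]; simp
  have hdet : (rep g.inner e y).det = rep g.inner e y 0 0 ^ 2 := by
    conv_lhs => rw [he.rep_eq hy]
    simp
  rw [h01, hdet] at h1
  set s := rep g.inner e y 0 0
  set m := minner (rep g.inner e y) (rep h e y) (rep k e y)
  have hs := hpos.ne'
  simp only [zero_mul, sub_zero] at h1
  have h2 : s ^ 2 * m = 2 * (rep h e y 0 0 * rep k e y 0 0 + rep h e y 0 1 * rep k e y 0 1) := by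
    rw [h1]
    field_simp
  field_simp
  linear_combination h2

lemma rep_lieT_localVF [T2Space M] {ξ : E2 → E2} (hX : VSmooth (localVF e ξ)) :
    rep (lieT g (localVF e ξ)) e y 0 0
        = rep g.inner e y 0 0 * (pd 0 (fun z ↦ ξ z 0) y - pd 1 (fun z ↦ ξ z 1) y) ∧
      rep (lieT g (localVF e ξ)) e y 0 1
        = rep g.inner e y 0 0 * (pd 0 (fun z ↦ ξ z 1) y + pd 1 (fun z ↦ ξ z 0) y) := by
  have h1 : rep (lieT g (localVF e ξ)) e y
      = lieTF (fun z ↦ rep g.inner e z 0 0 • (1 : Mat)) ξ y := by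
    rw [rep_lieT hX he.1 hy, lieTF_congr_of_eqOn e.open_target hy
      (fun z hz ↦ vrep_localVF he.1 ξ hz)]
    exact lieTF_congr_metric e.open_target hy fun z hz ↦ he.rep_eq hz
  have h2 := lieTF_conformal (γ := fun _ ↦ (1 : Mat)) (ξ := ξ) (c := fun z ↦ rep g.inner e z 0 0)
    ((Metric.isMetricOn he.1 g).differentiableAt hy 0 0) (he.rep_pos hy).ne'
    (fun i j ↦ differentiableAt_const _) (by simp) (by simp)
  rw [h1, h2, Matrix.smul_apply, Matrix.smul_apply, (lieTF_one y).1, (lieTF_one y).2]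
  exact ⟨rfl, rfl⟩

end IsIsothermal

lemma lieT_eq_zero {X : VF M} {x : M} (h : ∀ᶠ z in 𝓝 x, X z = 0) : lieT g X x = 0 := by
  have hx := mem_chart_source E2 x
  have hcont := (chartAt E2 x).continuousAt_symm (mem_chart_target E2 x)
  rw [ContinuousAt, (chartAt E2 x).left_inv hx] at hcont
  obtain ⟨U, hU, hUo, hxU⟩ := eventually_nhds_iff.1 (hcont.eventually h)
  have h0 : lieTF (rep g.inner (chartAt E2 x)) (vrep X (chartAt E2 x)) (chartAt E2 x x) = 0 := by
    rw [lieTF_congr_of_eqOn (ξ' := fun _ ↦ 0) hUo hxU fun z hz ↦ by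
      simp only [vrep, vrepAt, hU z hz, map_zero]]
    have hpd : ∀ (k : Fin 2) (c : ℝ), pd k (fun _ : E2 ↦ c) (chartAt E2 x x) = 0 :=
      fun k c ↦ by simp [pd]
    ext i j
    simp [lieTF, dv, mtr, lie, hpd]
  ext v w
  rw [lieT, tensOf, h0, bilinOf_apply]
  simp

variable [T2Space M] [CompactSpace M] [MeasurableSpace M] [BorelSpace M]

lemma integrableOn_chart (he : IsChart e) {f : M → ℝ} (hf : Continuous f) :
    IntegrableOn (fun y ↦ dens g e y * f (e.symm y)) e.target := by
  have h1 := (integrable_of_continuous g hf).restrict (s := e.source)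
  have hs : AEMeasurable e.symm (chartMeasure g e) :=
    (aemeasurable_symm e).mono_ac (withDensity_absolutelyContinuous _ _)
  have hm := h1.aestronglyMeasurable
  rw [restrict_areaMeasure g he] at h1 hm
  rw [integrable_map_measure hm hs, chartMeasure,
    integrable_withDensity_iff_integrable_smul₀' (aemeasurable_dens g he)
      (.of_forall fun _ ↦ ENNReal.ofReal_lt_top)] at h1
  refine h1.congr ?_
  filter_upwards [ae_restrict_mem e.open_target.measurableSet] with y hy
  rw [ENNReal.toReal_ofReal (dens_pos g he hy).le, smul_eq_mul]
  rfl

lemma setIntegral_chart_le (he : IsChart e) {f : M → ℝ} (hf : Continuous f) (h0 : ∀ x, 0 ≤ f x)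
    {B : Set E2} (hB : B ⊆ e.target) :
    ∫ y in B, dens g e y * f (e.symm y) ≤ ∫ x, f x ∂areaMeasure g := by
  calc ∫ y in B, dens g e y * f (e.symm y) ≤ ∫ y in e.target, dens g e y * f (e.symm y) := by
        refine setIntegral_mono_set (integrableOn_chart he hf) ?_ (.of_forall hB)
        filter_upwards [ae_restrict_mem e.open_target.measurableSet] with y hy
        exact mul_nonneg (dens_pos g he hy).le (h0 _)
    _ = ∫ x in e.source, f x ∂areaMeasure g :=
        (setIntegral_areaMeasure g he (integrable_of_continuous g hf).aestronglyMeasurable).symm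
    _ ≤ ∫ x, f x ∂areaMeasure g :=
        setIntegral_le_integral (integrable_of_continuous g hf) (.of_forall h0)

lemma integral_eq_setIntegral_chart (he : IsChart e) {f : M → ℝ} (hf : Continuous f) {B : Set E2}
    (hB : B ⊆ e.target) (h0 : ∀ x, (x ∈ e.source → e x ∉ B) → f x = 0) :
    ∫ x, f x ∂areaMeasure g = ∫ y in B, dens g e y * f (e.symm y) := by
  rw [← setIntegral_eq_integral_of_forall_compl_eq_zero (s := e.source)
      (fun x hx ↦ h0 x fun h ↦ absurd h hx),
    setIntegral_areaMeasure g he (integrable_of_continuous g hf).aestronglyMeasurable]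
  refine setIntegral_eq_of_subset_of_forall_sdiff_eq_zero e.open_target.measurableSet hB ?_
  intro y hy
  rw [h0 _ fun _ ↦ by rw [e.right_inv hy.1]; exact hy.2, mul_zero]

lemma memLp_of_continuousOn_closedBall {y₀ : E2} {R : ℝ} {f : E2 → ℝ}
    (hf : ContinuousOn f (Metric.closedBall y₀ R)) :
    MemLp f 2 (volume.restrict (Metric.ball y₀ R)) := by
  have : IsFiniteMeasure ((volume : Measure E2).restrict (Metric.ball y₀ R)) :=
    ⟨by rw [Measure.restrict_apply_univ]; exact measure_ball_lt_top⟩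
  obtain ⟨C, hC⟩ := (isCompact_closedBall y₀ R).exists_bound_of_continuousOn hf
  refine MemLp.of_bound ((hf.mono Metric.ball_subset_closedBall).aestronglyMeasurable
    Metric.isOpen_ball.measurableSet) C ?_
  filter_upwards [ae_restrict_mem Metric.isOpen_ball.measurableSet] with y hy
  exact hC y (Metric.ball_subset_closedBall hy)

section

variable (he : IsIsothermal g e) {y₀ : E2} {R : ℝ} (hB : Metric.closedBall y₀ R ⊆ e.target)
include he hB

/-- The conformal factor is bounded on the closed ball, so the L² norm controls the components;
Cauchy sequences of tensors become Cauchy sequences of functions. -/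
lemma exists_integral_sq_le : ∃ C, 0 < C ∧ ∀ (h : TFTens g) (j : Fin 2),
    ∫ y in Metric.ball y₀ R, rep h.val e y 0 j ^ 2 ≤ C * ‖h‖ ^ 2 := by
  have hcont := (((Metric.isMetricOn he.1 g).smooth 0 0).continuousOn).mono hB
  obtain ⟨C, hC⟩ := (isCompact_closedBall y₀ R).exists_bound_of_continuousOn hcont
  have hsub : Metric.ball y₀ R ⊆ e.target := Metric.ball_subset_closedBall.trans hB
  refine ⟨|C| + 1, by positivity, fun h j ↦ ?_⟩
  have hc := (fSmooth_tinner g h.tSmooth h.tSmooth).continuous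
  have h1 := setIntegral_chart_le (g := g) he.1 hc (tinner_self_nonneg g h.stf) hsub
  rw [← real_inner_self_eq_norm_sq, TFTens.inner_eq, l2]
  refine le_trans ?_ (mul_le_mul_of_nonneg_left h1 (by positivity))
  rw [← integral_const_mul]
  refine setIntegral_mono_on ?_ (((integrableOn_chart he.1 hc).mono_set hsub).const_mul _)
    Metric.isOpen_ball.measurableSet fun y hy ↦ ?_
  · exact (memLp_of_continuousOn_closedBall (((h.tSmooth e he.1 0 j).continuousOn).mono hB)).integrable_sq
  · rw [he.dens_mul_tinner (hsub hy) h.stf h.stf]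
    have hpos := he.rep_pos (hsub hy)
    have hle := hC y (Metric.ball_subset_closedBall hy)
    rw [Real.norm_of_nonneg hpos.le] at hle
    have hCs : 1 ≤ (|C| + 1) * (rep g.inner e y 0 0)⁻¹ := by
      rw [← div_eq_mul_inv, le_div_iff₀ hpos]
      linarith [le_abs_self C]
    have hsq : rep h.val e y 0 j ^ 2 ≤ rep h.val e y 0 0 * rep h.val e y 0 0
        + rep h.val e y 0 1 * rep h.val e y 0 1 := by
      fin_cases j
      · simp only [Fin.zero_eta]; nlinarith [mul_self_nonneg (rep h.val e y 0 1)]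
      · simp only [Fin.mk_one]; nlinarith [mul_self_nonneg (rep h.val e y 0 0)]
    set S := rep h.val e y 0 0 * rep h.val e y 0 0 + rep h.val e y 0 1 * rep h.val e y 0 1
    have hS : 0 ≤ S := (sq_nonneg _).trans hsq
    calc rep h.val e y 0 j ^ 2 ≤ S := hsq
      _ ≤ ((|C| + 1) * (rep g.inner e y 0 0)⁻¹) * S := le_mul_of_one_le_left hS hCs
      _ ≤ _ := by
        have : 0 ≤ ((|C| + 1) * (rep g.inner e y 0 0)⁻¹) * S := by positivity
        linarith

/-- The conformal factors cancel, and orthogonality to S X for X supported in the chart becomes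
literally the hypothesis of `weyl_lemma`. -/
lemma inner_localVF (h : TFTens g) {ξ : E2 → E2} (hc : HasCompactSupport ξ) (hs : tsupport ξ ⊆ Metric.ball y₀ R)
    (hX : VSmooth (localVF e ξ)) :
    l2 g h.val (lieT g (localVF e ξ)) = 2 * ∫ y in Metric.ball y₀ R,
      (rep h.val e y 0 0 * (pd 0 (fun z ↦ ξ z 0) y - pd 1 (fun z ↦ ξ z 1) y)
        + rep h.val e y 0 1 * (pd 0 (fun z ↦ ξ z 1) y + pd 1 (fun z ↦ ξ z 0) y)) := by
  have hsub : Metric.ball y₀ R ⊆ e.target := Metric.ball_subset_closedBall.trans hB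
  have hK : IsCompact (e.symm '' tsupport ξ) :=
    hc.image_of_continuousOn (e.continuousOn_symm.mono (hs.trans hsub))
  rw [l2, integral_eq_setIntegral_chart he.1
    (fSmooth_tinner g h.tSmooth (tSmooth_lieT g hX)).continuous hsub, ← integral_const_mul]
  · refine setIntegral_congr_fun Metric.isOpen_ball.measurableSet fun y hy ↦ ?_
    have hp := (he.rep_pos (hsub hy)).ne'
    obtain ⟨h1, h2⟩ := he.rep_lieT_localVF (hsub hy) hX
    simp only [he.dens_mul_tinner (hsub hy) h.stf (stf_lieT hX), h1, h2]
    field_simp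
  · intro x hx
    have hxK : x ∉ e.symm '' tsupport ξ := by
      rintro ⟨y, hy, rfl⟩
      have hyB := hs hy
      refine hx (e.map_target (hsub hyB)) ?_
      rwa [e.right_inv (hsub hyB)]
    rw [tinner_comm]
    refine tinner_eq_zero_of_left (lieT_eq_zero ?_) _
    filter_upwards [hK.isClosed.isOpen_compl.mem_nhds hxK] with z hz using localVF_eq_zero hz

/-- The components converge in L² of the ball. Asymptotic orthogonality to the range of S passes to
the limit as the weak Cauchy–Riemann system, so the limits are smooth on the half ball. -/
theorem exists_weak_limit_chart (hR : 0 < R) {τ : ℕ → TFTens g} (hτ : CauchySeq τ)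
    (h0 : ∀ s ∈ tfLieRange g, Tendsto (fun n ↦ inner ℝ (τ n) s) atTop (𝓝 0)) :
    ∃ P Q : E2 → ℝ, ContDiff ℝ ∞ P ∧ ContDiff ℝ ∞ Q ∧ ∀ a b : E2 → ℝ,
      ContinuousOn a (Metric.closedBall y₀ R) → ContinuousOn b (Metric.closedBall y₀ R) →
      Tendsto (fun n ↦ ∫ y in Metric.ball y₀ (R / 2),
          (rep (τ n).val e y 0 0 * a y + rep (τ n).val e y 0 1 * b y)) atTop
        (𝓝 (∫ y in Metric.ball y₀ (R / 2), (P y * a y + Q y * b y))) := by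
  have hsub : Metric.ball y₀ R ⊆ e.target := Metric.ball_subset_closedBall.trans hB
  have hball : Metric.ball y₀ (R / 2) ⊆ Metric.ball y₀ R := Metric.ball_subset_ball (by linarith)
  have hm : MeasurableSet (Metric.ball y₀ (R / 2)) := Metric.isOpen_ball.measurableSet
  have : IsFiniteMeasure ((volume : Measure E2).restrict (Metric.ball y₀ R)) :=
    ⟨by rw [Measure.restrict_apply_univ]; exact measure_ball_lt_top⟩
  obtain ⟨C, hC, hCle⟩ := exists_integral_sq_le he hB
  have hLp : ∀ (h : TFTens g) j, MemLp (fun y ↦ rep h.val e y 0 j) 2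
      (volume.restrict (Metric.ball y₀ R)) := fun h j ↦
    memLp_of_continuousOn_closedBall (((h.tSmooth e he.1 0 j).continuousOn).mono hB)
  have hlim : ∀ j : Fin 2, ∃ f, MemLp f 2 (volume.restrict (Metric.ball y₀ R)) ∧
      ∀ a, MemLp a 2 (volume.restrict (Metric.ball y₀ R)) →
      Tendsto (fun n ↦ ∫ y in Metric.ball y₀ R, rep (τ n).val e y 0 j * a y) atTop
        (𝓝 (∫ y in Metric.ball y₀ R, f y * a y)) := by
    intro j
    refine exists_weak_limit_of_memLp (fun n ↦ hLp (τ n) j) fun ε hε ↦ ?_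
    -- The bound is C times the square of the norm.
    obtain ⟨N, hN⟩ := Metric.cauchySeq_iff.1 hτ (√(ε / C)) (by positivity)
    refine ⟨N, fun m hm n hn ↦ ?_⟩
    have h1 := hCle (τ m - τ n) j
    have h2 := hN m hm n hn
    rw [dist_eq_norm, Real.lt_sqrt (norm_nonneg _), lt_div_iff₀ hC] at h2
    refine lt_of_le_of_lt ?_ (lt_of_le_of_lt h1 (by linarith))
    exact le_of_eq rfl
  obtain ⟨p, hp, hpl⟩ := hlim 0
  obtain ⟨q, hq, hql⟩ := hlim 1
  have hint : ∀ {u v : E2 → ℝ}, MemLp u 2 (volume.restrict (Metric.ball y₀ R)) →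
      MemLp v 2 (volume.restrict (Metric.ball y₀ R)) →
      IntegrableOn (fun y ↦ u y * v y) (Metric.ball y₀ R) := fun hu hv ↦ hu.integrable_mul hv
  have hadd : ∀ a b, MemLp a 2 (volume.restrict (Metric.ball y₀ R)) →
      MemLp b 2 (volume.restrict (Metric.ball y₀ R)) →
      Tendsto (fun n ↦ ∫ y in Metric.ball y₀ R,
        (rep (τ n).val e y 0 0 * a y + rep (τ n).val e y 0 1 * b y)) atTop
        (𝓝 (∫ y in Metric.ball y₀ R, (p y * a y + q y * b y))) := by
    intro a b ha hb
    rw [integral_add (hint hp ha) (hint hq hb)]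
    refine ((hpl a ha).add (hql b hb)).congr fun n ↦ ?_
    rw [integral_add (hint (hLp _ 0) ha) (hint (hLp _ 1) hb)]
  obtain ⟨⟨P, hP, hpP⟩, Q, hQ, hqQ⟩ := weyl_lemma hR
    (hp.integrable (by norm_num)) (hq.integrable (by norm_num)) (by
      intro ξ hξ hc hs
      have hX : VSmooth (localVF e ξ) := vSmooth_localVF he.1 hξ hc (hs.trans hsub)
      have hpd : ∀ i j, ContinuousOn (pd i fun z ↦ ξ z j) (Metric.closedBall y₀ R) := fun i j ↦
        ((contDiffOn_pd isOpen_univ (hξ j).contDiffOn i).continuousOn).mono (Set.subset_univ _)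
      have h1 := hadd _ _ (memLp_of_continuousOn_closedBall ((hpd 0 0).sub (hpd 1 1)))
        (memLp_of_continuousOn_closedBall ((hpd 0 1).add (hpd 1 0)))
      have h2 := (h0 (mkTFTens _ (tSmooth_lieT g hX) (stf_lieT hX)) ⟨_, hX, rfl⟩).const_mul (1 / 2)
      rw [mul_zero] at h2
      refine tendsto_nhds_unique h1 (h2.congr fun n ↦ ?_)
      rw [TFTens.inner_eq, mkTFTens_val, inner_localVF he hB (τ n) hc hs hX]
      simp)
  refine ⟨P, Q, hP, hQ, fun a b ha hb ↦ ?_⟩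
  -- Test functions need only be L², so cutting them off to the half ball, where the limits are
  -- smooth, is allowed.
  have h1 := hadd _ _ ((memLp_of_continuousOn_closedBall ha).indicator hm)
    ((memLp_of_continuousOn_closedBall hb).indicator hm)
  have hrestr : ∀ u v : E2 → ℝ, ∫ y in Metric.ball y₀ R,
      (u y * (Metric.ball y₀ (R / 2)).indicator a y + v y * (Metric.ball y₀ (R / 2)).indicator b y)
      = ∫ y in Metric.ball y₀ (R / 2), (u y * a y + v y * b y) := by
    intro u v
    rw [setIntegral_eq_of_subset_of_forall_sdiff_eq_zero Metric.isOpen_ball.measurableSet hball]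
    · refine setIntegral_congr_fun hm fun y hy ↦ ?_
      simp only [Set.indicator_of_mem hy]
    · intro y hy
      simp only [Set.indicator_of_notMem hy.2, mul_zero, add_zero]
  simp only [hrestr] at h1
  have h2 : ∫ y in Metric.ball y₀ (R / 2), (p y * a y + q y * b y)
      = ∫ y in Metric.ball y₀ (R / 2), (P y * a y + Q y * b y) := by
    refine integral_congr_ae ?_
    filter_upwards [hpP, hqQ] with y h3 h4
    rw [h3, h4]
  rwa [h2] at h1

end

end TTSurface

namespace TTSurface

open MeasureTheory Filter Topology

/-! ### Gluing local weak limits -/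

variable {M : Type*} [TopologicalSpace M] [ChartedSpace E2 M] [IsManifold 𝓘(ℝ, E2) ∞ M]
  {g : Metric M} {e : OpenPartialHomeomorph M E2}

/-- The tensor which is `χ (P (dx² - dy²) + 2 Q dx dy)` in the chart `e`. -/
def localTens (e : OpenPartialHomeomorph M E2) (χ : M → ℝ) (P Q : E2 → ℝ) : Tens M := fun x ↦
  bilinOf e x (χ x • !![P (e x), Q (e x); Q (e x), -P (e x)])

section localTens

variable {χ : M → ℝ} {P Q : E2 → ℝ}

lemma localTens_eq_zero {x : M} (hx : χ x = 0) : localTens e χ P Q x = 0 := by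
  ext v w
  rw [localTens, bilinOf_apply, hx]
  simp

lemma repAt_localTens (he : IsChart e) {x : M} (hx : x ∈ e.source) :
    repAt (localTens e χ P Q) e x = χ x • !![P (e x), Q (e x); Q (e x), -P (e x)] :=
  repAt_bilinOf he hx _ rfl

lemma tSmooth_localTens (he : IsChart e) (hχ : FSmooth χ) (hs : tsupport χ ⊆ e.source)
    (hP : ContDiff ℝ ∞ P) (hQ : ContDiff ℝ ∞ Q) : TSmooth (localTens e χ P Q) := by
  refine tSmooth_of_local fun x ↦ ?_
  by_cases hx : x ∈ e.source
  · refine ⟨e, he, hx, fun i j ↦ ?_⟩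
    have hχ' : ContDiffAt ℝ ∞ (fun y ↦ χ (e.symm y)) (e x) :=
      (hχ e he).contDiffAt (e.open_target.mem_nhds (e.map_source hx))
    have h1 : ContDiffAt ℝ ∞ (fun y ↦ χ (e.symm y) * !![P y, Q y; Q y, -P y] i j) (e x) := by
      refine hχ'.mul ?_
      fin_cases i <;> fin_cases j
      · simpa using hP.contDiffAt
      · simpa using hQ.contDiffAt
      · simpa using hQ.contDiffAt
      · simpa using hP.contDiffAt.neg
    refine h1.congr_of_eventuallyEq ?_
    filter_upwards [e.open_target.mem_nhds (e.map_source hx)] with y hy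
    rw [rep, repAt_localTens he (e.map_target hy), e.right_inv hy, Matrix.smul_apply, smul_eq_mul]
  · have hx' : x ∉ tsupport χ := fun h ↦ hx (hs h)
    set c := chartAt E2 x with hcd
    have hxc : x ∈ c.source := mem_chart_source E2 x
    refine ⟨c, isChart_chartAt x, hxc, fun i j ↦
      (contDiffAt_const (c := (0 : ℝ))).congr_of_eventuallyEq ?_⟩
    have hcont : ContinuousAt c.symm (c x) := c.continuousAt_symm (c.map_source hxc)
    have : (tsupport χ)ᶜ ∈ 𝓝 (c.symm (c x)) := by
      rw [c.left_inv hxc]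
      exact (isClosed_tsupport χ).isOpen_compl.mem_nhds hx'
    filter_upwards [hcont.preimage_mem_nhds this] with y hy
    rw [rep, repAt_eq_zero (localTens_eq_zero (image_eq_zero_of_notMem_tsupport hy)),
      Matrix.zero_apply]

/-- The matrix is trace-free for the identity, hence for any multiple of it; this is where the chart
must be isothermal. -/
lemma stf_localTens (he : IsIsothermal g e) (hs : tsupport χ ⊆ e.source) :
    STF g (localTens e χ P Q) where
  symm x v w := by
    simp only [localTens, bilinOf_apply, Fin.sum_univ_two, Matrix.smul_apply]
    simp
    ring
  mtr x := by
    by_cases hx : x ∈ e.source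
    · have h1 := he.rep_eq (e.map_source hx)
      rw [rep_apply_chart _ hx] at h1
      have hp := he.rep_pos (e.map_source hx)
      rw [rep_apply_chart _ hx] at hp
      rw [mtr_repAt g he.1 hx, repAt_localTens he.1 hx, mtr, h1,
        inv_smul_mat hp.ne' (by simp)]
      simp [Fin.sum_univ_two]
    · have h0 : χ x = 0 := image_eq_zero_of_notMem_tsupport fun h ↦ hx (hs h)
      rw [repAt_eq_zero (localTens_eq_zero h0)]
      simp [mtr]

end localTens

variable [T2Space M] [CompactSpace M] [MeasurableSpace M] [BorelSpace M]

/-- The cutoff confines the pairing to the half ball, where the limit components P and Q are smooth;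
multiplied by χ they define a global smooth tensor. -/
lemma exists_localTens_weak_limit (he : IsIsothermal g e) {y₀ : E2} {R : ℝ} (hR : 0 < R)
    (hB : Metric.closedBall y₀ R ⊆ e.target) {τ : ℕ → TFTens g} (hτ : CauchySeq τ)
    (h0 : ∀ s ∈ tfLieRange g, Tendsto (fun n ↦ inner ℝ (τ n) s) atTop (𝓝 0))
    {χ : M → ℝ} (hχ : FSmooth χ)
    (hs : tsupport χ ⊆ e.source ∩ e ⁻¹' Metric.ball y₀ (R / 2)) :
    ∃ θ : TFTens g, ∀ η : TFTens g,
      Tendsto (fun n ↦ ∫ x, χ x * tinner g (τ n).val η.val x ∂areaMeasure g) atTop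
        (𝓝 (inner ℝ θ η)) := by
  obtain ⟨P, Q, hP, hQ, hlim⟩ := exists_weak_limit_chart he hB hR hτ h0
  have hs' : tsupport χ ⊆ e.source := fun x hx ↦ (hs hx).1
  have hsub : Metric.ball y₀ (R / 2) ⊆ e.target :=
    (Metric.ball_subset_ball (by linarith)).trans (Metric.ball_subset_closedBall.trans hB)
  have hout : ∀ x, (x ∈ e.source → e x ∉ Metric.ball y₀ (R / 2)) → χ x = 0 := fun x hx ↦
    image_eq_zero_of_notMem_tsupport fun h ↦ hx (hs h).1 (hs h).2
  refine ⟨mkTFTens _ (tSmooth_localTens he.1 hχ hs' hP hQ) (stf_localTens he hs'), fun η ↦ ?_⟩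
  have hcoef : ∀ j, ContinuousOn (fun y ↦ χ (e.symm y) * (2 * (rep g.inner e y 0 0)⁻¹
      * rep η.val e y 0 j)) (Metric.closedBall y₀ R) := fun j ↦
    (((hχ e he.1).continuousOn).mul ((continuousOn_const.mul
      ((((Metric.isMetricOn he.1 g).smooth 0 0).continuousOn).inv₀ fun y hy ↦
        (he.rep_pos hy).ne')).mul (η.tSmooth e he.1 0 j).continuousOn)).mono hB
  have h1 := hlim _ _ (hcoef 0) (hcoef 1)
  have hθ : inner ℝ (mkTFTens _ (tSmooth_localTens he.1 hχ hs' hP hQ) (stf_localTens he hs')) η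
      = ∫ y in Metric.ball y₀ (R / 2),
        (P y * (χ (e.symm y) * (2 * (rep g.inner e y 0 0)⁻¹ * rep η.val e y 0 0))
          + Q y * (χ (e.symm y) * (2 * (rep g.inner e y 0 0)⁻¹ * rep η.val e y 0 1))) := by
    rw [TFTens.inner_eq, mkTFTens_val, l2, integral_eq_setIntegral_chart he.1
      (fSmooth_tinner g (tSmooth_localTens he.1 hχ hs' hP hQ) η.tSmooth).continuous hsub fun x hx ↦
        tinner_eq_zero_of_left (localTens_eq_zero (hout x hx)) _]
    refine setIntegral_congr_fun Metric.isOpen_ball.measurableSet fun y hy ↦ ?_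
    have hr : rep (localTens e χ P Q) e y = χ (e.symm y) • !![P y, Q y; Q y, -P y] := by
      rw [rep, repAt_localTens he.1 (e.map_target (hsub hy)), e.right_inv (hsub hy)]
    simp only [he.dens_mul_tinner (hsub hy) (stf_localTens he hs') η.stf, hr, Matrix.smul_apply]
    simp
    ring
  rw [hθ]
  refine h1.congr fun n ↦ ?_
  rw [integral_eq_setIntegral_chart (f := fun x ↦ χ x * tinner g (τ n).val η.val x) he.1
    (hχ.continuous.mul (fSmooth_tinner g (τ n).tSmooth η.tSmooth).continuous) hsub fun x hx ↦ by
      rw [hout x hx, zero_mul]]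
  refine setIntegral_congr_fun Metric.isOpen_ball.measurableSet fun y hy ↦ ?_
  rw [mul_left_comm (dens g e y), he.dens_mul_tinner (hsub hy) (τ n).stf η.stf]
  ring

/-- Sum the limits of ρᵢ τₙ over a finite partition of unity. Each summand is determined by its own
pairings, so no compatibility of the local limits on overlaps has to be checked. -/
theorem exists_weak_limit (hiso : ∀ x : M, ∃ e, IsIsothermal g e ∧ x ∈ e.source)
    {τ : ℕ → TFTens g} (hτ : CauchySeq τ)
    (h0 : ∀ s ∈ tfLieRange g, Tendsto (fun n ↦ inner ℝ (τ n) s) atTop (𝓝 0)) :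
    ∃ θ : TFTens g, ∀ η, Tendsto (fun n ↦ inner ℝ (τ n) η) atTop (𝓝 (inner ℝ θ η)) := by
  choose e he hxe using hiso
  have hrad : ∀ x, ∃ R, 0 < R ∧ Metric.closedBall (e x x) R ⊆ (e x).target := fun x ↦
    Metric.nhds_basis_closedBall.mem_iff.1
      ((e x).open_target.mem_nhds ((e x).map_source (hxe x)))
  choose R hR hB using hrad
  let N : M → Set M := fun x ↦ (e x).source ∩ e x ⁻¹' Metric.ball (e x x) (R x / 2)
  have hNo : ∀ x, IsOpen (N x) := fun x ↦ (e x).isOpen_inter_preimage Metric.isOpen_ball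
  have hNx : ∀ x, x ∈ N x := fun x ↦ ⟨hxe x, Metric.mem_ball_self (by linarith [hR x])⟩
  obtain ⟨t, ht⟩ := isCompact_univ.elim_finite_subcover N hNo
    fun x _ ↦ Set.mem_iUnion.2 ⟨x, hNx x⟩
  obtain ⟨ρ, hρ⟩ := SmoothPartitionOfUnity.exists_isSubordinate 𝓘(ℝ, E2) isClosed_univ
    (fun i : t ↦ N i) (fun i ↦ hNo i) (by
      intro x hx
      obtain ⟨i, hi, hxi⟩ := Set.mem_iUnion₂.1 (ht hx)
      exact Set.mem_iUnion.2 ⟨⟨i, hi⟩, hxi⟩)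
  have hρs : ∀ i, FSmooth (ρ i) := fun i ↦ fSmooth_of_contMDiff (ρ i).contMDiff
  have hρ1 : ∀ x, ∑ i, ρ i x = 1 := fun x ↦ by
    rw [← finsum_eq_sum_of_fintype]
    exact ρ.sum_eq_one (Set.mem_univ x)
  choose θ hθ using fun i : t ↦
    exists_localTens_weak_limit (he i) (hR i) (hB i) hτ h0 (hρs i) (hρ i)
  refine ⟨∑ i, θ i, fun η ↦ ?_⟩
  rw [sum_inner]
  refine (tendsto_finsetSum _ fun i _ ↦ hθ i η).congr fun n ↦ ?_
  rw [TFTens.inner_eq, l2, ← integral_finsetSum]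
  · refine integral_congr_ae (.of_forall fun x ↦ ?_)
    simp only
    rw [← Finset.sum_mul, hρ1, one_mul]
  · intro i _
    exact integrable_of_continuous g ((hρs i).continuous.mul
      (fSmooth_tinner g (τ n).tSmooth η.tSmooth).continuous)

end TTSurface

namespace TTSurface

open MeasureTheory Filter Topology

/-! ### The transverse-traceless projection -/

lemma IsPosMat.sq_le_cquad_mul_mquad {γ : Mat} (hγ : IsPosMat γ) (α : Fin 2 → ℝ) (v : E2) :
    (α 0 * v 0 + α 1 * v 1) ^ 2 ≤ cquad γ α * mquad γ v := by
  obtain ⟨i0, i1, i2, i3⟩ := inv_apply_fin_two γ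
  have hd := hγ.det_eq
  have hD := hγ.det_pos
  rw [← hd] at hD
  have h1 : cquad γ α * mquad γ v - (α 0 * v 0 + α 1 * v 1) ^ 2
      = ((γ 1 1 * α 0 - γ 0 1 * α 1) * v 1 - (γ 0 0 * α 1 - γ 0 1 * α 0) * v 0) ^ 2 / γ.det := by
    rw [hγ.mquad_eq]
    simp only [cquad, Fin.sum_univ_two, i0, i1, i2, i3, hγ.symm]
    field_simp
    rw [hd]
    ring
  have h2 : 0 ≤ ((γ 1 1 * α 0 - γ 0 1 * α 1) * v 1 - (γ 0 0 * α 1 - γ 0 1 * α 0) * v 0) ^ 2 / γ.det :=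
    by positivity
  linarith

lemma IsPosMat.cquad_nonneg {γ : Mat} (hγ : IsPosMat γ) (α : Fin 2 → ℝ) : 0 ≤ cquad γ α := by
  have h := hγ.inv.mquad_nonneg (WithLp.toLp 2 α)
  simpa [mquad, cquad] using h

/-- Cauchy–Schwarz in the form suited to pairings of a covector with a vector: the integral of a t²
+ 2 f t + b is nonnegative for all t, so its discriminant is nonpositive. -/
lemma sq_integral_le {α : Type*} [MeasurableSpace α] {μ : Measure α} {f a b : α → ℝ}
    (hf : Integrable f μ) (ha : Integrable a μ) (hb : Integrable b μ) (ha0 : ∀ x, 0 ≤ a x)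
    (hb0 : ∀ x, 0 ≤ b x) (h : ∀ x, f x ^ 2 ≤ a x * b x) :
    (∫ x, f x ∂μ) ^ 2 ≤ (∫ x, a x ∂μ) * ∫ x, b x ∂μ := by
  have key : ∀ t : ℝ, 0 ≤ (∫ x, a x ∂μ) * (t * t) + (2 * ∫ x, f x ∂μ) * t + ∫ x, b x ∂μ := by
    intro t
    have h1 : (∫ x, a x ∂μ) * (t * t) + (2 * ∫ x, f x ∂μ) * t + ∫ x, b x ∂μ
        = ∫ x, (t * t * a x + 2 * t * f x + b x) ∂μ := by
      have i1 := ha.const_mul (t * t)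
      have i2 := hf.const_mul (2 * t)
      have i3 : Integrable (fun x ↦ t * t * a x + 2 * t * f x) μ := i1.add i2
      rw [integral_add i3 hb, integral_add i1 i2, integral_const_mul, integral_const_mul]
      ring
    rw [h1]
    refine integral_nonneg fun x ↦ ?_
    rcases (ha0 x).eq_or_lt with h0 | h0
    · have h2 := h x
      rw [← h0, zero_mul] at h2
      have h3 : f x = 0 := by nlinarith [sq_nonneg (f x)]
      simp only [← h0, h3, Pi.zero_apply]
      linarith [hb0 x]
    · refine nonneg_of_mul_nonneg_right (a := a x) ?_ h0
      nlinarith [h x, sq_nonneg (a x * t + f x)]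
  have := discrim_le_zero key
  rw [discrim] at this
  linarith

variable {M : Type*} [TopologicalSpace M] [ChartedSpace E2 M] [IsManifold 𝓘(ℝ, E2) ∞ M]

/-- Smooth global fields with constant coordinates near a point, by means of a bump function; they
serve to test one-forms locally. -/
lemma exists_vSmooth_eq_frame [T2Space M] {e : OpenPartialHomeomorph M E2} (he : IsChart e) {x₀ : M}
    (hx₀ : x₀ ∈ e.source) (v : E2) : ∃ X : VF M, VSmooth X ∧ ∀ᶠ x in 𝓝 x₀, X x = frame e x v := by
  obtain ⟨R, hR, hB⟩ := Metric.nhds_basis_closedBall.mem_iff.1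
    (e.open_target.mem_nhds (e.map_source hx₀))
  let f : ContDiffBump (e x₀) := ⟨R / 2, R, by positivity, by linarith⟩
  have hsupp : Function.support (fun y ↦ f y • v) ⊆ Metric.closedBall (e x₀) R := by
    intro y hy
    have hy' : y ∈ Function.support f := left_ne_zero_of_smul hy
    rw [f.support_eq] at hy'
    exact Metric.ball_subset_closedBall hy'
  refine ⟨localVF e fun y ↦ f y • v, vSmooth_localVF he (fun i ↦ ?_)
    (HasCompactSupport.of_support_subset_isCompact (isCompact_closedBall _ _) hsupp)
    ((closure_minimal hsupp Metric.isClosed_closedBall).trans hB), ?_⟩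
  · simp only [PiLp.smul_apply, smul_eq_mul]
    exact f.contDiff.mul contDiff_const
  · filter_upwards [e.open_source.mem_nhds hx₀, (e.continuousAt hx₀).preimage_mem_nhds
      (Metric.closedBall_mem_nhds (e x₀) (show 0 < R / 2 by positivity))] with x hx hx'
    rw [localVF, if_pos hx, f.one_of_mem_closedBall hx', one_smul]

variable {g : Metric M}

lemma sq_apply_le_covectorNormSq (X : VF M) (x : M) (α : TangentSpace 𝓘(ℝ, E2) x →L[ℝ] ℝ) :
    α (X x) ^ 2 ≤ covectorNormSq g x α * g.inner x (X x) (X x) := by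
  have hx := mem_chart_source E2 x
  have hc := isChart_chartAt x
  have h1 := (Metric.isPosMat hc g hx).sq_le_cquad_mul_mquad
    (fun i ↦ α (frame (chartAt E2 x) x (stdVec i))) (vrepAt X (chartAt E2 x) x)
  rw [covectorNormSq_eq, inner_eq_mquad g hc hx]
  refine le_trans (le_of_eq ?_) h1
  congr 1
  conv_lhs => rw [← frame_coord hc hx (X x), eq_sum_stdVec (coord (chartAt E2 x) x (X x))]
  simp only [map_add, map_smul, smul_eq_mul, vrepAt]
  ring

lemma covectorNormSq_nonneg (x : M) (α : TangentSpace 𝓘(ℝ, E2) x →L[ℝ] ℝ) :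
    0 ≤ covectorNormSq g x α := by
  rw [covectorNormSq_eq]
  exact (Metric.isPosMat (isChart_chartAt x) g (mem_chart_source E2 x)).cquad_nonneg _

variable [T2Space M] [CompactSpace M] [MeasurableSpace M] [BorelSpace M]

/-- Near each point the norm is a combination of pairings of δh with smooth fields, and these are
smooth by the integration by parts identity. -/
lemma continuous_covectorNormSq_divergence {h : Tensor2 M} (hh : STF g fun x ↦ h x) :
    Continuous fun x ↦ covectorNormSq g x (divergence g h x) := by
  refine continuous_iff_continuousAt.2 fun x₀ ↦ ?_
  set e := chartAt E2 x₀ with hedef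
  have he : IsChart e := isChart_chartAt x₀
  have hx₀ : x₀ ∈ e.source := mem_chart_source E2 x₀
  choose X hX hXe using fun i ↦ exists_vSmooth_eq_frame he hx₀ (stdVec i)
  have hinv : ∀ i j, ContinuousAt (fun x ↦ (rep g.inner e (e x))⁻¹ i j) x₀ := fun i j ↦
    ContinuousAt.comp (f := e) (g := fun y ↦ (rep g.inner e y)⁻¹ i j)
      (((Metric.isMetricOn he g).contDiffOn_inv i j).continuousOn.continuousAt
        (e.open_target.mem_nhds (e.map_source hx₀))) (e.continuousAt hx₀)
  have hc : ContinuousAt (fun x ↦ ∑ i, ∑ j, (rep g.inner e (e x))⁻¹ i j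
      * divergence g h x (X i x) * divergence g h x (X j x)) x₀ := by
    refine tendsto_finsetSum _ fun i _ ↦ tendsto_finsetSum _ fun j _ ↦ ?_
    exact ((hinv i j).mul (fSmooth_divergence_apply g hh (hX i)).continuous.continuousAt).mul
      (fSmooth_divergence_apply g hh (hX j)).continuous.continuousAt
  refine hc.congr ?_
  filter_upwards [e.open_source.mem_nhds hx₀, hXe 0, hXe 1] with x hx h0 h1
  rw [covectorNormSq_apply g he hx, cquad, rep_apply_chart _ hx]
  simp only [Fin.sum_univ_two, h0, h1]

/-- Orthogonality is tested on the field (δh)(X) X, where X has the prescribed value at the point;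
the adjoint formula then gives ∫ ((δh)(X))² = 0. -/
lemma divergence_eq_zero_of_orthogonal {h : Tensor2 M} (hh : STF g fun x ↦ h x)
    (h0 : ∀ X : VF M, VSmooth X → l2 g (fun x ↦ h x) (lieT g X) = 0) (x : M) :
    divergence g h x = 0 := by
  ext v
  have he := isChart_chartAt x
  have hx := mem_chart_source E2 x
  obtain ⟨X, hX, hXe⟩ := exists_vSmooth_eq_frame he hx (coord (chartAt E2 x) x v)
  have hf := fSmooth_divergence_apply g hh hX
  have h1 := h0 _ (hX.fmul hf)
  rw [l2_lieT g hh (hX.fmul hf)] at h1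
  simp only [map_smul, smul_eq_mul, mul_eq_zero, OfNat.ofNat_ne_zero, false_or] at h1
  have hc : Continuous fun x ↦ divergence g h x (X x) * divergence g h x (X x) :=
    hf.continuous.mul hf.continuous
  have h2 := (integral_eq_zero_iff_of_nonneg (fun x ↦ mul_self_nonneg (divergence g h x (X x)))
    (integrable_of_continuous g hc)).1 h1
  have h3 := congrFun ((hc.ae_eq_iff_eq (areaMeasure g) continuous_const).1 h2) x
  have h4 := mul_self_eq_zero.1 h3
  rwa [hXe.self_of_nhds, frame_coord he hx] at h4

/-- ⟨h, S X⟩ = 2 ∫ (δh)(X) ≤ 2 ‖δh‖ ‖X‖, and ‖X‖ is absorbed by the coercivity hypothesis. -/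
lemma l2_lieT_le {h : Tensor2 M} (hh : STF g fun x ↦ h x) {X : VF M} (hX : VSmooth X) {c : ℝ}
    (hc : ∫ x, g.inner x (X x) (X x) ∂areaMeasure g ≤ c * l2 g (lieT g X) (lieT g X)) :
    l2 g (fun x ↦ h x) (lieT g X)
      ≤ 2 * √c * l2NormForm g (divergence g h) * √(l2 g (lieT g X) (lieT g X)) := by
  have hcont := continuous_covectorNormSq_divergence hh
  have hL : 0 ≤ l2 g (lieT g X) (lieT g X) :=
    integral_nonneg (tinner_self_nonneg g (stf_lieT hX))
  have hA : 0 ≤ ∫ x, covectorNormSq g x (divergence g h x) ∂areaMeasure g :=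
    integral_nonneg fun x ↦ covectorNormSq_nonneg x _
  have h1 := sq_integral_le
    (integrable_of_continuous g (fSmooth_divergence_apply g hh hX).continuous)
    (integrable_of_continuous g hcont) (integrable_of_continuous g (fSmooth_inner g hX).continuous)
    (fun x ↦ covectorNormSq_nonneg x _) (inner_self_nonneg' g X)
    fun x ↦ sq_apply_le_covectorNormSq X x _
  have h2 := h1.trans (mul_le_mul_of_nonneg_left hc hA)
  have h3 := Real.le_sqrt_of_sq_le h2
  rw [Real.sqrt_mul hA, Real.sqrt_mul' _ hL] at h3
  rw [l2_lieT g hh hX, l2NormForm]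
  linarith

lemma IsTT.l2_lieT_eq_zero {h : Tensor2 M} (hh : IsTT g h) {X : VF M} (hX : VSmooth X) :
    l2 g (fun x ↦ h x) (lieT g X) = 0 := by
  rw [l2_lieT g hh.toIsSymmTraceFree.stf hX]
  simp [hh.divergence_eq_zero]

theorem existsUnique_ttProjection (hiso : ∀ x : M, ∃ e, IsIsothermal g e ∧ x ∈ e.source) {c : ℝ}
    (hcoer : ∀ X : VF M, VSmooth X →
      ∫ x, g.inner x (X x) (X x) ∂areaMeasure g ≤ c * l2 g (lieT g X) (lieT g X))
    {κ : Tensor2 M} (hκ : IsSymmTraceFree g κ) :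
    (∃! τ : Tensor2 M, IsTTProjection g κ τ) ∧
      l2Norm g (ttProjection g κ - κ) ≤ 2 * √c * l2NormForm g (divergence g κ) := by
  let k : TFTens g := ⟨κ, hκ.stf⟩
  obtain ⟨θ, hθ, hcl⟩ := exists_orthogonal_of_weak_limits (tfLieRange g) k
    fun τ hτ h0 ↦ exists_weak_limit hiso hτ h0
  have hTT : IsTT g θ.sec := by
    refine ⟨STF.isSymmTraceFree (h := θ.sec) θ.stf,
      divergence_eq_zero_of_orthogonal (h := θ.sec) θ.stf fun X hX ↦ ?_⟩
    exact hθ (mkTFTens _ (tSmooth_lieT g hX) (stf_lieT hX)) ⟨X, hX, rfl⟩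
  have hproj : IsTTProjection g κ θ.sec := by
    refine ⟨hTT, fun η hη ↦ ?_⟩
    let η' : TFTens g := ⟨η, hη.toIsSymmTraceFree.stf⟩
    -- Orthogonality to a transverse-traceless tensor is a closed condition that holds on the range
    -- of S, hence on its closure, which contains κ - θ.
    have hset : closure (tfLieRange g : Set (TFTens g)) ⊆ {s | inner ℝ s η' = 0} := by
      refine closure_minimal ?_ (isClosed_eq (continuous_id.inner continuous_const) continuous_const)
      rintro s ⟨X, hX, hs⟩
      rw [Set.mem_ofPred_eq, real_inner_comm, TFTens.inner_eq, hs]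
      exact hη.l2_lieT_eq_zero hX
    have h1 : inner ℝ (k - θ) η' = 0 := hset hcl
    rwa [TFTens.inner_eq_l2Inner, TFTens.sec_sub] at h1
  have huniq : ∀ τ : Tensor2 M, IsTTProjection g κ τ → τ = θ.sec := by
    intro τ hτ
    let t : TFTens g := ⟨τ, hτ.1.toIsSymmTraceFree.stf⟩
    have h1 : ∀ η : TFTens g, IsTT g η.sec → inner ℝ (k - t) η = 0 ∧ inner ℝ (k - θ) η = 0 := by
      intro η hη
      rw [TFTens.inner_eq_l2Inner, TFTens.inner_eq_l2Inner, TFTens.sec_sub, TFTens.sec_sub]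
      exact ⟨hτ.2 _ hη, hproj.2 _ hη⟩
    -- Both residuals are orthogonal to t and to θ, so their difference t - θ is orthogonal to
    -- itself.
    have h2 : inner ℝ (t - θ) (t - θ) = 0 := by
      have e1 := h1 t hτ.1
      have e2 := h1 θ hTT
      have e3 : t - θ = (k - θ) - (k - t) := by abel
      conv_lhs => rw [e3]
      rw [inner_sub_left, ← e3, inner_sub_right, inner_sub_right, e1.1, e1.2, e2.1, e2.2]
      simp
    have h3 := inner_self_eq_zero.1 h2
    exact congrArg TFTens.sec (sub_eq_zero.1 h3)
  refine ⟨⟨θ.sec, hproj, huniq⟩, ?_⟩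
  have hε : ttProjection g κ = θ.sec := huniq _ (Classical.epsilon_spec ⟨θ.sec, hproj⟩)
  have hN : 0 ≤ l2NormForm g (divergence g κ) := Real.sqrt_nonneg _
  have hD : 0 ≤ 2 * √c * l2NormForm g (divergence g κ) := by positivity
  -- The inequality is closed in s and holds on the range of S, where θ contributes nothing. Taking
  -- s = κ - θ bounds ‖κ - θ‖² by a multiple of ‖κ - θ‖.
  have hset : closure (tfLieRange g : Set (TFTens g))
      ⊆ {s | inner ℝ (k - θ) s ≤ 2 * √c * l2NormForm g (divergence g κ) * ‖s‖} := by
    refine closure_minimal ?_ (isClosed_le (continuous_const.inner continuous_id)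
      (continuous_const.mul continuous_norm))
    intro s hs
    obtain ⟨X, hX, hsX⟩ := id hs
    rw [Set.mem_ofPred_eq, inner_sub_left, hθ s hs, sub_zero, norm_eq_sqrt_real_inner,
      TFTens.inner_eq, TFTens.inner_eq, hsX]
    exact l2_lieT_le hκ.stf hX (hcoer X hX)
  have h1 : inner ℝ (k - θ) (k - θ) ≤ 2 * √c * l2NormForm g (divergence g κ) * ‖k - θ‖ := hset hcl
  rw [real_inner_self_eq_norm_mul_norm] at h1
  have h2 : l2Norm g (ttProjection g κ - κ) = ‖k - θ‖ := by
    rw [hε, norm_sub_rev, norm_eq_sqrt_real_inner, l2Norm, TFTens.inner_eq_l2Inner,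
      TFTens.sec_sub]
    rfl
  rw [h2]
  rcases (norm_nonneg (k - θ)).eq_or_lt with h | h
  · rw [← h]; exact hD
  · exact le_of_mul_le_mul_right h1 h

end TTSurface

end

theorem mainTheorem4 (r : ℝ) :
    ∃ C : ℝ, 0 < C ∧
      ∀ (M : Type*) [TopologicalSpace M] [T2Space M] [CompactSpace M]
        [ChartedSpace TTSurface.E2 M] [IsManifold 𝓘(ℝ, TTSurface.E2) ∞ M]
        [MeasurableSpace M] [BorelSpace M]
        (g G : TTSurface.Metric M) (u : M → ℝ),
        ContMDiff 𝓘(ℝ, TTSurface.E2) 𝓘(ℝ, ℝ) ∞ u →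
        (∀ x, G.inner x = Real.exp (2 * u x) • g.inner x) →
        TTSurface.IsHyperbolic G →
        (∀ x, |u x| ≤ r) →
        ∀ κ : TTSurface.Tensor2 M, TTSurface.IsSymmTraceFree g κ →
          (∃! τ : TTSurface.Tensor2 M, TTSurface.IsTTProjection g κ τ) ∧
          TTSurface.l2Norm g (TTSurface.ttProjection g κ - κ) ≤
            C * TTSurface.l2NormForm g (TTSurface.divergence g κ) := by
  -- This is 2√c for the coercivity constant c = e^{6r}/2 of `integral_inner_le_of_conformal`.
  refine ⟨2 * √(Real.exp (6 * r) / 2), by positivity, ?_⟩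
  intro M _ _ _ _ _ _ _ g G u hu hG hhyp hr κ hκ
  refine TTSurface.existsUnique_ttProjection (fun x ↦ ?_) (fun X hX ↦ ?_) hκ
  · obtain ⟨e, he, hx⟩ := TTSurface.exists_isothermal hhyp x
    exact ⟨e, TTSurface.IsIsothermal.of_conformal hG he, hx⟩
  · exact TTSurface.integral_inner_le_of_conformal (TTSurface.fSmooth_of_contMDiff hu) hG hhyp hr hX
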